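/- All matroids have finite ground sets. For a matroid $M$ and bases $B_1,B_2$, a pair of bases $(D_1,D_2)$ is obtained from $(B_1,B_2)$ by a double swap if $D_1=(B_1\setminus\{e\})\cup\{f\}$ and $D_2=(B_2\setminus\{f\})\cup\{e\}$ for some $e\in B_1$, $f\in B_2$. Two sequences of bases $\mathcal B=(B_1,\dots,B_n)$ and $\mathcal D=(D_1,\dots,D_n)$ of $M$ are compatible if $B_1\cup\dots\cup B_n=D_1\cup\dots\cup D_n$ as multisets. A symmetric exchange replaces the bases at two distinct positions of a sequence by a pair obtained from them by a double swap. Write $\mathcal B\sim_1\mathcal D$ if $\mathcal D$ is obtained from $\mathcal B$ by a (possibly empty) composition of symmetric exchanges, and $\mathcal B\sim_2\mathcal D$ if $\mathcal D$ is obtained from $\mathcal B$ by a composition of symmetric exchanges and permutations of the order of the bases. For $i=1,2$ let $TE(i)$ be the class of matroids $M$ such that for all $n\ge 2$ and all compatible sequences $\mathcal B,\mathcal D$ of $n$ bases of $M$ one has $\mathcal B\sim_i\mathcal D$. A matroid is strongly base orderable if for any two bases $B_1,B_2$ there is a bijection $\pi:B_1\to B_2$ such that $(B_1\setminus A)\cup\pi(A)$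 is a basis for every $A\subseteq B_1$. A matroid is graphical if it is the cycle matroid of a finite multigraph (loops and parallel edges allowed), and cographical if its dual is graphical. **Corollary.** (a) If a class $\mathfrak C$ of matroids is closed under direct sums, then $\mathfrak C\subseteq TE(1)$ if and only if $\mathfrak C\subseteq TE(2)$. (b) All strongly base orderable matroids, all graphical matroids and all cographical matroids belong to $TE(1)$. (c) The conjectures "$TE(1)$ is the class of all matroids" and "$TE(2)$ is the class of all matroids" are equivalent. -/

import Mathlib

universe u

namespace Matroid

variable {α : Type*}

/-- `(D₁, D₂)` is a pair of bases obtained from `(B₁, B₂)` by a double swap: for some `e ∈ B₁` and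
`f ∈ B₂` one has `D₁ = (B₁ \ e) ∪ f` and `D₂ = (B₂ \ f) ∪ e`. -/
def DoubleSwap (M : Matroid α) (B₁ B₂ D₁ D₂ : Set α) : Prop :=
  M.IsBase B₁ ∧ M.IsBase B₂ ∧ M.IsBase D₁ ∧ M.IsBase D₂ ∧
    ∃ e ∈ B₁, ∃ f ∈ B₂, D₁ = insert f (B₁ \ {e}) ∧ D₂ = insert e (B₂ \ {f})

/-- Sequences of length `n` of bases of `M`. -/
abbrev BaseSeq (M : Matroid α) (n : ℕ) : Type _ := Fin n → {B : Set α // M.IsBase B}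

/-- Two sequences of bases are compatible if their unions as multisets agree, i.e. every element
lies in equally many members of the one as of the other. -/
def Compatible {M : Matroid α} {n : ℕ} (B D : M.BaseSeq n) : Prop :=
  ∀ x : α, {i | x ∈ (B i : Set α)}.ncard = {i | x ∈ (D i : Set α)}.ncard

/-- One symmetric exchange: a pair of bases at two distinct positions `i, j` of the sequence is
replaced by a pair obtained from it by a double swap; the other positions are unchanged. -/
def SymmExchange {M : Matroid α} {n : ℕ} (B D : M.BaseSeq n) : Prop :=
  ∃ i j : Fin n, i ≠ j ∧ M.DoubleSwap (B i) (B j) (D i) (D j) ∧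
    ∀ k, k ≠ i → k ≠ j → D k = B k

/-- `D` is obtained from `B` by permuting the order of the bases. -/
def Rearrangement {M : Matroid α} {n : ℕ} (B D : M.BaseSeq n) : Prop :=
  ∃ σ : Equiv.Perm (Fin n), D = B ∘ σ

/-- The relation `∼₁`: `D` is obtained from `B` by a (possibly empty) composition of symmetric
exchanges. -/
def Rel₁ {M : Matroid α} {n : ℕ} (B D : M.BaseSeq n) : Prop :=
  Relation.ReflTransGen SymmExchange B D

/-- The relation `∼₂`: `D` is obtained from `B` by a composition of symmetric exchanges and
permutations of the order of the bases. -/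
def Rel₂ {M : Matroid α} {n : ℕ} (B D : M.BaseSeq n) : Prop :=
  Relation.ReflTransGen (fun X Y => SymmExchange X Y ∨ Rearrangement X Y) B D

/-- `M` is strongly base orderable: between any two bases `B₁`, `B₂` there is a bijection `π` such
that exchanging any `A ⊆ B₁` for `π(A)` in `B₁` gives a basis. (Only the values of `π` on `B₁`
matter.) -/
def StronglyBaseOrderable (M : Matroid α) : Prop :=
  ∀ B₁ B₂ : Set α, M.IsBase B₁ → M.IsBase B₂ →
    ∃ π : α → α, Set.BijOn π B₁ B₂ ∧ ∀ A ⊆ B₁, M.IsBase ((B₁ \ A) ∪ π '' A)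

end Matroid

/-- `C` is the edge set of a cycle of the multigraph `G`: there are distinct vertices `v 0, …, v n`
and distinct edges `e 0, …, e n` with `e i` joining `v i` to `v (i + 1)`, indices modulo `n + 1`.
A loop is a cycle with one edge, two parallel edges form a cycle with two edges. -/
def Graph.IsCycleEdgeSet {V β : Type*} (G : Graph V β) (C : Set β) : Prop :=
  ∃ (n : ℕ) (v : Fin (n + 1) → V) (e : Fin (n + 1) → β),
    Function.Injective v ∧ Function.Injective e ∧
      (∀ i, G.IsLink (e i) (v i) (v (i + 1))) ∧ C = Set.range e

namespace Matroid

variable {α : Type*}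

/-- `M` is the cycle matroid of the multigraph `G`: its elements are the edges of `G` and its
circuits are the edge sets of the cycles of `G`. -/
def IsCycleMatroidOf {V : Type*} (M : Matroid α) (G : Graph V α) : Prop :=
  M.E = G.edgeSet ∧ ∀ C : Set α, M.IsCircuit C ↔ G.IsCycleEdgeSet C

/-- `M` is graphical: it is the cycle matroid of a multigraph with finitely many vertices. As the
vertex set is finite, vertices may be taken in a type in `Type`. -/
def Graphical (M : Matroid α) : Prop :=
  ∃ (V : Type) (G : Graph V α), G.vertexSet.Finite ∧ M.IsCycleMatroidOf G

/-- `M` is cographical: its dual is graphical. -/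
def Cographical (M : Matroid α) : Prop := M✶.Graphical

end Matroid

/-- A matroid with a finite ground set. -/
structure FinMatroid : Type (u + 1) where
  carrier : Type u
  toMatroid : Matroid carrier
  finite_ground : toMatroid.E.Finite

namespace FinMatroid

/-- The direct sum `M ⊕ N`, on the disjoint union of the ground sets. -/
def directSum (M N : FinMatroid.{u}) : FinMatroid.{u} where
  carrier := M.carrier ⊕ N.carrier
  toMatroid := M.toMatroid.sum N.toMatroid
  finite_ground := by
    rw [Matroid.sum_ground]
    exact (M.finite_ground.image _).union (N.finite_ground.image _)

/-- A class of matroids is closed under direct sums. -/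
def ClosedUnderDirectSums (𝒞 : Set FinMatroid.{u}) : Prop :=
  ∀ M ∈ 𝒞, ∀ N ∈ 𝒞, M.directSum N ∈ 𝒞

/-- The class `TE(1)`. -/
def TE₁ : Set FinMatroid.{u} :=
  {M | ∀ n : ℕ, 2 ≤ n → ∀ B D : M.toMatroid.BaseSeq n, Matroid.Compatible B D → Matroid.Rel₁ B D}

/-- The class `TE(2)`. -/
def TE₂ : Set FinMatroid.{u} :=
  {M | ∀ n : ℕ, 2 ≤ n → ∀ B D : M.toMatroid.BaseSeq n, Matroid.Compatible B D → Matroid.Rel₂ B D}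

end FinMatroid

/-!
A class closed under direct sums is treated through the sum `M ⊕ M`. A sequence of bases of `M ⊕ M`
consists of two sequences of bases of `M`, its traces. A symmetric exchange acts on one of them
only, whereas a rearrangement permutes both in the same way (`Matroid.exists_perm_of_rel₂_sum`).
Hence, if `M ⊕ M` belongs to `TE(2)`, the sequences with traces `(B, B)` and `(B, B ∘ σ)` yield a
permutation `ρ` with `B ∘ ρ ∼₁ B` and `B ∘ ρ ∼₁ B ∘ σ`. So permutations of bases of `M` are
compositions of symmetric exchanges, and `∼₂` implies `∼₁`.

In a strongly base orderable matroid, take compatible `B` and `D` that differ, and `e` which `B` has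
at position `i` but not at `j`, and `D` at `j` but not at `i`. The bijections between `B i` and
`B j` and between `D i` and `D j` are matchings on the two symmetric differences. A common
2-colouring of these matchings tells how to redistribute both symmetric differences, by symmetric
exchanges, so that `B` and `D` agree more (`Matroid.rel₁_of_stronglyBaseOrderable`).

For a graphical matroid, an edge with ends `x`, `y` is represented over `ZMod 2` by the vector
`BaseExchange.edgeVec x y`. With a copy of an element for every basis in which it occurs, a sequence
of bases becomes a colouring of a set `X` of edges whose colour classes are independent, and a
symmetric exchange interchanges the colours of two edges. The assertion is that any two such
colourings are connected by swaps, if the classes are bases of one space `L`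
(`BaseExchange.swapEquiv_of_edgeVec`). The proof is by induction on the number of vertices plus the
number `n` of colours.

Since the rank is less than the number of vertices, some vertex `v` has degree `n + p` with `p < n`.
By swaps a colouring can be made to have at most two edges at `v` in each class
(`BaseExchange.IsStar.exists_card_le_two`). Then `p` classes have two edges `v x`, `v y`; each such
pair is replaced by one new edge `x y`, whose vector is the sum of the two. The result is a set `m`
of `p` disjoint pairs of edges at `v`, and an independent colouring `t` of `m` and the edges that
avoid `v`, in a graph with fewer vertices; `c` is a lift of `t`. Four facts complete the induction.

* Two lifts of the same `t` are connected (`BaseExchange.IsStar.swapEquiv_of_isLift`).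
* A swap of `t` can be lifted (`BaseExchange.IsStar.exists_isLift_of_swapStep`). If there is a
  third colour, the lifts are chosen to agree on its class, which is then deleted. With two colours
  there is at most one pair, and explicit swaps exist.
* Any two pairings that occur are connected by replacements of a single member of a pair
  (`BaseExchange.pairStep_connected`). This takes place in the union of `n` copies of the cycle
  matroid, where a set is independent if it has an independent colouring. Of the vectors `a + b`,
  `b + c` and `a + c`, if one avoids a subspace, then so does a second one; this gives the
  replacements, and fundamental circuits of the union matroid show where to apply them.
* Lifts of pairings adjacent in this sense are connected
  (`BaseExchange.IsStar.swapEquiv_of_pairStep`).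

For cographical matroids, bases are replaced by their complements.
-/

set_option linter.unusedSectionVars false

namespace BaseExchange

open Finset Submodule Relation

/-! ### Independent colourings and the union matroid -/

section Coloring

variable {K W κ C : Type*} [Field K] [AddCommGroup W] [Module K W] [DecidableEq κ] [DecidableEq C]

/-- The elements of `X` of colour `i` under the colouring `c`. -/
def fiber (X : Finset κ) (c : κ → C) (i : C) : Finset κ := X.filter (c · = i)

@[simp] lemma mem_fiber {X : Finset κ} {c : κ → C} {i : C} {x : κ} :
    x ∈ fiber X c i ↔ x ∈ X ∧ c x = i := by simp [fiber]

lemma fiber_congr {X : Finset κ} {c c' : κ → C} (h : ∀ x ∈ X, c x = c' x) (i : C) :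
    fiber X c i = fiber X c' i := by
  ext x; simp only [mem_fiber]
  exact ⟨fun ⟨hx, hc⟩ => ⟨hx, h x hx ▸ hc⟩, fun ⟨hx, hc⟩ => ⟨hx, (h x hx).trans hc⟩⟩

/-- `c` colours the elements of `X` with colours from `Cs` so that the vectors `φ e` of each colour
are linearly independent: a partition of `X` into independent sets indexed by `Cs`. The values of
`c` outside `X` do not matter. -/
structure IsIndepColoring (K : Type*) {W κ C : Type*} [Field K] [AddCommGroup W] [Module K W]
    [DecidableEq C] (φ : κ → W) (X : Finset κ) (Cs : Finset C) (c : κ → C) : Prop where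
  mem : ∀ x ∈ X, c x ∈ Cs
  indep : ∀ i, LinearIndepOn K φ (fiber X c i : Set κ)

/-- Independence in the union of copies, one for each colour of `Cs`, of the matroid represented
by `φ`. -/
def Colorable (K : Type*) {W κ C : Type*} [Field K] [AddCommGroup W] [Module K W]
    [DecidableEq C] (φ : κ → W) (Cs : Finset C) (X : Finset κ) : Prop :=
  ∃ c : κ → C, IsIndepColoring K φ X Cs c

variable {φ : κ → W} {X Y : Finset κ} {Cs : Finset C} {c c' : κ → C}

lemma IsIndepColoring.congr (h : IsIndepColoring K φ X Cs c) (hc : ∀ x ∈ X, c x = c' x) :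
    IsIndepColoring K φ X Cs c' :=
  ⟨fun x hx => hc x hx ▸ h.mem x hx, fun i => fiber_congr hc i ▸ h.indep i⟩

lemma IsIndepColoring.mono (h : IsIndepColoring K φ X Cs c) (hY : Y ⊆ X) :
    IsIndepColoring K φ Y Cs c :=
  ⟨fun x hx => h.mem x (hY hx), fun i => (h.indep i).mono (by
    intro x; simp only [mem_coe, mem_fiber]; exact fun hx => ⟨hY hx.1, hx.2⟩)⟩

lemma Colorable.mono (h : Colorable K φ Cs X) (hY : Y ⊆ X) : Colorable K φ Cs Y :=
  h.imp fun _ hc => hc.mono hY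

lemma sum_card_fiber (h : ∀ x ∈ X, c x ∈ Cs) : ∑ i ∈ Cs, (fiber X c i).card = X.card :=
  (Finset.card_eq_sum_card_fiberwise h).symm

lemma card_le_finrank {S : Finset κ} {L : Submodule K W} [FiniteDimensional K L]
    (hS : LinearIndepOn K φ (S : Set κ)) (hL : ∀ e ∈ S, φ e ∈ L) :
    S.card ≤ Module.finrank K L := by
  have h : LinearIndependent K (fun e : S => (⟨φ e, hL e e.2⟩ : L)) :=
    LinearIndependent.of_comp L.subtype hS
  simpa using h.fintype_card_le_finrank

lemma finrank_span_image_le (S : Finset κ) :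
    Module.finrank K (span K (φ '' (S : Set κ))) ≤ S.card := by
  classical
  rw [← coe_image]
  exact (finrank_span_finset_le_card _).trans card_image_le

instance finiteDimensional_span_image (S : Finset κ) :
    FiniteDimensional K (span K (φ '' (S : Set κ))) :=
  FiniteDimensional.span_of_finite K (S.finite_toSet.image _)

lemma span_eq_of_card {S : Finset κ} {L : Submodule K W} [FiniteDimensional K L]
    (hS : LinearIndepOn K φ (S : Set κ)) (hL : ∀ e ∈ S, φ e ∈ L)
    (hc : Module.finrank K L ≤ S.card) : span K (φ '' S) = L := by
  have hle : span K (φ '' S) ≤ L := span_le.2 (by rintro _ ⟨e, he, rfl⟩; exact hL e he)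
  refine eq_of_le_of_finrank_le hle (hc.trans ?_)
  exact card_le_finrank hS fun e he => subset_span ⟨e, he, rfl⟩

lemma exists_sum_eq_of_mem_span {S : Finset κ} {w : W} (hw : w ∈ span K (φ '' (S : Set κ))) :
    ∃ μ : κ → K, w = ∑ f ∈ S, μ f • φ f := by
  classical
  obtain ⟨μ, hμ⟩ := (mem_span_image_finset_iff_exists_fun K).1 hw
  refine ⟨fun f => if h : f ∈ S then μ ⟨f, h⟩ else 0, ?_⟩
  rw [← hμ, ← sum_coe_sort S]
  exact sum_congr rfl fun f _ => by simp

lemma exists_notMem_span_of_card_lt {S T : Finset κ} (hT : LinearIndepOn K φ (T : Set κ))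
    (h : S.card < T.card) : ∃ e ∈ T, φ e ∉ span K (φ '' (S : Set κ)) := by
  by_contra! hcon
  have h1 := card_le_finrank hT hcon
  have h2 := finrank_span_image_le (K := K) (φ := φ) S
  omega

/-- Recolouring `e` with `i` keeps a colouring independent if `φ e` is not in the span of the
colour class `i`. -/
lemma IsIndepColoring.update (h : IsIndepColoring K φ X Cs c) {e : κ} {i : C} (hi : i ∈ Cs)
    (he : φ e ∉ span K (φ '' (fiber X c i : Set κ))) :
    IsIndepColoring K φ (insert e X) Cs (Function.update c e i) := by
  refine ⟨fun x hx => ?_, fun j => ?_⟩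
  · rcases eq_or_ne x e with rfl | hxe
    · simpa using hi
    · rw [Function.update_of_ne hxe]
      exact h.mem x (mem_of_mem_insert_of_ne hx hxe)
  · rcases eq_or_ne j i with rfl | hj
    · refine ((h.indep j).insert he).mono ?_
      intro x
      simp only [mem_coe, mem_fiber, mem_insert, Set.mem_insert_iff]
      rintro ⟨hx, hc⟩
      rcases eq_or_ne x e with rfl | hxe
      · simp
      · rw [Function.update_of_ne hxe] at hc
        exact Or.inr ⟨hx.resolve_left hxe, hc⟩
    · refine (h.indep j).mono ?_
      intro x
      simp only [mem_coe, mem_fiber, mem_insert]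
      rintro ⟨hx, hc⟩
      rcases eq_or_ne x e with rfl | hxe
      · simp at hc; exact absurd hc.symm hj
      · rw [Function.update_of_ne hxe] at hc
        exact ⟨hx.resolve_left hxe, hc⟩

/-- The augmentation axiom for the union matroid. Among all pairs of colourings one with the
largest agreement is chosen; then an element that augments a colour class is new, since moving it
would increase the agreement. -/
lemma Colorable.exists_insert {I J : Finset κ} (hI : Colorable K φ Cs I)
    (hJ : Colorable K φ Cs J) (hlt : I.card < J.card) :
    ∃ e ∈ J, e ∉ I ∧ Colorable K φ Cs (insert e I) := by
  obtain ⟨cJ, hcJ⟩ := hJ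
  let ov : (κ → C) → ℕ := fun c => ((I ∩ J).filter fun e => c e = cJ e).card
  obtain ⟨c, hc, hmax⟩ : ∃ c, IsIndepColoring K φ I Cs c ∧
      ∀ c', IsIndepColoring K φ I Cs c' → ov c' ≤ ov c := by
    have hb : ∀ c, ov c ≤ (I ∩ J).card := fun c => card_filter_le _ _
    obtain ⟨c0, hc0⟩ := hI
    have hfin : ((ov '' {c | IsIndepColoring K φ I Cs c})).Finite :=
      (Set.finite_Iic (I ∩ J).card).subset (by rintro _ ⟨c, -, rfl⟩; exact hb c)
    obtain ⟨_, ⟨⟨c, hc, rfl⟩, hm⟩⟩ := hfin.exists_maximal ⟨_, c0, hc0, rfl⟩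
    refine ⟨c, hc, fun c' hc' => ?_⟩
    by_contra! hlt
    exact absurd (hm ⟨c', hc', rfl⟩ hlt.le) (by simpa using hlt)
  obtain ⟨i, hi, hlti⟩ : ∃ i ∈ Cs, (fiber I c i).card < (fiber J cJ i).card := by
    by_contra! hcon
    have := sum_le_sum hcon
    rw [sum_card_fiber hcJ.mem, sum_card_fiber hc.mem] at this
    omega
  obtain ⟨e, heJ, hespan⟩ := exists_notMem_span_of_card_lt (hcJ.indep i) hlti
  rw [mem_fiber] at heJ
  have hup := hc.update hi hespan
  refine ⟨e, heJ.1, fun heI => ?_, _, hup⟩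
  rw [insert_eq_of_mem heI] at hup
  refine absurd (hmax _ hup) (not_le.2 (card_lt_card ⟨?_, ?_⟩))
  · intro x
    simp only [mem_filter]
    rintro ⟨hx, hcx⟩
    refine ⟨hx, ?_⟩
    rcases eq_or_ne x e with rfl | hxe
    · simp [heJ.2]
    · rwa [Function.update_of_ne hxe]
  · intro hsub
    have : e ∈ (I ∩ J).filter fun x => c x = cJ x :=
      hsub (by simp [heI, heJ.1, heJ.2])
    rw [mem_filter, heJ.2] at this
    exact hespan (subset_span ⟨e, by simp [heI, this.2], rfl⟩)

lemma Colorable.exists_superset {I J : Finset κ} (hI : Colorable K φ Cs I)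
    (hJ : Colorable K φ Cs J) (hle : I.card ≤ J.card) :
    ∃ I', I ⊆ I' ∧ I' ⊆ I ∪ J ∧ I'.card = J.card ∧ Colorable K φ Cs I' := by
  obtain ⟨k, hk⟩ := Nat.exists_eq_add_of_le hle
  induction k generalizing I with
  | zero => exact ⟨I, subset_rfl, subset_union_left, by omega, hI⟩
  | succ k ih =>
    obtain ⟨e, heJ, heI, he⟩ := hI.exists_insert hJ (by omega)
    have hcard := card_insert_of_notMem heI
    obtain ⟨I', h1, h2, h3, h4⟩ := ih he (by omega) (by omega)
    refine ⟨I', (subset_insert _ _).trans h1, h2.trans ?_, h3, h4⟩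
    intro x; simp only [mem_union, mem_insert]
    rintro ((rfl | h) | h) <;> simp_all

variable (K φ X Cs) in
/-- The vectors that lie in the span of every colour class of every independent colouring of `X`.
A new element with vector `w` can be added to `X` in the union matroid if and only if `w` does not
lie in this subspace. -/
def unionSpan : Submodule K W :=
  ⨅ (c : κ → C) (_ : IsIndepColoring K φ X Cs c) (i : C) (_ : i ∈ Cs),
    span K (φ '' (fiber X c i : Set κ))

lemma mem_unionSpan {w : W} : w ∈ unionSpan K φ X Cs ↔ ∀ c : κ → C,
    IsIndepColoring K φ X Cs c → ∀ i ∈ Cs, w ∈ span K (φ '' (fiber X c i : Set κ)) := by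
  simp [unionSpan, mem_iInf]

lemma unionSpan_mono (h : X ⊆ Y) : unionSpan K φ X Cs ≤ unionSpan K φ Y Cs := by
  intro w
  simp only [mem_unionSpan]
  intro hw c hc i hi
  refine span_mono (Set.image_mono ?_) (hw c (hc.mono h) i hi)
  intro x; simp only [mem_coe, mem_fiber]; exact fun hx => ⟨h hx.1, hx.2⟩

lemma colorable_insert_iff {e : κ} (he : e ∉ X) :
    Colorable K φ Cs (insert e X) ↔ φ e ∉ unionSpan K φ X Cs := by
  constructor
  · rintro ⟨c, hc⟩ hmem
    have hce := hc.mem e (mem_insert_self _ _)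
    have h := mem_unionSpan.1 hmem c (hc.mono (subset_insert _ _)) (c e) hce
    have hfib : (fiber (insert e X) c (c e) : Set κ) = insert e (fiber X c (c e) : Set κ) := by
      ext x; simp only [mem_coe, mem_fiber, mem_insert, Set.mem_insert_iff]
      constructor
      · rintro ⟨rfl | h, h'⟩ <;> simp_all
      · rintro (rfl | h) <;> simp_all
    exact (hfib ▸ hc.indep (c e)).notMem_span_of_insert (by simp [he]) h
  · intro h
    simp only [mem_unionSpan, not_forall] at h
    obtain ⟨c, hc, i, hi, hsp⟩ := h
    exact ⟨_, hc.update hi hsp⟩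

/-- Exchange in the union matroid: if `w` is spanned by `X` and `f` occurs in the expansion of `w`
over a colour class, then a further copy of `f` is spanned by `X`, too. -/
lemma mem_unionSpan_of_notMem_span_erase {w : W} (hw : w ∈ unionSpan K φ X Cs)
    (hc : IsIndepColoring K φ X Cs c) {f : κ} (hf : f ∈ X)
    (hwf : w ∉ span K (φ '' ((fiber X c (c f)).erase f : Set κ))) :
    φ f ∈ unionSpan K φ X Cs := by
  by_contra hcon
  -- Two new elements are adjoined to the index type: one with vector `w`, one with vector `φ f`.
  let ψ : κ ⊕ Bool → W := Sum.elim φ fun b => if b then w else φ f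
  let ι : κ ↪ κ ⊕ Bool := Function.Embedding.inl
  have hlift : ∀ (Z : Finset κ) (d : κ → C), IsIndepColoring K φ Z Cs d → ∀ i ∈ Cs,
      ∀ e : κ ⊕ Bool, ψ e ∉ span K (φ '' (fiber Z d i : Set κ)) →
      Colorable K ψ Cs (insert e (Z.map ι)) := by
    intro Z d hd i hi e he
    have hfib : ∀ j, (fiber (Z.map ι) (Sum.elim d fun _ => i) j : Set (κ ⊕ Bool)) =
        Sum.inl '' (fiber Z d j : Set κ) := by
      intro j; ext x
      simp only [mem_coe, mem_fiber, mem_map, Set.mem_image]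
      constructor
      · rintro ⟨⟨y, hy, rfl⟩, hj⟩; exact ⟨y, ⟨hy, hj⟩, rfl⟩
      · rintro ⟨y, ⟨hy, hj⟩, rfl⟩; exact ⟨⟨y, hy, rfl⟩, hj⟩
    have hd' : IsIndepColoring K ψ (Z.map ι) Cs (Sum.elim d fun _ => i) := by
      refine ⟨?_, fun j => ?_⟩
      · intro x hx
        obtain ⟨y, hy, rfl⟩ := mem_map.1 hx
        exact hd.mem y hy
      · rw [hfib]
        exact LinearIndepOn.image_of_comp Sum.inl ψ (hd.indep j)
    refine ⟨_, hd'.update hi ?_⟩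
    rw [hfib, Set.image_image]
    exact he
  simp only [mem_unionSpan, not_forall] at hcon
  obtain ⟨d, hd, i, hi, hdf⟩ := hcon
  have hJ : Colorable K ψ Cs (insert (Sum.inr false) (X.map ι)) := hlift X d hd i hi _ hdf
  have hfib : fiber (X.erase f) c (c f) = (fiber X c (c f)).erase f := by
    ext x; simp only [mem_fiber, mem_erase]; tauto
  have hI : Colorable K ψ Cs (insert (Sum.inr true) ((X.erase f).map ι)) :=
    hlift _ c (hc.mono (erase_subset _ _)) (c f) (hc.mem f hf) _ (by rw [hfib]; exact hwf)
  have hcardJ : (insert (Sum.inr false) (X.map ι)).card = X.card + 1 := by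
    rw [card_insert_of_notMem (by simp [ι]), card_map]
  have hcardI : (insert (Sum.inr true) ((X.erase f).map ι)).card = X.card := by
    rw [card_insert_of_notMem (by simp [ι]), card_map, card_erase_of_mem hf]
    exact Nat.sub_add_cancel (card_pos.2 ⟨f, hf⟩)
  obtain ⟨e, heJ, heI, he⟩ := hI.exists_insert hJ (by omega)
  -- In either case an independent colouring of `X` together with `w` is obtained.
  obtain ⟨b, hb, hcol⟩ : ∃ b : κ ⊕ Bool, ψ b = φ f ∧ b ≠ Sum.inr true ∧
      (∀ x ∈ X.erase f, b ≠ Sum.inl x) ∧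
      Colorable K ψ Cs (insert b (insert (Sum.inr true) ((X.erase f).map ι))) := by
    rcases mem_insert.1 heJ with rfl | heJ
    · exact ⟨Sum.inr false, by simp [ψ], by simp, by simp, he⟩
    · obtain ⟨x, hx, rfl⟩ := mem_map.1 heJ
      have hxf : x = f := by
        by_contra hne
        exact heI (mem_insert_of_mem (mem_map_of_mem _ (mem_erase.2 ⟨hne, hx⟩)))
      subst hxf
      refine ⟨Sum.inl x, by simp [ψ], by simp, ?_, he⟩
      rintro y hy h
      exact (mem_erase.1 hy).1 (Sum.inl_injective h).symm
  obtain ⟨hbt, hbX, g, hg⟩ := hcol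
  let θ : κ → κ ⊕ Bool := fun x => if x = f then b else Sum.inl x
  have hθφ : ∀ x, ψ (θ x) = φ x := by
    intro x; by_cases hx : x = f <;> simp [θ, hx, hb, ψ]
  have hθX : ∀ x ∈ X, θ x ∈ insert b (insert (Sum.inr true) ((X.erase f).map ι)) := by
    intro x hx
    by_cases hxf : x = f
    · simp [θ, hxf]
    · have : θ x = Sum.inl x := by simp [θ, hxf]
      rw [this]
      exact mem_insert_of_mem (mem_insert_of_mem (mem_map_of_mem ι (mem_erase.2 ⟨hxf, hx⟩)))
  have hθinj : Set.InjOn θ X := by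
    intro x hx y hy hxy
    by_cases hxf : x = f <;> by_cases hyf : y = f
    · rw [hxf, hyf]
    · exact absurd (by simpa [θ, hxf, hyf] using hxy) (hbX y (mem_erase.2 ⟨hyf, hy⟩))
    · exact absurd (by simpa [θ, hxf, hyf] using hxy.symm) (hbX x (mem_erase.2 ⟨hxf, hx⟩))
    · simpa [θ, hxf, hyf] using hxy
  have hθt : ∀ x, θ x ≠ Sum.inr true := by
    intro x; by_cases hxf : x = f
    · simpa [θ, hxf] using hbt
    · simp [θ, hxf]
  set Z := insert b (insert (Sum.inr true) ((X.erase f).map ι)) with hZ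
  have hgX : IsIndepColoring K φ X Cs (g ∘ θ) := by
    refine ⟨fun x hx => hg.mem _ (hθX x hx), fun j => ?_⟩
    have h1 : LinearIndepOn K ψ (θ '' (fiber X (g ∘ θ) j : Set κ)) := by
      refine (hg.indep j).mono ?_
      rintro _ ⟨x, hx, rfl⟩
      simp only [mem_coe, mem_fiber, Function.comp] at hx ⊢
      exact ⟨hθX x hx.1, hx.2⟩
    have h2 := (linearIndepOn_iff_image (f := ψ) (s := θ '' (fiber X (g ∘ θ) j : Set κ)) ?_).1 h1
    · have h3 : LinearIndepOn K (ψ ∘ θ) (fiber X (g ∘ θ) j : Set κ) :=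
        LinearIndepOn.comp_of_image h1 (hθinj.mono fun x hx => (mem_fiber.1 hx).1)
      exact h3.congr fun x _ => hθφ x
    · exact h1.injOn
  have htZ : Sum.inr true ∈ Z := mem_insert_of_mem (mem_insert_self _ _)
  have hmem := mem_unionSpan.1 hw _ hgX (g (Sum.inr true)) (hg.mem _ htZ)
  refine (hg.indep (g (Sum.inr true))).notMem_span (i := Sum.inr true) (by simp [htZ]) ?_
  refine span_mono ?_ (show ψ (Sum.inr true) ∈ _ by simpa [ψ] using hmem)
  rintro _ ⟨x, hx, rfl⟩
  simp only [mem_coe, mem_fiber, Function.comp] at hx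
  refine ⟨θ x, ⟨?_, ?_⟩, hθφ x⟩
  · simp only [mem_coe, mem_fiber]; exact ⟨hθX x hx.1, hx.2⟩
  · exact hθt x

/-- A vector spanned by `X` in the union matroid is spanned, in each colour class, by those
elements a further copy of which is spanned by `X` in the union matroid. -/
lemma mem_span_fiber_inter_unionSpan {w : W} (hw : w ∈ unionSpan K φ X Cs)
    (hc : IsIndepColoring K φ X Cs c) {i : C} (hi : i ∈ Cs) :
    ∃ μ : κ → K, w = ∑ f ∈ fiber X c i, μ f • φ f ∧
      ∀ f ∈ fiber X c i, μ f ≠ 0 → φ f ∈ unionSpan K φ X Cs := by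
  obtain ⟨μ, hμ⟩ := exists_sum_eq_of_mem_span (mem_unionSpan.1 hw c hc i hi)
  refine ⟨μ, hμ, fun f hf hne => ?_⟩
  have hfX := mem_fiber.1 hf
  refine mem_unionSpan_of_notMem_span_erase hw hc hfX.1 fun hmem => ?_
  rw [hfX.2] at hmem
  refine (hc.indep i).notMem_span hf ?_
  rw [← add_sum_erase _ _ hf] at hμ
  have h1 : φ f = (μ f)⁻¹ • (w - ∑ x ∈ (fiber X c i).erase f, μ x • φ x) := by
    rw [hμ, add_sub_cancel_right, smul_smul, inv_mul_cancel₀ hne, one_smul]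
  rw [h1, ← coe_erase]
  refine smul_mem _ _ (sub_mem (by simpa using hmem) (sum_mem fun x hx => smul_mem _ _ ?_))
  exact subset_span ⟨x, hx, rfl⟩

end Coloring

/-! ### Vectors of edges over the field with two elements -/

section GraphVectors

variable {V κ C : Type*} [DecidableEq V] [DecidableEq κ] [DecidableEq C]

/-- The vector over the field with two elements that represents an edge with ends `x` and `y` in
the cycle matroid; it vanishes if `x = y`. -/
def edgeVec (x y : V) : V → ZMod 2 := Pi.single x 1 + Pi.single y 1

lemma add_self_eq_zero' (w : V → ZMod 2) : w + w = 0 := funext fun _ => CharTwo.add_self_eq_zero _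

lemma edgeVec_comm (x y : V) : edgeVec x y = edgeVec y x := add_comm _ _

lemma edgeVec_self (x : V) : edgeVec x x = 0 := add_self_eq_zero' _

lemma edgeVec_add (x y z : V) : edgeVec x y + edgeVec x z = edgeVec y z := by
  have h := add_self_eq_zero' (Pi.single x 1 : V → ZMod 2)
  unfold edgeVec
  calc _ = (Pi.single x 1 + Pi.single x 1 : V → ZMod 2) + (Pi.single y 1 + Pi.single z 1) := by
        abel
    _ = _ := by rw [h, zero_add]

lemma edgeVec_apply (x y z : V) :
    edgeVec x y z = (if z = x then 1 else 0) + (if z = y then 1 else 0) := by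
  simp [edgeVec, Pi.single_apply]

lemma zmod_two_cases (a : ZMod 2) : a = 0 ∨ a = 1 := by
  revert a; decide

lemma map_edgeVec (h : (V → ZMod 2) →ₗ[ZMod 2] ZMod 2) (v x y : V) :
    h (edgeVec x y) = h (edgeVec v x) + h (edgeVec v y) := by
  rw [← map_add, edgeVec_add]

/-- A circuit has only two edges at a vertex. If `φ g` is a combination of the edges of `T`, where
`g`, `s₁` and `s₂` are incident with `v`, then one of `s₁`, `s₂` is not needed. Otherwise two cuts
witness this, and the product of their potentials, normalized to vanish at `v`, is the potential of
a cut that contains `g` but no edge of `T`. -/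
lemma mem_span_erase_or_of_star {φ : κ → V → ZMod 2} {A : Finset V} {T : Finset κ} {v : V}
    (hT : ∀ e ∈ T, ∃ x ∈ A, ∃ y ∈ A, φ e = edgeVec x y) {g s₁ s₂ : κ}
    (hgA : ∃ x ∈ A, ∃ y ∈ A, φ g = edgeVec x y)
    (hg : φ g ∈ span (ZMod 2) (φ '' (T : Set κ))) (hgv : φ g v = 1)
    (h₁ : φ s₁ v = 1) (h₂ : φ s₂ v = 1) (hne : s₁ ≠ s₂) :
    φ g ∈ span (ZMod 2) (φ '' ((T.erase s₁ : Finset κ) : Set κ)) ∨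
      φ g ∈ span (ZMod 2) (φ '' ((T.erase s₂ : Finset κ) : Set κ)) := by
  by_contra! hcon
  obtain ⟨f₁, hf₁, hk₁⟩ := exists_le_ker_of_notMem hcon.1
  obtain ⟨f₂, hf₂, hk₂⟩ := exists_le_ker_of_notMem hcon.2
  have hk : ∀ e ∈ T, ∀ s (f : (V → ZMod 2) →ₗ[ZMod 2] ZMod 2),
      span (ZMod 2) (φ '' ((T.erase s : Finset κ) : Set κ)) ≤ LinearMap.ker f →
      e ≠ s → f (φ e) = 0 := by
    intro e he s f hf hes
    exact hf (subset_span ⟨e, by simp [he, hes], rfl⟩)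
  let p : V → ZMod 2 := fun x => f₁ (edgeVec v x) * f₂ (edgeVec v x)
  let h : (V → ZMod 2) →ₗ[ZMod 2] ZMod 2 :=
    ∑ x ∈ A, p x • LinearMap.proj x
  have hh : ∀ x ∈ A, ∀ y ∈ A, h (edgeVec x y) = p x + p y := by
    intro x hx y hy
    simp [h, edgeVec_apply, mul_add, sum_add_distrib, hx, hy]
  have hpv : p v = 0 := by simp [p, edgeVec_self]
  have star : ∀ e x y, φ e = edgeVec x y → φ e v = 1 →
      p x + p y = f₁ (φ e) * f₂ (φ e) := by
    intro e x y he hev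
    rw [he, edgeVec_apply] at hev
    by_cases hx : v = x <;> by_cases hy : v = y
    · rw [if_pos hx, if_pos hy] at hev; exact absurd hev (by decide)
    · rw [he, ← hx, hpv, zero_add]
    · rw [he, ← hy, hpv, add_zero, edgeVec_comm]
    · simp [hx, hy] at hev
  have hzero : span (ZMod 2) (φ '' (T : Set κ)) ≤ LinearMap.ker h := by
    rw [span_le]
    rintro _ ⟨e, he, rfl⟩
    obtain ⟨x, hx, y, hy, hxy⟩ := hT e he
    rw [SetLike.mem_coe, LinearMap.mem_ker, hxy, hh x hx y hy]
    by_cases hev : φ e v = 1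
    · rw [star e x y hxy hev]
      by_cases hes : e = s₁
      · rw [hk e he s₂ f₂ hk₂ (hes ▸ hne), mul_zero]
      · rw [hk e he s₁ f₁ hk₁ hes, zero_mul]
    · have e1 : f₁ (edgeVec v x) = f₁ (edgeVec v y) := by
        have := hk e he s₁ f₁ hk₁ (by rintro rfl; exact hev h₁)
        rw [hxy, map_edgeVec f₁ v] at this
        exact CharTwo.add_eq_zero.1 this
      have e2 : f₂ (edgeVec v x) = f₂ (edgeVec v y) := by
        have := hk e he s₂ f₂ hk₂ (by rintro rfl; exact hev h₂)
        rw [hxy, map_edgeVec f₂ v] at this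
        exact CharTwo.add_eq_zero.1 this
      simp only [p, e1, e2]
      exact CharTwo.add_self_eq_zero _
  obtain ⟨x, hx, y, hy, hxy⟩ := hgA
  have hgz := hzero hg
  rw [LinearMap.mem_ker, hxy, hh x hx y hy, star g x y hxy hgv] at hgz
  exact (mul_ne_zero hf₁ hf₂) hgz

/-- Fundamental circuits of the union matroid do not leave the vertex set of one tight subgraph.
If the edge `g` is spanned by `Z ∪ W` but not by `Z`, then it can be exchanged for an edge `f` of
`W`, and every pair consisting of an end of `g` and an end of `f` is spanned by `Z ∪ W`. -/
lemma exists_exchange_unionSpan {φ : κ → V → ZMod 2} {Cs : Finset C} {Z W : Finset κ}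
    (hcol : Colorable (ZMod 2) φ Cs (Z ∪ W)) (hZW : Disjoint Z W)
    (hedge : ∀ e ∈ Z ∪ W, ∃ x y, φ e = edgeVec x y) {a b : V} {g : κ} (hgX : g ∉ Z ∪ W)
    (hg : φ g = edgeVec a b) (h₁ : φ g ∈ unionSpan (ZMod 2) φ (Z ∪ W) Cs)
    (h₂ : φ g ∉ unionSpan (ZMod 2) φ Z Cs) :
    ∃ f ∈ W, Colorable (ZMod 2) φ Cs (insert g ((Z ∪ W).erase f)) ∧
      ∀ x y, φ f = edgeVec x y → edgeVec a x ∈ unionSpan (ZMod 2) φ (Z ∪ W) Cs ∧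
        edgeVec a y ∈ unionSpan (ZMod 2) φ (Z ∪ W) Cs := by
  classical
  obtain ⟨Y, ⟨hYW, hY⟩, hmin⟩ : ∃ Y : Finset κ,
      (Y ⊆ W ∧ φ g ∈ unionSpan (ZMod 2) φ (Z ∪ Y) Cs) ∧
      ∀ Y' ⊂ Y, φ g ∉ unionSpan (ZMod 2) φ (Z ∪ Y') Cs := by
    obtain ⟨Y, hY, hm⟩ := (W.powerset.filter fun Y => φ g ∈ unionSpan (ZMod 2) φ (Z ∪ Y) Cs
      ).exists_minimal ⟨W, by simp [h₁]⟩
    simp only [mem_filter, mem_powerset] at hY hm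
    refine ⟨Y, hY, fun Y' hY' hg' => ?_⟩
    exact hY'.2 (hm ⟨hY'.1.trans hY.1, hg'⟩ hY'.1)
  have hXsub : Z ∪ Y ⊆ Z ∪ W := union_subset_union_right hYW
  have hYcol := hcol.mono hXsub
  set S := unionSpan (ZMod 2) φ (Z ∪ Y) Cs with hS
  let U : Set V := {x | edgeVec a x ∈ S}
  have haU : a ∈ U := by simp [U, edgeVec_self]
  have hbU : b ∈ U := by simpa [U, hg] using hY
  have hUU : ∀ x y, edgeVec x y ∈ S → (x ∈ U ↔ y ∈ U) := by
    intro x y hxy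
    constructor
    · intro hx
      have := add_mem hx hxy
      rwa [edgeVec_comm a x, edgeVec_add] at this
    · intro hy
      have := add_mem hy hxy
      rwa [edgeVec_comm a y, edgeVec_comm x y, edgeVec_add] at this
  let D : Submodule (ZMod 2) (V → ZMod 2) := span _ {w | ∃ x ∈ U, ∃ y ∈ U, w = edgeVec x y}
  have hDmem : ∀ x ∈ U, ∀ y ∈ U, edgeVec x y ∈ D := fun x hx y hy =>
    subset_span ⟨x, hx, y, hy, rfl⟩
  have hgD : φ g ∈ D := hg ▸ hDmem a haU b hbU
  have hsupp : ∀ w ∈ D, ∀ z ∉ U, w z = 0 := by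
    intro w hw z hz
    have : D ≤ LinearMap.ker (LinearMap.proj z : (V → ZMod 2) →ₗ[ZMod 2] ZMod 2) := by
      rw [span_le]
      rintro _ ⟨x, hx, y, hy, rfl⟩
      have h1 : z ≠ x := by rintro rfl; exact hz hx
      have h2 : z ≠ y := by rintro rfl; exact hz hy
      simp [edgeVec_apply, h1, h2]
    exact this hw
  -- The part of each colour class that lies in `D` spans `D`: restrict to coordinates in `U`.
  have hspan : ∀ c, IsIndepColoring (ZMod 2) φ (Z ∪ Y) Cs c → ∀ i ∈ Cs, ∀ w ∈ D,
      w ∈ span (ZMod 2) (φ '' (((fiber (Z ∪ Y) c i).filter fun f => φ f ∈ D : Finset κ) :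
        Set κ)) := by
    intro c hc i hi w hw
    refine (show D ≤ _ from span_le.2 ?_) hw
    rintro _ ⟨x, hx, y, hy, rfl⟩
    have hwS : edgeVec x y ∈ S := by
      have := add_mem (S := Submodule (ZMod 2) (V → ZMod 2)) (s := S) hx hy
      rwa [edgeVec_add] at this
    obtain ⟨μ, hμ, hμS⟩ := mem_span_fiber_inter_unionSpan hwS hc hi
    let R : (V → ZMod 2) →ₗ[ZMod 2] (V → ZMod 2) :=
      LinearMap.pi fun z => if z ∈ U then LinearMap.proj z else 0
    have hR1 : ∀ p ∈ U, ∀ q ∈ U, R (edgeVec p q) = edgeVec p q := by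
      intro p hp q hq; ext z
      by_cases hz : z ∈ U
      · simp [R, hz]
      · have := hsupp _ (hDmem p hp q hq) z hz
        simp [R, hz, this]
    have hR2 : ∀ p ∉ U, ∀ q ∉ U, R (edgeVec p q) = 0 := by
      intro p hp q hq; ext z
      by_cases hz : z ∈ U
      · have h1 : z ≠ p := by rintro rfl; exact hp hz
        have h2 : z ≠ q := by rintro rfl; exact hq hz
        simp [R, hz, edgeVec_apply, h1, h2]
      · simp [R, hz]
    have hsum := congrArg R hμ
    rw [hR1 x hx y hy, map_sum] at hsum
    rw [SetLike.mem_coe, hsum]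
    refine sum_mem fun f hf => ?_
    rw [map_smul]
    by_cases hμf : μ f = 0
    · simp [hμf]
    refine smul_mem _ _ ?_
    obtain ⟨p, q, hpq⟩ := hedge f (hXsub (mem_fiber.1 hf).1)
    have hfS := hμS f hf hμf
    rw [hpq] at hfS
    by_cases hp : p ∈ U
    · have hq := (hUU p q hfS).1 hp
      rw [hpq, hR1 p hp q hq, ← hpq]
      refine subset_span ⟨f, ?_, rfl⟩
      rw [mem_coe, mem_filter, hpq]
      exact ⟨hf, hDmem p hp q hq⟩
    · have hq := fun hq => hp ((hUU p q hfS).2 hq)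
      rw [hpq, hR2 p hp q hq]
      exact zero_mem _
  have hYD : ∀ f ∈ Y, φ f ∈ D := by
    by_contra! hcon
    have hss : Y.filter (fun f => φ f ∈ D) ⊂ Y := by
      rw [Finset.filter_ssubset]; exact hcon
    have hgn : g ∉ Z ∪ Y.filter fun f => φ f ∈ D := fun h =>
      hgX (hXsub (union_subset_union_right (filter_subset _ _) h))
    obtain ⟨d, hd⟩ := (colorable_insert_iff hgn).2 (hmin _ hss)
    obtain ⟨c, hc⟩ := hYcol
    have hdg := hd.mem g (mem_insert_self _ _)
    have hfin : FiniteDimensional (ZMod 2) D :=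
      Submodule.finiteDimensional_of_le (hspan c hc (d g) hdg)
    set N := (insert g (Z ∪ Y.filter fun f => φ f ∈ D)).filter fun f => φ f ∈ D with hN
    set X₀ := (Z ∪ Y).filter fun f => φ f ∈ D with hX₀
    have hlow : Cs.card * Module.finrank (ZMod 2) D ≤ X₀.card := by
      rw [← sum_card_fiber (X := X₀) (c := c) (Cs := Cs)
        (fun x hx => hc.mem x (mem_filter.1 hx).1), ← smul_eq_mul]
      refine card_nsmul_le_sum _ _ _ fun i hi => ?_
      have hfib : fiber X₀ c i = (fiber (Z ∪ Y) c i).filter fun f => φ f ∈ D := by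
        ext x; simp only [hX₀, mem_fiber, mem_filter]; tauto
      rw [hfib]
      exact (Submodule.finrank_mono (hspan c hc i hi)).trans (finrank_span_image_le _)
    have hup : N.card ≤ Cs.card * Module.finrank (ZMod 2) D := by
      rw [← sum_card_fiber (X := N) (c := d) (Cs := Cs)
        (fun x hx => hd.mem x (mem_filter.1 hx).1), ← smul_eq_mul]
      refine sum_le_card_nsmul _ _ _ fun i hi => ?_
      refine card_le_finrank ((hd.mono (filter_subset _ _)).indep i) fun e he => ?_
      exact (mem_filter.1 (mem_fiber.1 he).1).2
    have hlt : X₀.card < N.card := by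
      refine card_lt_card ⟨fun x hx => ?_, fun h => ?_⟩
      · simp only [hX₀, hN, mem_filter, mem_union, mem_insert] at hx ⊢; tauto
      · have : g ∈ X₀ := h (by simp [hN, hgD])
        exact hgX (hXsub (mem_filter.1 this).1)
    omega
  have hYne : Y.Nonempty := by
    rw [nonempty_iff_ne_empty]; rintro rfl
    rw [union_empty] at hS
    exact h₂ (hS ▸ hY)
  obtain ⟨f, hf⟩ := hYne
  have hfZ : f ∉ Z := fun h => disjoint_left.1 hZW h (hYW hf)
  refine ⟨f, hYW hf, ?_, fun x y hxy => ?_⟩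
  · have hsub : Z ∪ Y.erase f ⊆ Z ∪ W :=
      (union_subset_union_right (erase_subset _ _)).trans hXsub
    have h3 : Colorable (ZMod 2) φ Cs (insert g (Z ∪ Y.erase f)) :=
      (colorable_insert_iff fun h => hgX (hsub h)).2 (hmin _ (erase_ssubset hf))
    have hgn : g ∉ Z ∪ Y.erase f := fun h => hgX (hsub h)
    have hlt : (Z ∪ Y.erase f).card < (Z ∪ W).card := by
      refine card_lt_card ⟨hsub, fun h => ?_⟩
      have := h (mem_union_right _ (hYW hf))
      simp [hfZ] at this
    obtain ⟨I, hI1, hI2, hI3, hI4⟩ := h3.exists_superset hcol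
      (by rw [card_insert_of_notMem hgn]; omega)
    have hfI : f ∉ I := by
      intro hfI
      refine absurd hY ((colorable_insert_iff fun h => hgX (hXsub h)).1 (hI4.mono ?_))
      intro x hx
      rcases mem_insert.1 hx with rfl | hx
      · exact hI1 (mem_insert_self _ _)
      · by_cases hxf : x = f
        · exact hxf ▸ hfI
        · refine hI1 (mem_insert_of_mem ?_)
          simp only [mem_union, mem_erase] at hx ⊢; tauto
    have hle : I ⊆ insert g ((Z ∪ W).erase f) := by
      intro x hx
      have hxf : x ≠ f := by rintro rfl; exact hfI hx
      have := hI2 hx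
      simp only [mem_union, mem_insert, mem_erase] at this ⊢; tauto
    have heq : I = insert g ((Z ∪ W).erase f) := by
      refine eq_of_subset_of_card_le hle ?_
      rw [hI3, card_insert_of_notMem (by simp at hgX ⊢; tauto), card_erase_of_mem
        (mem_union_right _ (hYW hf))]
      omega
    exact heq ▸ hI4
  · obtain ⟨c, hc⟩ := hYcol
    have hne : φ f ≠ 0 := (hc.indep (c f)).ne_zero (by simp [hf])
    have hxy' : x ≠ y := by rintro rfl; exact hne (hxy.trans (edgeVec_self x))
    have hfD := hYD f hf
    rw [hxy] at hfD
    have hmono := unionSpan_mono (K := ZMod 2) (φ := φ) (Cs := Cs) hXsub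
    constructor
    · by_contra hx
      have := hsupp _ hfD x fun hxU => hx (hmono hxU)
      simp [edgeVec_apply, hxy'] at this
    · by_contra hy
      have := hsupp _ hfD y fun hyU => hy (hmono hyU)
      simp [edgeVec_apply, hxy'.symm] at this

end GraphVectors

/-! ### Pairs of edges at a vertex -/

section Pairs

variable {V κ C : Type*} [DecidableEq V] [DecidableEq κ] [DecidableEq C]

/-- The sum of the vectors of the two members of a pair. If these represent edges `v x` and `v y`,
the sum represents an edge `x y`. -/
def pairVec (φ : κ → V → ZMod 2) : Sym2 κ → V → ZMod 2 :=
  Sym2.lift ⟨fun a b => φ a + φ b, fun _ _ => add_comm _ _⟩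

@[simp] lemma pairVec_mk (φ : κ → V → ZMod 2) (a b : κ) : pairVec φ s(a, b) = φ a + φ b := rfl

/-- The vectors of the graph obtained by adjoining, for all pairs of edges, the edge represented
by the sum of the pair. -/
def extVec (φ : κ → V → ZMod 2) : κ ⊕ Sym2 κ → V → ZMod 2 := Sum.elim φ (pairVec φ)

@[simp] lemma extVec_inr (φ : κ → V → ZMod 2) (s : Sym2 κ) :
    extVec φ (Sum.inr s) = pairVec φ s := rfl

/-- `m` is a set of disjoint pairs of elements of `δ`. -/
structure IsPairing (δ : Finset κ) (m : Finset (Sym2 κ)) : Prop where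
  mem : ∀ s ∈ m, ∀ a ∈ s, a ∈ δ
  not_isDiag : ∀ s ∈ m, ¬ s.IsDiag
  eq_of_mem : ∀ s ∈ m, ∀ t ∈ m, ∀ a, a ∈ s → a ∈ t → s = t

lemma IsPairing.mono {δ : Finset κ} {m J : Finset (Sym2 κ)} (h : IsPairing δ m) (hJ : J ⊆ m) :
    IsPairing δ J :=
  ⟨fun s hs => h.mem s (hJ hs), fun s hs => h.not_isDiag s (hJ hs),
    fun s hs t ht => h.eq_of_mem s (hJ hs) t (hJ ht)⟩

lemma IsPairing.insert {δ : Finset κ} {J : Finset (Sym2 κ)} (h : IsPairing δ J) {a b : κ}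
    (ha : a ∈ δ) (hb : b ∈ δ) (hab : a ≠ b) (ha' : ∀ s ∈ J, a ∉ s) (hb' : ∀ s ∈ J, b ∉ s) :
    IsPairing δ (insert s(a, b) J) := by
  have key : ∀ t ∈ J, ∀ x ∈ s(a, b), x ∉ t := by
    intro t ht x hx
    rcases Sym2.mem_iff.1 hx with rfl | rfl
    · exact ha' t ht
    · exact hb' t ht
  refine ⟨fun s hs x hx => ?_, fun s hs => ?_, fun s hs t ht x hxs hxt => ?_⟩
  · rcases mem_insert.1 hs with rfl | hs
    · rcases Sym2.mem_iff.1 hx with rfl | rfl <;> assumption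
    · exact h.mem s hs x hx
  · rcases mem_insert.1 hs with rfl | hs
    · simpa using hab
    · exact h.not_isDiag s hs
  · rcases mem_insert.1 hs with rfl | hs <;> rcases mem_insert.1 ht with rfl | ht
    · rfl
    · exact absurd hxt (key t ht x hxs)
    · exact absurd hxs (key s hs x hxt)
    · exact h.eq_of_mem s hs t ht x hxs hxt

lemma IsPairing.notMem_of_mem_erase {δ : Finset κ} {m : Finset (Sym2 κ)} (h : IsPairing δ m)
    {s : Sym2 κ} (hs : s ∈ m) {a : κ} (ha : a ∈ s) : ∀ t ∈ m.erase s, a ∉ t := by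
  intro t ht hat
  exact (mem_erase.1 ht).1 (h.eq_of_mem t (mem_of_mem_erase ht) s hs a hat ha)

variable (φ : κ → V → ZMod 2) (E δ : Finset κ) (Cs : Finset C) (p : ℕ)

/-- A pairing of `p` pairs which, together with the edges in `E`, can be partitioned into
independent sets, one for each colour in `Cs`. -/
structure IsRealized (m : Finset (Sym2 κ)) : Prop where
  pairing : IsPairing δ m
  card : m.card = p
  colorable : Colorable (ZMod 2) (extVec φ) Cs (E.disjSum m)

/-- Two realized pairings are adjacent if one arises from the other by replacing a single member
of a pair. -/
def PairStep (m m' : Finset (Sym2 κ)) : Prop :=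
  IsRealized φ E δ Cs p m ∧ IsRealized φ E δ Cs p m' ∧ ∃ J a b c,
    a ≠ b ∧ b ≠ c ∧ a ≠ c ∧ (∀ s ∈ J, a ∉ s) ∧ (∀ s ∈ J, b ∉ s) ∧ (∀ s ∈ J, c ∉ s) ∧
    m = insert s(a, b) J ∧ m' = insert s(b, c) J

/-- The span, in the union matroid, of the edges in `E` together with the pairs in `m`. -/
abbrev pairSpan (m : Finset (Sym2 κ)) : Submodule (ZMod 2) (V → ZMod 2) :=
  unionSpan (ZMod 2) (extVec φ) (E.disjSum m) Cs

variable {φ E δ Cs p} {m m' J W : Finset (Sym2 κ)}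

lemma colorable_insert_pair {s : Sym2 κ} (hs : s ∉ J) :
    Colorable (ZMod 2) (extVec φ) Cs (E.disjSum (insert s J)) ↔
      pairVec φ s ∉ pairSpan φ E Cs J := by
  have : E.disjSum (insert s J) = insert (Sum.inr s) (E.disjSum J) := by
    ext x; cases x <;> simp
  rw [this, colorable_insert_iff (by simpa using hs), extVec_inr]

lemma disjSum_mono_right' (h : J ⊆ W) : E.disjSum J ⊆ E.disjSum W :=
  disjSum_mono subset_rfl h

lemma exists_pairs_superset (hJ : Colorable (ZMod 2) (extVec φ) Cs (E.disjSum J))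
    (hW : Colorable (ZMod 2) (extVec φ) Cs (E.disjSum W)) (h : J.card ≤ W.card) :
    ∃ I, J ⊆ I ∧ I ⊆ J ∪ W ∧ I.card = W.card ∧
      Colorable (ZMod 2) (extVec φ) Cs (E.disjSum I) := by
  obtain ⟨I', h1, h2, h3, h4⟩ := hJ.exists_superset hW (by simpa [card_disjSum] using h)
  have hI' : I' = E.disjSum I'.toRight := by
    ext x; cases x with
    | inl x =>
      simp only [inl_mem_disjSum]
      exact ⟨fun h => by simpa using h2 h, fun h => h1 (by simpa using h)⟩
    | inr x => simp
  refine ⟨I'.toRight, fun s hs => ?_, fun s hs => ?_, ?_, hI' ▸ h4⟩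
  · simpa using h1 (inr_mem_disjSum.2 hs)
  · simpa using h2 (mem_toRight.1 hs)
  · rw [hI', card_disjSum, card_disjSum] at h3
    omega

lemma IsRealized.erase (hm : IsRealized φ E δ Cs p m) {s : Sym2 κ} (hs : s ∈ m) :
    pairVec φ s ∉ pairSpan φ E Cs (m.erase s) ∧ (m.erase s).card + 1 = p := by
  refine ⟨(colorable_insert_pair (notMem_erase s m)).1 ?_, ?_⟩
  · rw [insert_erase hs]; exact hm.colorable
  · rw [card_erase_add_one hs]; exact hm.card

lemma notMem_of_forall_notMem {a b : κ} (h : ∀ s ∈ J, a ∉ s) : s(a, b) ∉ J :=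
  fun hs => h _ hs (Sym2.mem_mk_left a b)

lemma isRealized_insert (hJ : IsPairing δ J) (hp : J.card + 1 = p) {a b : κ} (ha : a ∈ δ)
    (hb : b ∈ δ) (hab : a ≠ b) (ha' : ∀ s ∈ J, a ∉ s) (hb' : ∀ s ∈ J, b ∉ s)
    (h : φ a + φ b ∉ pairSpan φ E Cs J) : IsRealized φ E δ Cs p (insert s(a, b) J) :=
  ⟨hJ.insert ha hb hab ha' hb', by rw [card_insert_of_notMem (notMem_of_forall_notMem ha'), hp],
    (colorable_insert_pair (notMem_of_forall_notMem ha')).2 h⟩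

lemma pairStep_insert (hJ : IsPairing δ J) (hp : J.card + 1 = p) {a b c : κ} (ha : a ∈ δ)
    (hb : b ∈ δ) (hc : c ∈ δ) (hab : a ≠ b) (hbc : b ≠ c) (hac : a ≠ c) (ha' : ∀ s ∈ J, a ∉ s)
    (hb' : ∀ s ∈ J, b ∉ s) (hc' : ∀ s ∈ J, c ∉ s) (h : φ a + φ b ∉ pairSpan φ E Cs J)
    (h' : φ b + φ c ∉ pairSpan φ E Cs J) :
    PairStep φ E δ Cs p (insert s(a, b) J) (insert s(b, c) J) :=
  ⟨isRealized_insert hJ hp ha hb hab ha' hb' h, isRealized_insert hJ hp hb hc hbc hb' hc' h',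
    J, a, b, c, hab, hbc, hac, ha', hb', hc', rfl, rfl⟩

/-- If neither `a + b` nor `b + c` avoids a subspace, then neither does `a + c`. -/
lemma add_notMem_or {S : Submodule (ZMod 2) (V → ZMod 2)} {x z : V → ZMod 2} (y : V → ZMod 2)
    (h : x + z ∉ S) : x + y ∉ S ∨ y + z ∉ S := by
  by_contra! hcon
  refine h ?_
  have := add_mem hcon.1 hcon.2
  rwa [show x + y + (y + z) = x + z + (y + y) by abel, add_self_eq_zero', add_zero] at this

lemma notMem_pairSpan_exchange {s t : Sym2 κ} (hs : s ∉ J) (ht : t ∉ J)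
    (hsJ : pairVec φ s ∉ pairSpan φ E Cs J)
    (hst : pairVec φ s ∈ pairSpan φ E Cs (insert t J)) {u : Sym2 κ} (hu : u ∉ insert t J)
    (hus : u ≠ s) (h : pairVec φ u ∉ pairSpan φ E Cs (insert t J)) :
    pairVec φ u ∉ pairSpan φ E Cs (insert s J) := by
  by_cases hst' : s = t
  · rwa [hst']
  have h1 := (colorable_insert_pair hs).2 hsJ
  have h2 := (colorable_insert_pair hu).2 h
  obtain ⟨I, hI1, hI2, hI3, hI4⟩ := exists_pairs_superset h1 h2 (by
    rw [card_insert_of_notMem hs, card_insert_of_notMem hu, card_insert_of_notMem ht]; omega)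
  have htI : t ∉ I := fun htI => by
    refine (colorable_insert_pair (J := insert t J) (s := s) ?_).1 (hI4.mono ?_) hst
    · simp [hst', hs]
    · refine disjSum_mono_right' ?_
      intro x hx
      rcases mem_insert.1 hx with rfl | hx
      · exact hI1 (mem_insert_self _ _)
      · rcases mem_insert.1 hx with rfl | hx
        · exact htI
        · exact hI1 (mem_insert_of_mem hx)
  have huJ : u ∉ insert s J := by
    rw [mem_insert] at hu ⊢
    tauto
  refine (colorable_insert_pair huJ).1 ?_
  have hsub : I ⊆ insert u (insert s J) := by
    intro x hx
    have hxt : x ≠ t := by rintro rfl; exact htI hx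
    have := hI2 hx
    simp only [mem_union, mem_insert] at this ⊢; tauto
  rwa [← eq_of_subset_of_card_le hsub]
  rw [hI3, card_insert_of_notMem huJ, card_insert_of_notMem hs, card_insert_of_notMem hu,
    card_insert_of_notMem ht]

/-- `exists_exchange_unionSpan` for pairs of edges at a vertex `v`. -/
lemma exists_pair_exchange {v : V} (hE : ∀ e ∈ E, ∃ x y, φ e = edgeVec x y)
    (hδ : ∀ e ∈ δ, ∃ x, φ e = edgeVec v x) (hW : IsPairing δ W)
    (hWc : Colorable (ZMod 2) (extVec φ) Cs (E.disjSum W)) (hJW : J ⊆ W) {a b : κ} (ha : a ∈ δ)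
    (hb : b ∈ δ) (hab : s(a, b) ∉ W) (h₁ : φ a + φ b ∈ pairSpan φ E Cs W)
    (h₂ : φ a + φ b ∉ pairSpan φ E Cs J) :
    ∃ d e, s(d, e) ∈ W ∧ s(d, e) ∉ J ∧
      φ a + φ b ∉ pairSpan φ E Cs (W.erase s(d, e)) ∧ φ a + φ d ∈ pairSpan φ E Cs W ∧
      φ a + φ e ∈ pairSpan φ E Cs W := by
  obtain ⟨x, hx⟩ := hδ a ha
  obtain ⟨y, hy⟩ := hδ b hb
  have hun : E.disjSum J ∪ (W \ J).map .inr = E.disjSum W := by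
    ext z; cases z with
    | inl z => simp
    | inr z => simp only [mem_union, inr_mem_disjSum, mem_map, mem_sdiff]
               constructor
               · rintro (h | ⟨w, hw, h⟩)
                 · exact hJW h
                 · obtain rfl := Sum.inr_injective h; exact hw.1
               · intro h; by_cases hz : z ∈ J
                 · exact Or.inl hz
                 · exact Or.inr ⟨z, ⟨h, hz⟩, rfl⟩
  obtain ⟨f, hf, hfc, hfS⟩ := exists_exchange_unionSpan (φ := extVec φ) (Cs := Cs)
    (Z := E.disjSum J) (W := (W \ J).map .inr) (hun ▸ hWc) (by
      rw [disjoint_left]; intro z hz hz'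
      obtain ⟨w, hw, rfl⟩ := mem_map.1 hz'
      exact (mem_sdiff.1 hw).2 (by simpa using hz)) (by
      rw [hun]; intro z hz
      cases z with
      | inl z => exact hE z (by simpa using hz)
      | inr z =>
        induction z with
        | _ d e =>
          have hz' : s(d, e) ∈ W := by simpa using hz
          obtain ⟨x, hx⟩ := hδ d (hW.mem _ hz' d (by simp))
          obtain ⟨y, hy⟩ := hδ e (hW.mem _ hz' e (by simp))
          exact ⟨x, y, by rw [extVec_inr, pairVec_mk, hx, hy, edgeVec_add]⟩)
    (a := x) (b := y) (g := Sum.inr s(a, b)) (by rw [hun]; simpa using hab)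
    (by rw [extVec_inr, pairVec_mk, hx, hy, edgeVec_add]) (by rw [hun]; exact h₁) h₂
  rw [hun] at hfc hfS
  obtain ⟨s, hs, rfl⟩ := mem_map.1 hf
  induction s with
  | _ d e =>
    rw [mem_sdiff] at hs
    obtain ⟨z, hz⟩ := hδ d (hW.mem _ hs.1 d (by simp))
    obtain ⟨w, hw⟩ := hδ e (hW.mem _ hs.1 e (by simp))
    obtain ⟨h3, h4⟩ := hfS z w (by
      show pairVec φ s(d, e) = _
      rw [pairVec_mk, hz, hw, edgeVec_add])
    refine ⟨d, e, hs.1, hs.2, ?_, ?_, ?_⟩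
    · refine (colorable_insert_pair (s := s(a, b)) fun h => hab (mem_of_mem_erase h)).1 ?_
      have : E.disjSum (insert s(a, b) (W.erase s(d, e))) =
          insert (Sum.inr s(a, b)) ((E.disjSum W).erase (Sum.inr s(d, e))) := by
        ext x; cases x <;> simp
      rw [this]; exact hfc
    · rw [hx, hz, edgeVec_add]; exact h3
    · rw [hx, hw, edgeVec_add]; exact h4

end Pairs

/-! ### Connectedness of pairings -/

section PairingGraph

variable {V κ C : Type*} [DecidableEq V] [DecidableEq κ] [DecidableEq C]
variable {φ : κ → V → ZMod 2} {E δ : Finset κ} {Cs : Finset C} {p : ℕ}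
  {m m' J W : Finset (Sym2 κ)}

/-- One member of a pair `s(a, b)` can be replaced by an uncovered element `c`, if the choice of
the member is left open. -/
lemma exists_replace (hm : IsRealized φ E δ Cs p m) {a b c : κ} (hab : s(a, b) ∈ m)
    (hc : c ∈ δ) (hc' : ∀ s ∈ m, c ∉ s) :
    (φ a + φ c ∉ pairSpan φ E Cs (m.erase s(a, b)) ∧
        PairStep φ E δ Cs p m (insert s(a, c) (m.erase s(a, b)))) ∨
      (φ b + φ c ∉ pairSpan φ E Cs (m.erase s(a, b)) ∧
        PairStep φ E δ Cs p m (insert s(b, c) (m.erase s(a, b)))) := by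
  obtain ⟨hJs, hJc⟩ := hm.erase hab
  rw [pairVec_mk] at hJs
  have hJ := hm.pairing.mono (erase_subset s(a, b) m)
  have ha' := hm.pairing.notMem_of_mem_erase hab (Sym2.mem_mk_left a b)
  have hb' := hm.pairing.notMem_of_mem_erase hab (Sym2.mem_mk_right a b)
  have hca : a ≠ c := by rintro rfl; exact hc' _ hab (Sym2.mem_mk_left _ _)
  have hcb : b ≠ c := by rintro rfl; exact hc' _ hab (Sym2.mem_mk_right _ _)
  have hne : a ≠ b := by simpa using hm.pairing.not_isDiag _ hab
  have ha := hm.pairing.mem _ hab a (Sym2.mem_mk_left _ _)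
  have hb := hm.pairing.mem _ hab b (Sym2.mem_mk_right _ _)
  have hcJ : ∀ s ∈ m.erase s(a, b), c ∉ s := fun s hs => hc' s (mem_of_mem_erase hs)
  have hins : m = insert s(a, b) (m.erase s(a, b)) := (insert_erase hab).symm
  rcases add_notMem_or (φ c) hJs with h | h
  · left
    refine ⟨h, ?_⟩
    have := pairStep_insert (Cs := Cs) hJ hJc hb ha hc hne.symm hca hcb hb' ha' hcJ
      (by rwa [add_comm]) h
    rwa [Sym2.eq_swap, ← hins] at this
  · right
    rw [add_comm] at h
    refine ⟨h, ?_⟩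
    have := pairStep_insert (Cs := Cs) hJ hJc ha hb hc hne hcb hca ha' hb' hcJ hJs h
    rwa [← hins] at this

/-- Three replacements that turn the pairs `s(x, y)`, `s(b, c)` into `s(a, b)`, `s(c, y)`, where
`s(x, y)`, `s(a, x)` and `s(a, b)` are exchangeable for each other. -/
lemma reach_insert_insert (hJp : IsPairing δ J) (hJc : J.card + 2 = p) {a b c x y : κ}
    (ha : a ∈ δ) (hb : b ∈ δ) (hc : c ∈ δ) (hx : x ∈ δ) (hy : y ∈ δ)
    (hab : a ≠ b) (hac : a ≠ c) (hax : a ≠ x) (hay : a ≠ y) (hbc : b ≠ c) (hbx : b ≠ x)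
    (hby : b ≠ y) (hcx : c ≠ x) (hcy : c ≠ y) (hxy : x ≠ y)
    (haJ : ∀ t ∈ J, a ∉ t) (hbJ : ∀ t ∈ J, b ∉ t) (hcJ : ∀ t ∈ J, c ∉ t)
    (hxJ : ∀ t ∈ J, x ∉ t) (hyJ : ∀ t ∈ J, y ∉ t)
    (h₁ : φ a + φ x ∉ pairSpan φ E Cs J) (h₂ : φ a + φ b ∉ pairSpan φ E Cs J)
    (h₃ : φ a + φ x ∈ pairSpan φ E Cs (insert s(x, y) J))
    (h₄ : φ a + φ b ∈ pairSpan φ E Cs (insert s(x, y) J))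
    (h₅ : φ b + φ c ∉ pairSpan φ E Cs (insert s(x, y) J))
    (h₆ : φ c + φ y ∉ pairSpan φ E Cs (insert s(x, y) J)) :
    ReflTransGen (PairStep φ E δ Cs p) (insert s(b, c) (insert s(x, y) J))
      (insert s(a, b) (insert s(c, y) J)) ∧
    IsRealized φ E δ Cs p (insert s(a, b) (insert s(c, y) J)) := by
  have nm : ∀ {i j}, (∀ t ∈ J, i ∉ t) → s(i, j) ∉ J := fun h => notMem_of_forall_notMem h
  have nin : ∀ {i j k l}, i ≠ k → i ≠ l → (∀ t ∈ J, i ∉ t) → s(i, j) ∉ insert s(k, l) J := by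
    intro i j k l h1 h2 h h3
    rcases mem_insert.1 h3 with h3 | h3
    · rcases Sym2.eq_iff.1 h3 with ⟨h3, -⟩ | ⟨h3, -⟩
      · exact h1 h3
      · exact h2 h3
    · exact nm h h3
  have ne : ∀ {i j k l : κ}, i ≠ k → i ≠ l → s(i, j) ≠ s(k, l) := by
    intro i j k l h1 h2 h3
    rcases Sym2.eq_iff.1 h3 with ⟨h3, -⟩ | ⟨h3, -⟩
    · exact h1 h3
    · exact h2 h3
  have unc : ∀ {i k l}, i ≠ k → i ≠ l → (∀ t ∈ J, i ∉ t) → ∀ t ∈ insert s(k, l) J, i ∉ t := by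
    intro i k l h1 h2 h t ht hit
    rcases mem_insert.1 ht with rfl | ht
    · rcases Sym2.mem_iff.1 hit with rfl | rfl
      · exact h1 rfl
      · exact h2 rfl
    · exact h t ht hit
  have key1 : pairVec φ s(b, c) ∉ pairSpan φ E Cs (insert s(a, x) J) :=
    notMem_pairSpan_exchange (nm haJ) (nm hxJ) h₁ h₃ (nin hbx hby hbJ) (ne hab.symm hbx) h₅
  have key2 : pairVec φ s(c, y) ∉ pairSpan φ E Cs (insert s(a, x) J) :=
    notMem_pairSpan_exchange (nm haJ) (nm hxJ) h₁ h₃ (nin hcx hcy hcJ) (ne hac.symm hcx) h₆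
  have key3 : pairVec φ s(c, y) ∉ pairSpan φ E Cs (insert s(a, b) J) :=
    notMem_pairSpan_exchange (nm haJ) (nm hxJ) h₂ h₄ (nin hcx hcy hcJ) (ne hac.symm hbc.symm) h₆
  have swapped : ∀ {s u : Sym2 κ}, s ∉ J → pairVec φ u ∉ pairSpan φ E Cs (insert s J) →
      u ∉ insert s J → pairVec φ s ∉ pairSpan φ E Cs (insert u J) := by
    intro s u hsJ hu huJ
    have h := (colorable_insert_pair huJ).2 hu
    rw [insert_comm] at h
    refine (colorable_insert_pair ?_).1 h
    rw [mem_insert] at huJ ⊢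
    push Not at huJ ⊢
    exact ⟨huJ.1.symm, hsJ⟩
  have step1 : PairStep φ E δ Cs p (insert s(y, x) (insert s(b, c) J))
      (insert s(x, a) (insert s(b, c) J)) := by
    refine pairStep_insert (hJp.insert hb hc hbc hbJ hcJ) ?_ hy hx ha hxy.symm hax.symm
      hay.symm (unc hby.symm hcy.symm hyJ) (unc hbx.symm hcx.symm hxJ)
      (unc hab hac haJ) ?_ ?_
    · rw [card_insert_of_notMem (nm hbJ)]; omega
    · rw [add_comm]
      exact swapped (s := s(x, y)) (nm hxJ) h₅ (nin hbx hby hbJ)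
    · rw [add_comm]
      exact swapped (s := s(a, x)) (nm haJ) key1 (nin hab.symm hbx hbJ)
  have step2 : PairStep φ E δ Cs p (insert s(b, c) (insert s(a, x) J))
      (insert s(c, y) (insert s(a, x) J)) := by
    refine pairStep_insert (hJp.insert ha hx hax haJ hxJ) ?_ hb hc hy hbc hcy hby
      (unc hab.symm hbx hbJ) (unc hac.symm hcx hcJ) (unc hay.symm hxy.symm hyJ) key1 key2
    rw [card_insert_of_notMem (nm haJ)]; omega
  have step3 : PairStep φ E δ Cs p (insert s(x, a) (insert s(c, y) J))
      (insert s(a, b) (insert s(c, y) J)) := by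
    refine pairStep_insert (hJp.insert hc hy hcy hcJ hyJ) ?_ hx ha hb hax.symm hab hbx.symm
      (unc hcx.symm hxy hxJ) (unc hac hay haJ) (unc hbc hby hbJ) ?_ ?_
    · rw [card_insert_of_notMem (nm hcJ)]; omega
    · rw [add_comm]
      exact swapped (s := s(a, x)) (nm haJ) key2 (nin hac.symm hcx hcJ)
    · exact swapped (s := s(a, b)) (nm haJ) key3 (nin hac.symm hbc.symm hcJ)
  rw [Sym2.eq_swap (a := y), Sym2.eq_swap (a := x) (b := a), insert_comm,
    insert_comm s(a, x)] at step1
  rw [Sym2.eq_swap (a := x) (b := a), insert_comm s(a, x)] at step3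
  exact ⟨((ReflTransGen.single step1).tail step2).tail step3, step3.2.1⟩

/-- A pair of `m'` with a member that `m` does not cover can be moved into `m` while all common
pairs are kept. -/
lemma exists_reach_insert_inter {v : V} (hE : ∀ e ∈ E, ∃ x y, φ e = edgeVec x y)
    (hδ : ∀ e ∈ δ, ∃ x, φ e = edgeVec v x) (hm : IsRealized φ E δ Cs p m)
    (hm' : IsRealized φ E δ Cs p m') {a b : κ} (ha' : ∀ s ∈ m, a ∉ s) (hab : s(a, b) ∈ m') :
    ∃ m₁, ReflTransGen (PairStep φ E δ Cs p) m m₁ ∧ IsRealized φ E δ Cs p m₁ ∧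
      insert s(a, b) (m ∩ m') ⊆ m₁ := by
  have hne : a ≠ b := by simpa using hm'.pairing.not_isDiag _ hab
  have ha := hm'.pairing.mem _ hab a (Sym2.mem_mk_left _ _)
  have hb := hm'.pairing.mem _ hab b (Sym2.mem_mk_right _ _)
  have habm : s(a, b) ∉ m := notMem_of_forall_notMem ha'
  have habc : s(a, b) ∉ m ∩ m' := fun h => habm (mem_inter.1 h).1
  have hind : Colorable (ZMod 2) (extVec φ) Cs (E.disjSum (insert s(a, b) (m ∩ m'))) :=
    hm'.colorable.mono (disjSum_mono_right' (by
      intro x hx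
      rcases mem_insert.1 hx with rfl | hx
      · exact hab
      · exact (mem_inter.1 hx).2))
  have hc₀ : φ a + φ b ∉ pairSpan φ E Cs (m ∩ m') := (colorable_insert_pair habc).1 hind
  by_cases hbm : ∀ s ∈ m, b ∉ s
  · -- Neither `a` nor `b` is covered: some pair `s(c, d)` can be exchanged for `s(a, b)`.
    have hlt : (m ∩ m').card < m.card := by
      refine card_lt_card ⟨inter_subset_left, fun h => ?_⟩
      have : m = m' := eq_of_subset_of_card_le (fun x hx => (mem_inter.1 (h hx)).2)
        (by rw [hm.card, hm'.card])
      exact habm (this ▸ hab)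
    obtain ⟨I, hI1, hI2, hI3, hI4⟩ := exists_pairs_superset hind hm.colorable
      (by rw [card_insert_of_notMem habc]; omega)
    obtain ⟨s, hs, hsI⟩ : ∃ s ∈ m, s ∉ I := by
      by_contra! hcon
      have : insert s(a, b) m ⊆ I := by
        intro x hx
        rcases mem_insert.1 hx with rfl | hx
        · exact hI1 (mem_insert_self _ _)
        · exact hcon x hx
      have := card_le_card this
      rw [card_insert_of_notMem habm] at this
      omega
    have hIe : I = insert s(a, b) (m.erase s) := by
      refine eq_of_subset_of_card_le ?_ ?_
      · intro x hx
        have hxs : x ≠ s := by rintro rfl; exact hsI hx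
        have := hI2 hx
        simp only [mem_union, mem_insert, mem_erase, mem_inter] at this ⊢; tauto
      · rw [card_insert_of_notMem (fun h => habm (mem_of_mem_erase h)), hI3,
          card_erase_add_one hs]
    have hsub : m ∩ m' ⊆ m.erase s := by
      intro x hx
      refine mem_erase.2 ⟨?_, (mem_inter.1 hx).1⟩
      rintro rfl
      exact hsI (hI1 (mem_insert_of_mem hx))
    rw [hIe] at hI4
    have habJ : φ a + φ b ∉ pairSpan φ E Cs (m.erase s) :=
      (colorable_insert_pair fun h => habm (mem_of_mem_erase h)).1 hI4
    obtain ⟨-, hJc⟩ := hm.erase hs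
    have hJ := hm.pairing.mono (erase_subset s m)
    have haJ : ∀ t ∈ m.erase s, a ∉ t := fun t ht => ha' t (mem_of_mem_erase ht)
    have hbJ : ∀ t ∈ m.erase s, b ∉ t := fun t ht => hbm t (mem_of_mem_erase ht)
    have fin : ∀ c ∈ s, φ c + φ a ∉ pairSpan φ E Cs (m.erase s) →
        PairStep φ E δ Cs p m (insert s(c, a) (m.erase s)) →
        ∃ m₁, ReflTransGen (PairStep φ E δ Cs p) m m₁ ∧ IsRealized φ E δ Cs p m₁ ∧
          insert s(a, b) (m ∩ m') ⊆ m₁ := by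
      intro c hc hca hstep
      have hac : c ≠ a := by rintro rfl; exact ha' s hs hc
      have hbc : c ≠ b := by rintro rfl; exact hbm s hs hc
      have hstep' := pairStep_insert (Cs := Cs) hJ hJc (hm.pairing.mem _ hs c hc) ha hb hac hne hbc
        (hm.pairing.notMem_of_mem_erase hs hc) haJ hbJ hca habJ
      exact ⟨_, (ReflTransGen.single hstep).tail hstep', hstep'.2.1, insert_subset_insert _ hsub⟩
    induction s with
    | _ c d =>
      rcases exists_replace hm hs ha ha' with ⟨h1, h2⟩ | ⟨h1, h2⟩
      · exact fin c (Sym2.mem_mk_left _ _) h1 h2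
      · exact fin d (Sym2.mem_mk_right _ _) h1 h2
  · push Not at hbm
    obtain ⟨s, hs, hbs⟩ := hbm
    obtain ⟨c, rfl⟩ := hbs
    set W := m.erase s(b, c) with hW
    obtain ⟨hbcW, hWc⟩ := hm.erase hs
    rw [pairVec_mk, ← hW] at hbcW
    rw [← hW] at hWc
    have hWp := hm.pairing.mono (erase_subset s(b, c) m)
    have hbc : b ≠ c := by simpa using hm.pairing.not_isDiag _ hs
    have hac : a ≠ c := by rintro rfl; exact ha' _ hs (Sym2.mem_mk_right _ _)
    have hc := hm.pairing.mem _ hs c (Sym2.mem_mk_right _ _)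
    have haW : ∀ t ∈ W, a ∉ t := fun t ht => ha' t (mem_of_mem_erase ht)
    have hbW : ∀ t ∈ W, b ∉ t := hm.pairing.notMem_of_mem_erase hs (Sym2.mem_mk_left _ _)
    have hcW : ∀ t ∈ W, c ∉ t := hm.pairing.notMem_of_mem_erase hs (Sym2.mem_mk_right _ _)
    have hmW : m = insert s(b, c) W := (insert_erase hs).symm
    have hbcm' : s(b, c) ∉ m' := fun h => by
      have := hm'.pairing.eq_of_mem _ h _ hab b (Sym2.mem_mk_left _ _) (Sym2.mem_mk_right _ _)
      rw [Sym2.eq_iff] at this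
      rcases this with ⟨h1, -⟩ | ⟨-, h1⟩
      · exact hne h1.symm
      · exact hac h1.symm
    have hsub : m ∩ m' ⊆ W := by
      intro x hx
      refine mem_erase.2 ⟨?_, (mem_inter.1 hx).1⟩
      rintro rfl
      exact hbcm' (mem_inter.1 hx).2
    by_cases habW : φ a + φ b ∈ pairSpan φ E Cs W
    · -- A pair `s(d, e)` in the fundamental circuit of `s(a, b)` is moved to `s(a, b)` in three
      -- steps.
      have hWcol : Colorable (ZMod 2) (extVec φ) Cs (E.disjSum W) :=
        hm.colorable.mono (disjSum_mono_right' (erase_subset _ _))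
      obtain ⟨d₀, e₀, hdeW, hdeJ, habJ, had₀, hae₀⟩ := exists_pair_exchange hE hδ hWp hWcol hsub
        ha hb (fun h => habm (mem_of_mem_erase h)) habW hc₀
      have hde : φ d₀ + φ e₀ ∉ pairSpan φ E Cs (W.erase s(d₀, e₀)) := by
        rw [← pairVec_mk]
        refine (colorable_insert_pair (notMem_erase _ _)).1 ?_
        rwa [insert_erase hdeW]
      -- The names `x` and `y` of the two members are chosen such that `s(a, x)` is independent.
      obtain ⟨x, y, hxyW, hxyJ, habJ, hax, hay, haxJ⟩ : ∃ x y, s(x, y) ∈ W ∧ s(x, y) ∉ m ∩ m' ∧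
          φ a + φ b ∉ pairSpan φ E Cs (W.erase s(x, y)) ∧ φ a + φ x ∈ pairSpan φ E Cs W ∧
          φ a + φ y ∈ pairSpan φ E Cs W ∧ φ a + φ x ∉ pairSpan φ E Cs (W.erase s(x, y)) := by
        rcases add_notMem_or (φ a) hde with h | h
        · exact ⟨d₀, e₀, hdeW, hdeJ, habJ, had₀, hae₀, by rwa [add_comm]⟩
        · rw [Sym2.eq_swap (a := d₀)] at hdeW hdeJ habJ h
          exact ⟨e₀, d₀, hdeW, hdeJ, habJ, hae₀, had₀, h⟩
      set J := W.erase s(x, y) with hJ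
      have hWJ : W = insert s(x, y) J := (insert_erase hxyW).symm
      have hJp := hWp.mono (erase_subset s(x, y) W)
      have hJW : J ⊆ W := erase_subset _ _
      have haJ : ∀ t ∈ J, a ∉ t := fun t ht => haW t (hJW ht)
      have hbJ : ∀ t ∈ J, b ∉ t := fun t ht => hbW t (hJW ht)
      have hcJ : ∀ t ∈ J, c ∉ t := fun t ht => hcW t (hJW ht)
      have hxJ : ∀ t ∈ J, x ∉ t := hWp.notMem_of_mem_erase hxyW (Sym2.mem_mk_left _ _)
      have hyJ : ∀ t ∈ J, y ∉ t := hWp.notMem_of_mem_erase hxyW (Sym2.mem_mk_right _ _)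
      have hxy : x ≠ y := by simpa using hWp.not_isDiag _ hxyW
      have hx := hWp.mem _ hxyW x (Sym2.mem_mk_left _ _)
      have hy := hWp.mem _ hxyW y (Sym2.mem_mk_right _ _)
      have hax' : a ≠ x := by rintro rfl; exact haW _ hxyW (Sym2.mem_mk_left _ _)
      have hay' : a ≠ y := by rintro rfl; exact haW _ hxyW (Sym2.mem_mk_right _ _)
      have hbx' : b ≠ x := by rintro rfl; exact hbW _ hxyW (Sym2.mem_mk_left _ _)
      have hby' : b ≠ y := by rintro rfl; exact hbW _ hxyW (Sym2.mem_mk_right _ _)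
      have hcx' : c ≠ x := by rintro rfl; exact hcW _ hxyW (Sym2.mem_mk_left _ _)
      have hcy' : c ≠ y := by rintro rfl; exact hcW _ hxyW (Sym2.mem_mk_right _ _)
      have hcard : J.card + 1 = W.card := card_erase_add_one hxyW
      have hcyW : φ c + φ y ∉ pairSpan φ E Cs W := by
        intro h
        refine hbcW ?_
        have h' := add_mem (add_mem h hay) habW
        rwa [show φ c + φ y + (φ a + φ y) + (φ a + φ b) =
          φ b + φ c + (φ y + φ y) + (φ a + φ a) by abel, add_self_eq_zero', add_self_eq_zero',
          add_zero, add_zero] at h'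
      have hmJ : m = insert s(b, c) (insert s(x, y) J) := by rw [← hWJ, hmW]
      rw [hWJ] at hax habW hbcW hcyW
      obtain ⟨hreach, hreal⟩ := reach_insert_insert hJp (show J.card + 2 = p by omega)
        ha hb hc hx hy hne hac hax' hay' hbc hbx' hby' hcx' hcy' hxy
        haJ hbJ hcJ hxJ hyJ haxJ habJ hax habW hbcW hcyW
      rw [← hmJ] at hreach
      refine ⟨_, hreach, hreal,
        insert_subset_insert _ fun z hz => mem_insert_of_mem (mem_erase.2 ⟨?_, hsub hz⟩)⟩
      rintro rfl
      exact hxyJ hz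
    · have hstep := pairStep_insert (Cs := Cs) hWp hWc hc hb ha hbc.symm hne.symm hac.symm hcW hbW
        haW (by rwa [add_comm]) (by rwa [add_comm])
      rw [Sym2.eq_swap, ← hmW, Sym2.eq_swap] at hstep
      exact ⟨_, .single hstep, hstep.2.1, insert_subset_insert _ hsub⟩

/-- Any two realized pairings are connected by replacements of single members, provided that a
pairing leaves at least one element uncovered. -/
theorem pairStep_connected {v : V} (hE : ∀ e ∈ E, ∃ x y, φ e = edgeVec x y)
    (hδ : ∀ e ∈ δ, ∃ x, φ e = edgeVec v x) (hp : 2 * p < δ.card) (hm : IsRealized φ E δ Cs p m)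
    (hm' : IsRealized φ E δ Cs p m') : ReflTransGen (PairStep φ E δ Cs p) m m' := by
  have hcov : ∀ m, IsPairing δ m → ∃ S : Finset κ, (∀ a, a ∈ S ↔ ∃ s ∈ m, a ∈ s) ∧
      S.card = 2 * m.card ∧ S ⊆ δ := by
    intro m hm
    have hmem : ∀ a, a ∈ m.biUnion Sym2.toFinset ↔ ∃ s ∈ m, a ∈ s := by simp
    refine ⟨m.biUnion Sym2.toFinset, hmem, ?_, fun a ha => ?_⟩
    · rw [card_biUnion, sum_congr rfl fun s hs =>
        Sym2.card_toFinset_of_not_isDiag s (hm.not_isDiag s hs)]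
      · simp [mul_comm]
      · intro s hs t ht hst
        refine disjoint_left.2 fun a ha hb => ?_
        exact hst (hm.eq_of_mem s hs t ht a (by simpa using ha) (by simpa using hb))
    · obtain ⟨s, hs, has⟩ := (hmem a).1 ha
      exact hm.mem s hs a has
  obtain ⟨k, hk⟩ : ∃ k, k = (m \ m').card := ⟨_, rfl⟩
  induction k using Nat.strong_induction_on generalizing m with
  | _ k ih =>
    by_cases hmm : m = m'
    · rw [hmm]
    have hnsub : ¬ m ⊆ m' := fun h =>
      hmm (eq_of_subset_of_card_le h (by rw [hm.card, hm'.card]))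
    -- progress is possible as soon as `m'` covers an element that `m` does not cover
    have progress : ∀ m₁, IsRealized φ E δ Cs p m₁ → (m ∩ m' ⊆ m₁) →
        (∃ a, (∃ s ∈ m', a ∈ s) ∧ ∀ s ∈ m₁, a ∉ s) →
        ReflTransGen (PairStep φ E δ Cs p) m₁ m' := by
      rintro m₁ hm₁ hsub ⟨a, ⟨s, hs, has⟩, hna⟩
      obtain ⟨b, rfl⟩ := has
      obtain ⟨m₂, hr, hm₂, hins⟩ := exists_reach_insert_inter hE hδ hm₁ hm' hna hs
      refine hr.trans (ih _ ?_ hm₂ rfl)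
      have h1 : (m₂ \ m').card + (m₂ ∩ m').card = p := by
        rw [card_sdiff_add_card_inter, hm₂.card]
      have h2 : (m \ m').card + (m ∩ m').card = p := by
        rw [card_sdiff_add_card_inter, hm.card]
      have h3 : insert s(a, b) (m ∩ m') ⊆ m₂ ∩ m' := by
        intro x hx
        rcases mem_insert.1 hx with rfl | hx
        · exact mem_inter.2 ⟨hins (mem_insert_self _ _), hs⟩
        · have := (mem_inter.1 hx).2
          exact mem_inter.2 ⟨hins (mem_insert_of_mem (mem_inter.2 ⟨hsub hx, this⟩)), this⟩
      have h4 := card_le_card h3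
      rw [card_insert_of_notMem] at h4
      · omega
      · intro h
        exact hna _ (hsub h) (Sym2.mem_mk_left _ _)
    obtain ⟨S, hS, hSc, hSδ⟩ := hcov m hm.pairing
    obtain ⟨S', hS', hSc', hSδ'⟩ := hcov m' hm'.pairing
    by_cases hSS : ∃ a ∈ S', a ∉ S
    · obtain ⟨a, ha, ha'⟩ := hSS
      rw [hS'] at ha
      rw [hS] at ha'
      push Not at ha'
      exact progress m hm inter_subset_left ⟨a, ha, ha'⟩
    · -- otherwise both cover the same elements, and one replacement changes that
      push Not at hSS
      have hSeq : S' = S := eq_of_subset_of_card_le hSS (by rw [hSc, hSc', hm.card, hm'.card])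
      obtain ⟨a, ha, haS⟩ : ∃ a ∈ δ, a ∉ S := by
        by_contra! hcon
        have := card_le_card hcon
        rw [hSc, hm.card] at this
        omega
      have haS' := haS
      rw [← hSeq, hS'] at haS'
      rw [hS] at haS
      push Not at haS haS'
      obtain ⟨s, hs, hsm'⟩ := not_subset.1 hnsub
      have fin : ∀ c d, s = s(c, d) → PairStep φ E δ Cs p m (insert s(d, a) (m.erase s)) →
          ReflTransGen (PairStep φ E δ Cs p) m m' := by
        rintro c d rfl hstep
        refine (ReflTransGen.single hstep).trans (progress _ hstep.2.1 ?_ ⟨c, ?_, ?_⟩)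
        · intro x hx
          refine mem_insert_of_mem (mem_erase.2 ⟨?_, (mem_inter.1 hx).1⟩)
          rintro rfl
          exact hsm' (mem_inter.1 hx).2
        · rw [← hS', hSeq, hS]
          exact ⟨_, hs, Sym2.mem_mk_left _ _⟩
        · intro t ht hct
          rcases mem_insert.1 ht with rfl | ht
          · rcases Sym2.mem_iff.1 hct with rfl | rfl
            · exact hm.pairing.not_isDiag _ hs rfl
            · exact haS _ hs (Sym2.mem_mk_left _ _)
          · exact hm.pairing.notMem_of_mem_erase hs (Sym2.mem_mk_left _ _) t ht hct
      induction s with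
      | _ c d =>
        rcases exists_replace hm hs ha haS with ⟨-, h⟩ | ⟨-, h⟩
        · exact fin d c Sym2.eq_swap h
        · exact fin c d rfl h

end PairingGraph

/-! ### Stars and lifts -/

section LinearAlgebra

variable {K W κ : Type*} [Field K] [AddCommGroup W] [Module K W] [DecidableEq κ] {φ : κ → W}

lemma exists_extension {F : Finset κ} (hF : LinearIndepOn K φ (F : Set κ)) (U : Finset κ) :
    ∃ S ⊆ U, Disjoint F S ∧ LinearIndepOn K φ ((F ∪ S : Finset κ) : Set κ) ∧
      ∀ u ∈ U, φ u ∈ span K (φ '' ((F ∪ S : Finset κ) : Set κ)) := by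
  obtain ⟨b, hbU, hFb, hspan, hb⟩ := exists_linearIndepOn_extension hF
    (show (F : Set κ) ⊆ ((F ∪ U : Finset κ) : Set κ) by simp)
  have hfin : b.Finite := (F ∪ U).finite_toSet.subset hbU
  have hS : F ∪ (hfin.toFinset \ F) = hfin.toFinset :=
    union_sdiff_of_subset fun x hx => by simpa using hFb hx
  refine ⟨hfin.toFinset \ F, fun x hx => ?_, disjoint_sdiff, ?_, fun u hu => ?_⟩
  · have := hbU (show x ∈ b by simpa using (mem_sdiff.1 hx).1)
    simp only [coe_union, Set.mem_union, mem_coe] at this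
    exact this.resolve_left (mem_sdiff.1 hx).2
  · rw [hS, hfin.coe_toFinset]; exact hb
  · rw [hS, hfin.coe_toFinset]
    exact hspan ⟨u, by simp [hu], rfl⟩

lemma notMem_span_erase {T : Finset κ} (hT : LinearIndepOn K φ (T : Set κ)) {w : W} {μ : κ → K}
    (hw : w = ∑ f ∈ T, μ f • φ f) {f : κ} (hf : f ∈ T) (hμ : μ f ≠ 0) :
    w ∉ span K (φ '' ((T.erase f : Finset κ) : Set κ)) := by
  intro hmem
  refine hT.notMem_span hf ?_
  rw [← add_sum_erase _ _ hf] at hw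
  have h1 : φ f = (μ f)⁻¹ • (w - ∑ x ∈ T.erase f, μ x • φ x) := by
    rw [hw, add_sub_cancel_right, smul_smul, inv_mul_cancel₀ hμ, one_smul]
  rw [h1, ← coe_erase]
  exact smul_mem _ _ (sub_mem hmem (sum_mem fun x hx => smul_mem _ _ (subset_span ⟨x, hx, rfl⟩)))

/-- Basis exchange that keeps the common elements of `T` and `T'`. -/
lemma exists_exchange {T T' : Finset κ} (hT : LinearIndepOn K φ (T : Set κ))
    (hT' : LinearIndepOn K φ (T' : Set κ)) {e : κ} (he' : e ∈ T') (he : e ∉ T)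
    (hspan : φ e ∈ span K (φ '' (T : Set κ))) :
    ∃ f ∈ T, f ∉ T' ∧ LinearIndepOn K φ ((insert e (T.erase f) : Finset κ) : Set κ) := by
  obtain ⟨μ, hμ⟩ := exists_sum_eq_of_mem_span hspan
  obtain ⟨f, hf, hfT', hne⟩ : ∃ f ∈ T, f ∉ T' ∧ μ f ≠ 0 := by
    by_contra! hcon
    refine hT'.notMem_span he' ?_
    rw [hμ]
    refine sum_mem fun f hf => ?_
    by_cases hfT' : f ∈ T'
    · refine smul_mem _ _ (subset_span ⟨f, ⟨hfT', ?_⟩, rfl⟩)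
      rintro rfl; exact he hf
    · rw [hcon f hf hfT', zero_smul]; exact zero_mem _
  refine ⟨f, hf, hfT', ?_⟩
  rw [coe_insert]
  exact (hT.mono (by simp)).insert (notMem_span_erase hT hμ hf hne)

/-- The symmetric exchange property of bases. -/
lemma exists_symmetric_exchange {T T' : Finset κ} (hT : LinearIndepOn K φ (T : Set κ))
    (hT' : LinearIndepOn K φ (T' : Set κ)) {s : κ} (hs : s ∈ T)
    (hspan : φ s ∈ span K (φ '' (T' : Set κ))) :
    ∃ f ∈ T', φ f ∉ span K (φ '' ((T.erase s : Finset κ) : Set κ)) ∧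
      φ s ∉ span K (φ '' ((T'.erase f : Finset κ) : Set κ)) := by
  obtain ⟨μ, hμ⟩ := exists_sum_eq_of_mem_span hspan
  obtain ⟨f, hf, hne, hfs⟩ : ∃ f ∈ T', μ f ≠ 0 ∧
      φ f ∉ span K (φ '' ((T.erase s : Finset κ) : Set κ)) := by
    by_contra! hcon
    refine hT.notMem_span hs ?_
    rw [← coe_erase, hμ]
    refine sum_mem fun f hf => ?_
    by_cases hne : μ f = 0
    · rw [hne, zero_smul]; exact zero_mem _
    · exact smul_mem _ _ (hcon f hf hne)
  exact ⟨f, hf, hfs, notMem_span_erase hT' hμ hf hne⟩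

end LinearAlgebra

section Star

variable {V κ C : Type*} [DecidableEq V] [DecidableEq κ] [DecidableEq C]

/-- The subspace of the vectors in `L` that vanish at `v`. -/
abbrev vanishAt (L : Submodule (ZMod 2) (V → ZMod 2)) (v : V) : Submodule (ZMod 2) (V → ZMod 2) :=
  L ⊓ LinearMap.ker (LinearMap.proj v : (V → ZMod 2) →ₗ[ZMod 2] ZMod 2)

/-- The edges in `X` span `L` and have the right number for a partition into bases indexed by
`Cs`. They are split into the edges `δ` at a vertex `v` and the set `E` of all others; the number
of edges at `v` exceeds the number of bases by `p` and is less than twice that number. -/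
structure IsStar (φ : κ → V → ZMod 2) (X : Finset κ) (Cs : Finset C)
    (L : Submodule (ZMod 2) (V → ZMod 2)) (v : V) (E δ : Finset κ) (p : ℕ) : Prop where
  card : X.card = Cs.card * Module.finrank (ZMod 2) L
  mem : ∀ x ∈ X, φ x ∈ L
  edge : ∀ x ∈ X, ∃ y z, φ x = edgeVec y z
  mem_left : ∀ e, e ∈ E ↔ e ∈ X ∧ φ e v = 0
  mem_right : ∀ e, e ∈ δ ↔ e ∈ X ∧ φ e v = 1
  card_right : δ.card = Cs.card + p
  lt : p < Cs.card
  finrank : Module.finrank (ZMod 2) (vanishAt L v) + 1 = Module.finrank (ZMod 2) L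

variable {φ : κ → V → ZMod 2} {X : Finset κ} {Cs : Finset C}
  {L : Submodule (ZMod 2) (V → ZMod 2)} {v : V} {E δ : Finset κ} {p : ℕ}
  [FiniteDimensional (ZMod 2) L] {m m' : Finset (Sym2 κ)} {t t' : κ ⊕ Sym2 κ → C} {c c' : κ → C}

lemma card_fiber_eq_finrank {K W κ : Type*} [Field K] [AddCommGroup W] [Module K W]
    [DecidableEq κ] {φ : κ → W} {X : Finset κ} {L : Submodule K W} [FiniteDimensional K L]
    {c : κ → C} (hX : X.card = Cs.card * Module.finrank K L)
    (hL : ∀ x ∈ X, φ x ∈ L) (hc : IsIndepColoring K φ X Cs c) {i : C} (hi : i ∈ Cs) :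
    (fiber X c i).card = Module.finrank K L := by
  have hle : ∀ i ∈ Cs, (fiber X c i).card ≤ Module.finrank K L := fun i _ =>
    card_le_finrank (hc.indep i) fun e he => hL e (mem_fiber.1 he).1
  have hsum : ∑ i ∈ Cs, (fiber X c i).card = ∑ i ∈ Cs, Module.finrank K L := by
    rw [sum_card_fiber hc.mem, hX, sum_const, smul_eq_mul]
  exact (sum_eq_sum_iff_of_le hle).1 hsum i hi

lemma span_fiber_eq {K W κ : Type*} [Field K] [AddCommGroup W] [Module K W]
    [DecidableEq κ] {φ : κ → W} {X : Finset κ} {L : Submodule K W} [FiniteDimensional K L]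
    {c : κ → C} (hX : X.card = Cs.card * Module.finrank K L)
    (hL : ∀ x ∈ X, φ x ∈ L) (hc : IsIndepColoring K φ X Cs c) {i : C} (hi : i ∈ Cs) :
    span K (φ '' (fiber X c i : Set κ)) = L :=
  span_eq_of_card (hc.indep i) (fun e he => hL e (mem_fiber.1 he).1)
    (card_fiber_eq_finrank hX hL hc hi).ge

/-- `c` arises from the colouring `t` of the edges in `E` and the pairs in `m` as follows: the
edges in `E` keep their colours, and in a colour class that contains pairs, these are replaced by
some of their members. The remaining edges at `v` are distributed among the other colour classes. -/
structure IsLift (φ : κ → V → ZMod 2) (X : Finset κ) (Cs : Finset C) (E δ : Finset κ)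
    (m : Finset (Sym2 κ)) (t : κ ⊕ Sym2 κ → C) (c : κ → C) : Prop where
  coloring : IsIndepColoring (ZMod 2) φ X Cs c
  eq_left : ∀ e ∈ E, c e = t (Sum.inl e)
  cover : ∀ a ∈ δ, ∀ s ∈ m, t (Sum.inr s) = c a → ∃ s' ∈ m, t (Sum.inr s') = c a ∧ a ∈ s'

/-- The edges of colour `i` not incident with `v`. -/
abbrev leftFiber (E : Finset κ) (t : κ ⊕ Sym2 κ → C) (i : C) : Finset κ := fiber E (t ∘ Sum.inl) i

/-- The pairs of colour `i`. -/
abbrev pairFiber (m : Finset (Sym2 κ)) (t : κ ⊕ Sym2 κ → C) (i : C) : Finset (Sym2 κ) :=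
  fiber m (t ∘ Sum.inr) i

lemma fiber_disjSum (i : C) :
    fiber (E.disjSum m) t i = (leftFiber E t i).disjSum (pairFiber m t i) := by
  ext x; cases x <;> simp

namespace IsStar

variable (h : IsStar φ X Cs L v E δ p)
include h

lemma right_edge : ∀ e ∈ δ, ∃ x, φ e = edgeVec v x := by
  intro e he
  obtain ⟨heX, hev⟩ := (h.mem_right e).1 he
  obtain ⟨x, y, hxy⟩ := h.edge e heX
  rw [hxy, edgeVec_apply] at hev
  by_cases hx : v = x
  · exact ⟨y, by rw [hxy, hx]⟩
  · by_cases hy : v = y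
    · exact ⟨x, by rw [hxy, hy, edgeVec_comm]⟩
    · simp [hx, hy] at hev

lemma left_edge : ∀ e ∈ E, ∃ x y, φ e = edgeVec x y :=
  fun e he => h.edge e ((h.mem_left e).1 he).1

lemma union_eq : E ∪ δ = X := by
  ext e
  rw [mem_union, h.mem_left, h.mem_right]
  rcases zmod_two_cases (φ e v) with h | h <;> simp [h]

lemma disjoint : Disjoint E δ := by
  rw [disjoint_left]
  intro e he he'
  rw [h.mem_left] at he; rw [h.mem_right] at he'
  rw [he.2] at he'
  exact zero_ne_one he'.2

lemma left_subset : E ⊆ X := fun e he => ((h.mem_left e).1 he).1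

lemma right_subset : δ ⊆ X := fun e he => ((h.mem_right e).1 he).1

lemma fiber_eq (i : C) : fiber X c i = fiber E c i ∪ fiber δ c i := by
  ext e; rw [← h.union_eq]; simp only [mem_fiber, mem_union]; tauto

lemma card_disjSum (hm : m.card = p) :
    (E.disjSum m).card = Cs.card * Module.finrank (ZMod 2) (vanishAt L v) := by
  have h1 := card_union_of_disjoint h.disjoint
  rw [h.union_eq, h.card, h.card_right, ← h.finrank, mul_add] at h1
  rw [Finset.card_disjSum, hm]
  omega

lemma disjSum_mem (hm : IsPairing δ m) : ∀ x ∈ E.disjSum m, extVec φ x ∈ vanishAt L v := by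
  intro x hx
  cases x with
  | inl e =>
    have he := (h.mem_left e).1 (by simpa using hx)
    exact ⟨h.mem e he.1, he.2⟩
  | inr s =>
    induction s with
    | _ a b =>
      have hs : s(a, b) ∈ m := by simpa using hx
      have ha := (h.mem_right a).1 (hm.mem _ hs a (Sym2.mem_mk_left _ _))
      have hb := (h.mem_right b).1 (hm.mem _ hs b (Sym2.mem_mk_right _ _))
      refine ⟨add_mem (h.mem a ha.1) (h.mem b hb.1), ?_⟩
      change φ a v + φ b v = 0
      rw [ha.2, hb.2]; decide

lemma card_left_add (hm : IsPairing δ m) (hmp : m.card = p)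
    (ht : IsIndepColoring (ZMod 2) (extVec φ) (E.disjSum m) Cs t) {i : C} (hi : i ∈ Cs) :
    (leftFiber E t i).card + (pairFiber m t i).card + 1 = Module.finrank (ZMod 2) L := by
  have h1 := card_fiber_eq_finrank (h.card_disjSum hmp) (h.disjSum_mem hm) ht hi
  rw [fiber_disjSum, Finset.card_disjSum] at h1
  rw [h1, h.finrank]

lemma vanishAt_le (hm : IsPairing δ m) (hmp : m.card = p)
    (ht : IsIndepColoring (ZMod 2) (extVec φ) (E.disjSum m) Cs t) {i : C} (hi : i ∈ Cs)
    {S : Submodule (ZMod 2) (V → ZMod 2)} (hl : ∀ e ∈ leftFiber E t i, φ e ∈ S)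
    (hr : ∀ s ∈ pairFiber m t i, pairVec φ s ∈ S) : vanishAt L v ≤ S := by
  rw [← span_fiber_eq (h.card_disjSum hmp) (h.disjSum_mem hm) ht hi, span_le, fiber_disjSum]
  rintro _ ⟨x, hx, rfl⟩
  cases x with
  | inl e => exact hl e (by simpa using hx)
  | inr s => exact hr s (by simpa using hx)

lemma indep_left (ht : IsIndepColoring (ZMod 2) (extVec φ) (E.disjSum m) Cs t) (i : C) :
    LinearIndepOn (ZMod 2) φ (leftFiber E t i : Set κ) := by
  refine LinearIndepOn.comp_of_image (f := Sum.inl) (v := extVec φ) ((ht.indep i).mono ?_)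
    Sum.inl_injective.injOn
  rintro _ ⟨x, hx, rfl⟩
  rw [fiber_disjSum]; simpa using hx

/-- An edge at `v` is independent of edges that avoid `v`. -/
lemma indep_insert {F : Finset κ} (hF : LinearIndepOn (ZMod 2) φ (F : Set κ))
    (hFE : F ⊆ E) {a : κ} (ha : a ∈ δ) :
    LinearIndepOn (ZMod 2) φ ((insert a F : Finset κ) : Set κ) := by
  rw [coe_insert]
  refine hF.insert fun hmem => ?_
  have : span (ZMod 2) (φ '' (F : Set κ)) ≤
      LinearMap.ker (LinearMap.proj v : (V → ZMod 2) →ₗ[ZMod 2] ZMod 2) := by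
    rw [span_le]
    rintro _ ⟨e, he, rfl⟩
    exact ((h.mem_left e).1 (hFE he)).2
  have h0 : φ a v = 0 := this hmem
  rw [((h.mem_right a).1 ha).2] at h0
  exact one_ne_zero h0

lemma card_right_fiber (hm : IsPairing δ m) (hmp : m.card = p)
    (ht : IsIndepColoring (ZMod 2) (extVec φ) (E.disjSum m) Cs t)
    (hc : IsLift φ X Cs E δ m t c) {i : C} (hi : i ∈ Cs) :
    (fiber δ c i).card = (pairFiber m t i).card + 1 := by
  have h1 := h.card_left_add hm hmp ht hi
  have h2 := card_fiber_eq_finrank h.card h.mem hc.coloring hi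
  have hF : fiber E c i = leftFiber E t i := fiber_congr hc.eq_left i
  rw [h.fiber_eq, hF, card_union_of_disjoint] at h2
  · omega
  · exact disjoint_of_subset_left (filter_subset _ _)
      (disjoint_of_subset_right (filter_subset _ _) h.disjoint)

lemma isLift_of (ht : IsIndepColoring (ZMod 2) (extVec φ) (E.disjSum m) Cs t)
    (h₁ : ∀ e ∈ E, c e = t (Sum.inl e)) (h₂ : ∀ a ∈ δ, c a ∈ Cs)
    (h₃ : ∀ i ∈ Cs, LinearIndepOn (ZMod 2) φ ((leftFiber E t i ∪ fiber δ c i : Finset κ) : Set κ))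
    (h₄ : ∀ a ∈ δ, ∀ s ∈ m, t (Sum.inr s) = c a → ∃ s' ∈ m, t (Sum.inr s') = c a ∧ a ∈ s') :
    IsLift φ X Cs E δ m t c := by
  have hmem : ∀ x ∈ X, c x ∈ Cs := by
    intro x hx
    rw [← h.union_eq, mem_union] at hx
    rcases hx with hx | hx
    · rw [h₁ x hx]; exact ht.mem _ (by simpa using hx)
    · exact h₂ x hx
  refine ⟨⟨hmem, fun i => ?_⟩, h₁, h₄⟩
  by_cases hi : i ∈ Cs
  · rw [h.fiber_eq, fiber_congr h₁ i]
    exact h₃ i hi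
  · have : fiber X c i = ∅ := by
      ext x; simp only [mem_fiber, notMem_empty, iff_false]
      rintro ⟨hx, rfl⟩; exact hi (hmem x hx)
    rw [this]; simp

/-- Edges at `v` of different colours, one of them in a class without pairs, may be swapped if the
other class stays independent. -/
lemma isLift_swap (hm : IsPairing δ m) (hmp : m.card = p)
    (ht : IsIndepColoring (ZMod 2) (extVec φ) (E.disjSum m) Cs t)
    (hc : IsLift φ X Cs E δ m t c) {e f : κ} (he : e ∈ δ) (hf : f ∈ δ) (hef : c e ≠ c f)
    (hleaf : ∀ s ∈ m, t (Sum.inr s) ≠ c f)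
    (hind : LinearIndepOn (ZMod 2) φ
      ((leftFiber E t (c e) ∪ insert f ((fiber δ c (c e)).erase e) : Finset κ) : Set κ))
    (hcov : (∀ s ∈ m, t (Sum.inr s) ≠ c e) ∨ ∃ s ∈ m, t (Sum.inr s) = c e ∧ f ∈ s) :
    IsLift φ X Cs E δ m t (c ∘ Equiv.swap e f) := by
  have hne : e ≠ f := by rintro rfl; exact hef rfl
  have hnot : ∀ x ∈ δ, ∀ y ∈ E, y ≠ x := by
    rintro x hx y hy rfl
    exact disjoint_left.1 h.disjoint hy hx
  have hleaf' : pairFiber m t (c f) = ∅ := by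
    ext s; simp only [mem_fiber, notMem_empty, iff_false]
    exact fun hs => hleaf s hs.1 hs.2
  have hsing : fiber δ c (c f) = {f} := by
    have h1 := h.card_right_fiber hm hmp ht hc (hc.coloring.mem f (h.right_subset hf))
    rw [hleaf', card_empty] at h1
    obtain ⟨a, ha⟩ := card_eq_one.1 h1
    have : f ∈ fiber δ c (c f) := by simp [hf]
    rw [ha] at this ⊢
    rw [mem_singleton.1 this]
  refine h.isLift_of ht (fun x hx => ?_) (fun x hx => ?_) (fun i hi => ?_) (fun x hx s hs hst => ?_)
  · rw [Function.comp_apply, Equiv.swap_apply_of_ne_of_ne (hnot e he x hx) (hnot f hf x hx)]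
    exact hc.eq_left x hx
  · refine hc.coloring.mem _ (h.right_subset ?_)
    by_cases hxe : x = e
    · rw [hxe, Equiv.swap_apply_left]; exact hf
    · by_cases hxf : x = f
      · rw [hxf, Equiv.swap_apply_right]; exact he
      · rwa [Equiv.swap_apply_of_ne_of_ne hxe hxf]
  · by_cases hie : i = c e
    · subst hie
      refine hind.mono ?_
      simp only [coe_union]
      refine Set.union_subset_union_right _ ?_
      intro x hx
      simp only [mem_coe, mem_fiber, Function.comp, mem_insert, mem_erase] at hx ⊢
      by_cases hxe : x = e
      · rw [hxe, Equiv.swap_apply_left] at hx; exact absurd hx.2.symm hef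
      · by_cases hxf : x = f
        · exact Or.inl hxf
        · rw [Equiv.swap_apply_of_ne_of_ne hxe hxf] at hx
          exact Or.inr ⟨hxe, hx⟩
    · by_cases hif : i = c f
      · subst hif
        refine (h.indep_insert (h.indep_left ht (c f)) (filter_subset _ _) he).mono ?_
        intro x hx
        simp only [mem_coe, mem_union, mem_insert] at hx ⊢
        rcases hx with hx | hx
        · exact Or.inr hx
        · rw [mem_fiber, Function.comp_apply] at hx
          by_cases hxe : x = e
          · exact Or.inl hxe
          · by_cases hxf : x = f
            · rw [hxf, Equiv.swap_apply_right] at hx; exact absurd hx.2 hef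
            · rw [Equiv.swap_apply_of_ne_of_ne hxe hxf] at hx
              have : x ∈ fiber δ c (c f) := by simpa using hx
              rw [hsing, mem_singleton] at this
              exact absurd this hxf
      · refine ((hc.coloring.indep i)).mono ?_
        rw [h.fiber_eq, fiber_congr hc.eq_left i]
        intro x hx
        simp only [mem_coe, mem_union] at hx ⊢
        rcases hx with hx | hx
        · exact Or.inl hx
        · right
          rw [mem_fiber] at hx ⊢; rw [Function.comp_apply] at hx
          by_cases hxe : x = e
          · rw [hxe, Equiv.swap_apply_left] at hx; exact absurd hx.2.symm hif
          · by_cases hxf : x = f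
            · rw [hxf, Equiv.swap_apply_right] at hx; exact absurd hx.2.symm hie
            · rwa [Equiv.swap_apply_of_ne_of_ne hxe hxf] at hx
  · simp only [Function.comp] at hst ⊢
    by_cases hxe : x = e
    · rw [hxe, Equiv.swap_apply_left] at hst; exact absurd hst (hleaf s hs)
    · by_cases hxf : x = f
      · rw [hxf, Equiv.swap_apply_right] at hst ⊢
        rcases hcov with hcov | hcov
        · exact absurd hst (hcov s hs)
        · exact hcov
      · rw [Equiv.swap_apply_of_ne_of_ne hxe hxf] at hst ⊢
        exact hc.cover x hx s hs hst

end IsStar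

end Star

/-! ### Existence and connectedness of lifts -/

section Lifts

/-- `c'` is obtained from `c` by interchanging the colours of two elements of `X`, or agrees with
`c` on `X`. -/
def SwapStep (K : Type*) {W κ C : Type*} [Field K] [AddCommGroup W] [Module K W] [DecidableEq κ]
    [DecidableEq C] (φ : κ → W) (X : Finset κ) (Cs : Finset C) (c c' : κ → C) : Prop :=
  IsIndepColoring K φ X Cs c ∧ IsIndepColoring K φ X Cs c' ∧
    ((∀ x ∈ X, c' x = c x) ∨ ∃ e ∈ X, ∃ f ∈ X, ∀ x ∈ X, c' x = c (Equiv.swap e f x))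

/-- `c'` is obtained from `c` by successively interchanging the colours of two elements, through
independent colourings. -/
abbrev SwapEquiv (K : Type*) {W κ C : Type*} [Field K] [AddCommGroup W] [Module K W]
    [DecidableEq κ] [DecidableEq C] (φ : κ → W) (X : Finset κ) (Cs : Finset C) :
    (κ → C) → (κ → C) → Prop := ReflTransGen (SwapStep K φ X Cs)

variable {V κ C : Type*} [DecidableEq V] [DecidableEq κ] [DecidableEq C]
variable {φ : κ → V → ZMod 2} {X : Finset κ} {Cs : Finset C}
  {L : Submodule (ZMod 2) (V → ZMod 2)} {v : V} {E δ : Finset κ} {p : ℕ}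
  [FiniteDimensional (ZMod 2) L] {m m' : Finset (Sym2 κ)} {t t' : κ ⊕ Sym2 κ → C} {c c' : κ → C}

lemma swap_mem {e f x : κ} (he : e ∈ X) (hf : f ∈ X) (hx : x ∈ X) : Equiv.swap e f x ∈ X := by
  by_cases hxe : x = e
  · rw [hxe, Equiv.swap_apply_left]; exact hf
  · by_cases hxf : x = f
    · rw [hxf, Equiv.swap_apply_right]; exact he
    · rwa [Equiv.swap_apply_of_ne_of_ne hxe hxf]

lemma SwapStep.symm {K W : Type*} [Field K] [AddCommGroup W] [Module K W] {φ : κ → W}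
    (h : SwapStep K φ X Cs c c') : SwapStep K φ X Cs c' c := by
  refine ⟨h.2.1, h.1, ?_⟩
  rcases h.2.2 with h | ⟨e, he, f, hf, h⟩
  · exact Or.inl fun x hx => (h x hx).symm
  · refine Or.inr ⟨e, he, f, hf, fun x hx => ?_⟩
    rw [h _ (swap_mem he hf hx), Equiv.swap_apply_self]

lemma SwapEquiv.symm {K W : Type*} [Field K] [AddCommGroup W] [Module K W] {φ : κ → W}
    (h : SwapEquiv K φ X Cs c c') : SwapEquiv K φ X Cs c' c := by
  induction h with
  | refl => exact .refl
  | tail _ hs ih => exact ih.head hs.symm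

/-- A basis of `L` that consists of edges of colour `i` and of edges at `v` which belong to pairs
of colour `i`. -/
structure IsTransversal (φ : κ → V → ZMod 2) (E δ : Finset κ) (m : Finset (Sym2 κ))
    (t : κ ⊕ Sym2 κ → C) (i : C) (S : Finset κ) : Prop where
  subset : S ⊆ δ
  cover : ∀ a ∈ S, ∃ s ∈ m, t (Sum.inr s) = i ∧ a ∈ s
  indep : LinearIndepOn (ZMod 2) φ ((leftFiber E t i ∪ S : Finset κ) : Set κ)
  card : S.card = (pairFiber m t i).card + 1

namespace IsStar

variable (h : IsStar φ X Cs L v E δ p)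
include h

lemma swapStep_of_isLift (hc : IsLift φ X Cs E δ m t c) {e f : κ} (he : e ∈ δ) (hf : f ∈ δ)
    (hc' : IsLift φ X Cs E δ m' t' (c ∘ Equiv.swap e f)) :
    SwapStep (ZMod 2) φ X Cs c (c ∘ Equiv.swap e f) :=
  ⟨hc.coloring, hc'.coloring,
    Or.inr ⟨e, h.right_subset he, f, h.right_subset hf, fun _ _ => rfl⟩⟩

lemma fiber_eq_singleton (hm : IsPairing δ m) (hmp : m.card = p)
    (ht : IsIndepColoring (ZMod 2) (extVec φ) (E.disjSum m) Cs t)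
    (hc : IsLift φ X Cs E δ m t c) {l : C} (hl : l ∈ Cs) (hleaf : ∀ s ∈ m, t (Sum.inr s) ≠ l) :
    ∃ f, fiber δ c l = {f} := by
  have hleaf' : pairFiber m t l = ∅ := by
    ext s; simp only [mem_fiber, notMem_empty, iff_false]
    exact fun hs => hleaf s hs.1 hs.2
  have h1 := h.card_right_fiber hm hmp ht hc hl
  rw [hleaf', card_empty] at h1
  exact card_eq_one.1 h1

/-- Two edges at `v` whose colour classes contain no pairs may be swapped. -/
lemma isLift_swap_leaf (hm : IsPairing δ m) (hmp : m.card = p)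
    (ht : IsIndepColoring (ZMod 2) (extVec φ) (E.disjSum m) Cs t)
    (hc : IsLift φ X Cs E δ m t c) {e f : κ} (he : e ∈ δ) (hf : f ∈ δ) (hef : c e ≠ c f)
    (hle : ∀ s ∈ m, t (Sum.inr s) ≠ c e) (hlf : ∀ s ∈ m, t (Sum.inr s) ≠ c f) :
    IsLift φ X Cs E δ m t (c ∘ Equiv.swap e f) := by
  refine h.isLift_swap hm hmp ht hc he hf hef hlf ?_ (Or.inl hle)
  obtain ⟨a, ha⟩ := h.fiber_eq_singleton hm hmp ht hc
    (hc.coloring.mem e (h.right_subset he)) hle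
  have hae : e ∈ fiber δ c (c e) := by simp [he]
  rw [ha, mem_singleton] at hae
  subst hae
  rw [ha, erase_singleton, union_comm, insert_empty_eq, ← insert_eq]
  exact h.indep_insert (h.indep_left ht _) (filter_subset _ _) hf

/-- Any two lifts of the same colouring are connected. -/
lemma swapEquiv_of_isLift (hm : IsPairing δ m) (hmp : m.card = p)
    (ht : IsIndepColoring (ZMod 2) (extVec φ) (E.disjSum m) Cs t)
    (hc : IsLift φ X Cs E δ m t c) (hc' : IsLift φ X Cs E δ m t c') :
    SwapEquiv (ZMod 2) φ X Cs c c' := by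
  obtain ⟨k, hk⟩ : ∃ k, k = (δ.filter fun e => c e ≠ c' e).card := ⟨_, rfl⟩
  induction k using Nat.strong_induction_on generalizing c with
  | _ k ih =>
    by_cases hall : ∀ e ∈ δ, c e = c' e
    · refine .single ⟨hc.coloring, hc'.coloring, Or.inl fun x hx => ?_⟩
      rw [← h.union_eq, mem_union] at hx
      rcases hx with hx | hx
      · rw [hc.eq_left x hx, hc'.eq_left x hx]
      · exact (hall x hx).symm
    push Not at hall
    have hCs : ∀ e ∈ δ, c e ∈ Cs := fun e he => hc.coloring.mem e (h.right_subset he)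
    have hCs' : ∀ e ∈ δ, c' e ∈ Cs := fun e he => hc'.coloring.mem e (h.right_subset he)
    -- It suffices to find a swap that corrects the colour of `e` and destroys no agreement.
    have progress : ∀ e ∈ δ, ∀ f ∈ δ, c e ≠ c' e → c f = c' e → c' f ≠ c f →
        IsLift φ X Cs E δ m t (c ∘ Equiv.swap e f) → SwapEquiv (ZMod 2) φ X Cs c c' := by
      intro e he f hf h1 h2 h3 hlift
      refine (ReflTransGen.single (h.swapStep_of_isLift hc he hf hlift)).trans
        (ih _ ?_ hlift rfl)
      rw [hk]
      refine card_lt_card ⟨fun x hx => ?_, fun hsub => ?_⟩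
      · simp only [mem_filter, Function.comp_apply] at hx ⊢
        by_cases hxe : x = e
        · subst hxe; exact ⟨he, h1⟩
        · by_cases hxf : x = f
          · subst hxf; exact ⟨hf, h3.symm⟩
          · rwa [Equiv.swap_apply_of_ne_of_ne hxe hxf] at hx
      · have : e ∈ δ.filter fun x => (c ∘ Equiv.swap e f) x ≠ c' x := hsub (by simp [he, h1])
        rw [mem_filter, Function.comp_apply, Equiv.swap_apply_left] at this
        exact this.2 h2
    by_cases hA : ∃ e ∈ δ, c e ≠ c' e ∧ ∃ s ∈ m, t (Sum.inr s) = c' e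
    · obtain ⟨e, he, hne, s, hs, hst⟩ := hA
      obtain ⟨s, hs, hst, hes⟩ := hc'.cover e he s hs hst
      have hleaf : ∀ s ∈ m, t (Sum.inr s) ≠ c e := by
        intro s' hs' hst'
        obtain ⟨s', hs', hst', hes'⟩ := hc.cover e he s' hs' hst'
        obtain rfl := hm.eq_of_mem s hs s' hs' e hes hes'
        exact hne (hst'.symm.trans hst)
      have hT := hc.coloring.indep (c' e)
      have hT' := hc'.coloring.indep (c' e)
      obtain ⟨f, hf, hfT', hind⟩ := exists_exchange hT hT' (e := e)
        (by simp [h.right_subset he]) (by simp [hne]) (by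
          rw [span_fiber_eq h.card h.mem hc.coloring (hCs' e he)]
          exact h.mem e (h.right_subset he))
      have hfX := (mem_fiber.1 hf)
      have hfδ : f ∈ δ := by
        have := hfX.1
        rw [← h.union_eq, mem_union] at this
        refine this.resolve_left fun hfE => hfT' ?_
        rw [mem_fiber, hc'.eq_left f hfE, ← hc.eq_left f hfE]
        exact hfX
      have hcf : c' f ≠ c f := fun heq => hfT' (mem_fiber.2 ⟨hfX.1, heq.trans hfX.2⟩)
      have hlift := h.isLift_swap hm hmp ht hc hfδ he (by rw [hfX.2]; exact hne.symm) hleaf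
        (hind.mono (by
          rw [hfX.2, h.fiber_eq, fiber_congr hc.eq_left]
          intro x
          simp only [mem_coe, mem_union, mem_insert, mem_erase, mem_fiber, Function.comp_apply]
          rintro (hx | hx | hx)
          · refine Or.inr ⟨?_, Or.inl hx⟩
            rintro rfl
            exact disjoint_left.1 h.disjoint hx.1 hfδ
          · exact Or.inl hx
          · tauto))
        (Or.inr ⟨s, hs, hst.trans hfX.2.symm, hes⟩)
      rw [Equiv.swap_comm] at hlift
      exact progress e he f hfδ hne hfX.2 hcf hlift
    · push Not at hA
      obtain ⟨e, he, hne⟩ := hall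
      have hle : ∀ s ∈ m, t (Sum.inr s) ≠ c' e := hA e he hne
      obtain ⟨f, hf⟩ := h.fiber_eq_singleton hm hmp ht hc (hCs' e he) hle
      obtain ⟨f', hf'⟩ := h.fiber_eq_singleton hm hmp ht hc' (hCs' e he) hle
      have hff : f ∈ fiber δ c (c' e) := by rw [hf]; exact mem_singleton_self f
      rw [mem_fiber] at hff
      have hef : e = f' := by
        have : e ∈ fiber δ c' (c' e) := by simp [he]
        rwa [hf', mem_singleton] at this
      have hcf : c' f ≠ c f := by
        intro heq
        have : f ∈ fiber δ c' (c' e) := mem_fiber.2 ⟨hff.1, heq.trans hff.2⟩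
        rw [hf', mem_singleton, ← hef] at this
        exact hne (this ▸ hff.2)
      have hle' : ∀ s ∈ m, t (Sum.inr s) ≠ c e := by
        intro s hs hst
        have h1 := h.card_right_fiber hm hmp ht hc (hCs e he)
        have h2 := h.card_right_fiber hm hmp ht hc' (hCs e he)
        obtain ⟨e', he', hne'⟩ : ∃ e' ∈ fiber δ c' (c e), e' ∉ fiber δ c (c e) := by
          by_contra! hcon
          have heq := eq_of_subset_of_card_le (show fiber δ c' (c e) ⊆ fiber δ c (c e) from hcon)
            (by omega)
          have : e ∈ fiber δ c' (c e) := by rw [heq]; simp [he]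
          exact hne (mem_fiber.1 this).2.symm
        rw [mem_fiber] at he'
        refine hA e' he'.1 (fun heq => hne' (mem_fiber.2 ⟨he'.1, heq.trans he'.2⟩)) s hs ?_
        rw [he'.2]; exact hst
      exact progress e he f hff.1 hne hff.2 hcf (h.isLift_swap_leaf hm hmp ht hc he hff.1
        (by rw [hff.2]; exact hne) hle' (by rw [hff.2]; exact hle))

/-- The members of the pairs of a colour class, together with its edges that avoid `v`, span
everything as soon as the class contains a pair. -/
lemma le_span_of_cover (hm : IsPairing δ m) (hmp : m.card = p)
    (ht : IsIndepColoring (ZMod 2) (extVec φ) (E.disjSum m) Cs t) {i : C} (hi : i ∈ Cs)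
    {S : Submodule (ZMod 2) (V → ZMod 2)} (hF : ∀ e ∈ leftFiber E t i, φ e ∈ S)
    (hS : ∀ s ∈ m, t (Sum.inr s) = i → ∀ a ∈ s, φ a ∈ S) (hne : ∃ a ∈ δ, φ a ∈ S) : L ≤ S := by
  have hle : vanishAt L v ≤ S := by
    refine h.vanishAt_le hm hmp ht hi hF fun s hs => ?_
    rw [mem_fiber] at hs
    induction s with
    | _ a b =>
      exact add_mem (hS _ hs.1 hs.2 a (Sym2.mem_mk_left _ _)) (hS _ hs.1 hs.2 b
        (Sym2.mem_mk_right _ _))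
  obtain ⟨a, ha, haS⟩ := hne
  have ha' := (h.mem_right a).1 ha
  intro w hw
  rcases zmod_two_cases (w v) with h0 | h1
  · exact hle ⟨hw, h0⟩
  · have h2 : w + φ a ∈ S := by
      refine hle ⟨add_mem hw (h.mem a ha'.1), ?_⟩
      change w v + φ a v = 0
      rw [h1, ha'.2]; decide
    have := add_mem h2 haS
    rwa [add_assoc, add_self_eq_zero', add_zero] at this

lemma isTransversal_of_span (hm : IsPairing δ m) (hmp : m.card = p)
    (ht : IsIndepColoring (ZMod 2) (extVec φ) (E.disjSum m) Cs t) {i : C} (hi : i ∈ Cs)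
    {S : Finset κ} (hS : S ⊆ δ) (hSc : ∀ a ∈ S, ∃ s ∈ m, t (Sum.inr s) = i ∧ a ∈ s)
    (hind : LinearIndepOn (ZMod 2) φ ((leftFiber E t i ∪ S : Finset κ) : Set κ))
    (hL : L ≤ span (ZMod 2) (φ '' ((leftFiber E t i ∪ S : Finset κ) : Set κ))) :
    IsTransversal φ E δ m t i S := by
  refine ⟨hS, hSc, hind, ?_⟩
  have hmemL : ∀ e ∈ leftFiber E t i ∪ S, φ e ∈ L := by
    intro e he
    rcases mem_union.1 he with he | he
    · exact h.mem e (h.left_subset (mem_fiber.1 he).1)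
    · exact h.mem e (h.right_subset (hS he))
  have h1 := card_le_finrank hind hmemL
  have h2 := finrank_span_image_le (K := ZMod 2) (φ := φ) (leftFiber E t i ∪ S)
  have h4 := (Submodule.finrank_mono hL).trans h2
  have h5 := h.card_left_add hm hmp ht hi
  have hdisj : Disjoint (leftFiber E t i) S :=
    disjoint_of_subset_left (filter_subset _ _) (disjoint_of_subset_right hS h.disjoint)
  rw [card_union_of_disjoint hdisj] at h1 h4
  omega

lemma exists_transversal (hm : IsPairing δ m) (hmp : m.card = p)
    (ht : IsIndepColoring (ZMod 2) (extVec φ) (E.disjSum m) Cs t) {i : C} (hi : i ∈ Cs)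
    {U : Finset κ} (hU : U ⊆ δ) (hUc : ∀ a ∈ U, ∃ s ∈ m, t (Sum.inr s) = i ∧ a ∈ s)
    (hL : ∀ S : Submodule (ZMod 2) (V → ZMod 2), (∀ e ∈ leftFiber E t i, φ e ∈ S) →
      (∀ a ∈ U, φ a ∈ S) → L ≤ S) :
    ∃ S ⊆ U, IsTransversal φ E δ m t i S := by
  obtain ⟨S, hSU, -, hind, hspan⟩ := exists_extension (h.indep_left ht i) U
  exact ⟨S, hSU, h.isTransversal_of_span hm hmp ht hi (hSU.trans hU) (fun a ha => hUc a (hSU ha))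
    hind (hL _ (fun e he => subset_span ⟨e, mem_coe.2 (mem_union_left _ he), rfl⟩) hspan)⟩

lemma exists_transversal_of_nonempty (hm : IsPairing δ m) (hmp : m.card = p)
    (ht : IsIndepColoring (ZMod 2) (extVec φ) (E.disjSum m) Cs t) {i : C} (hi : i ∈ Cs)
    (hne : (pairFiber m t i).Nonempty) : ∃ S, IsTransversal φ E δ m t i S := by
  have hU : ∀ a, a ∈ (pairFiber m t i).biUnion Sym2.toFinset ↔
      ∃ s ∈ m, t (Sum.inr s) = i ∧ a ∈ s := by
    intro a; simp [and_assoc]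
  obtain ⟨S, -, hS⟩ := h.exists_transversal hm hmp ht hi (fun a ha => by
      obtain ⟨s, hs, -, has⟩ := (hU a).1 ha
      exact hm.mem s hs a has) (fun a ha => (hU a).1 ha) (by
      intro S hF hS
      obtain ⟨s, hs⟩ := hne
      rw [mem_fiber] at hs
      refine h.le_span_of_cover hm hmp ht hi hF
        (fun s hs hst a ha => hS a ((hU a).2 ⟨s, hs, hst, ha⟩)) ?_
      induction s with
      | _ a b => exact ⟨a, hm.mem _ hs.1 a (Sym2.mem_mk_left _ _),
          hS a ((hU a).2 ⟨_, hs.1, hs.2, Sym2.mem_mk_left _ _⟩)⟩)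
  exact ⟨S, hS⟩

/-- A colouring of the edges in `E` and the pairs in `m` has a lift with prescribed transversals in
the colour classes that contain pairs. The remaining edges at `v` can be distributed arbitrarily
among the other classes, and their numbers match. -/
lemma exists_isLift (hm : IsPairing δ m) (hmp : m.card = p)
    (ht : IsIndepColoring (ZMod 2) (extVec φ) (E.disjSum m) Cs t) (S : C → Finset κ)
    (hS : ∀ i ∈ Cs, (pairFiber m t i).Nonempty → IsTransversal φ E δ m t i (S i)) :
    ∃ c, IsLift φ X Cs E δ m t c ∧ ∀ i ∈ Cs, (pairFiber m t i).Nonempty → fiber δ c i = S i := by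
  set N := Cs.filter fun i => (pairFiber m t i).Nonempty with hN
  set R := δ \ N.biUnion S with hR
  have hNS : ∀ i ∈ N, IsTransversal φ E δ m t i (S i) := fun i hi =>
    hS i (mem_filter.1 hi).1 (mem_filter.1 hi).2
  have huniq : ∀ i ∈ N, ∀ j ∈ N, ∀ a, a ∈ S i → a ∈ S j → i = j := by
    intro i hi j hj a hai haj
    obtain ⟨s, hs, hst, has⟩ := (hNS i hi).cover a hai
    obtain ⟨s', hs', hst', has'⟩ := (hNS j hj).cover a haj
    obtain rfl := hm.eq_of_mem s hs s' hs' a has has'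
    exact hst.symm.trans hst'
  have hcard : R.card = (Cs \ N).card := by
    have h1 : N.biUnion S ⊆ δ := by
      intro a ha
      obtain ⟨i, hi, hai⟩ := mem_biUnion.1 ha
      exact (hNS i hi).subset hai
    have h2 : (N.biUnion S).card = m.card + N.card := by
      rw [card_biUnion]
      · rw [sum_congr rfl fun i hi => (hNS i hi).card, sum_add_distrib, sum_const, smul_eq_mul,
          mul_one]
        congr 1
        rw [← sum_card_fiber (X := m) (c := t ∘ Sum.inr) (Cs := Cs)
          (fun s hs => ht.mem (Sum.inr s)
        (by simpa using hs))]
        refine sum_subset (filter_subset _ _) fun i hi hiN => ?_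
        rw [card_eq_zero, ← not_nonempty_iff_eq_empty]
        exact fun hne => hiN (mem_filter.2 ⟨hi, hne⟩)
      · intro i hi j hj hij
        exact disjoint_left.2 fun a hai haj => hij (huniq i hi j hj a hai haj)
    have h3 : N ⊆ Cs := filter_subset _ _
    have h4 := card_le_card h3
    rw [hR, card_sdiff_of_subset h1, card_sdiff_of_subset h3, h2, h.card_right, hmp]
    omega
  let ρ := equivOfCardEq hcard
  classical
  let c : κ → C := fun a => if hE : a ∈ E then t (Sum.inl a) else
    if hi : ∃ i ∈ N, a ∈ S i then hi.choose else
    if hR : a ∈ R then (ρ ⟨a, hR⟩ : C) else t (Sum.inl a)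
  have hδE : ∀ a ∈ δ, a ∉ E := fun a ha haE => disjoint_left.1 h.disjoint haE ha
  have hcE : ∀ e ∈ E, c e = t (Sum.inl e) := fun e he => by simp [c, he]
  have hcS : ∀ i ∈ N, ∀ a ∈ S i, c a = i := by
    intro i hi a ha
    have haE := hδE a ((hNS i hi).subset ha)
    have hex : ∃ i ∈ N, a ∈ S i := ⟨i, hi, ha⟩
    simp only [c, haE, hex, dite_true, dite_false]
    exact huniq _ hex.choose_spec.1 i hi a hex.choose_spec.2 ha
  have hcR : ∀ a (ha : a ∈ R), c a = ρ ⟨a, ha⟩ := by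
    intro a ha
    have ha' := mem_sdiff.1 ha
    have hex : ¬ ∃ i ∈ N, a ∈ S i := fun ⟨i, hi, hai⟩ => ha'.2 (mem_biUnion.2 ⟨i, hi, hai⟩)
    simp only [c, hδE a ha'.1, hex, ha, dite_true, dite_false]
  have hsplit : ∀ a ∈ δ, (∃ i ∈ N, a ∈ S i) ∨ a ∈ R := by
    intro a ha
    by_cases hex : ∃ i ∈ N, a ∈ S i
    · exact Or.inl hex
    · refine Or.inr (mem_sdiff.2 ⟨ha, fun hmem => hex ?_⟩)
      obtain ⟨i, hi, hai⟩ := mem_biUnion.1 hmem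
      exact ⟨i, hi, hai⟩
  have hρN : ∀ a (ha : a ∈ R), c a ∈ Cs ∧ c a ∉ N := by
    intro a ha
    rw [hcR a ha]
    exact mem_sdiff.1 (ρ ⟨a, ha⟩).2
  have hfibN : ∀ i ∈ N, fiber δ c i = S i := by
    intro i hi
    ext a
    rw [mem_fiber]
    refine ⟨fun ⟨ha, hca⟩ => ?_, fun ha => ⟨(hNS i hi).subset ha, hcS i hi a ha⟩⟩
    rcases hsplit a ha with ⟨j, hj, haj⟩ | haR
    · rw [hcS j hj a haj] at hca
      exact hca ▸ haj
    · exact absurd (hca ▸ hi) (hρN a haR).2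
  have hsubs : ∀ i ∉ N, ∀ a ∈ fiber δ c i, ∀ b ∈ fiber δ c i, a = b := by
    intro i hi a ha b hb
    rw [mem_fiber] at ha hb
    have hmem : ∀ a ∈ δ, c a = i → a ∈ R := fun a ha hca =>
      (hsplit a ha).resolve_left fun ⟨j, hj, haj⟩ => hi (by rwa [← hca, hcS j hj a haj])
    have h1 := (hcR a (hmem a ha.1 ha.2)).symm.trans ha.2
    have h2 := (hcR b (hmem b hb.1 hb.2)).symm.trans hb.2
    exact Subtype.ext_iff.1 (ρ.injective (Subtype.ext (h1.trans h2.symm)))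
  refine ⟨c, h.isLift_of ht hcE (fun a ha => ?_) (fun i hi => ?_) (fun a ha s hs hst => ?_),
    fun i hi hne => hfibN i (mem_filter.2 ⟨hi, hne⟩)⟩
  · rcases hsplit a ha with ⟨i, hi, hai⟩ | haR
    · rw [hcS i hi a hai]; exact (mem_filter.1 hi).1
    · exact (hρN a haR).1
  · by_cases hiN : i ∈ N
    · rw [hfibN i hiN]; exact (hNS i hiN).indep
    · rcases (fiber δ c i).eq_empty_or_nonempty with h0 | ⟨a, ha⟩
      · rw [h0, union_empty]; exact h.indep_left ht i
      · have : fiber δ c i = {a} :=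
          eq_singleton_iff_unique_mem.2 ⟨ha, fun b hb => hsubs i hiN b hb a ha⟩
        rw [this, union_comm, ← insert_eq]
        exact h.indep_insert (h.indep_left ht i) (filter_subset _ _) (mem_fiber.1 ha).1
  · have hN' : c a ∈ N := by
      refine mem_filter.2 ⟨?_, s, mem_fiber.2 ⟨hs, hst⟩⟩
      rw [← hst]; exact ht.mem _ (by simpa using hs)
    rcases hsplit a ha with ⟨i, hi, hai⟩ | haR
    · rw [hcS i hi a hai]
      exact (hNS i hi).cover a hai
    · exact absurd hN' (hρN a haR).2

lemma exists_isLift' (hm : IsPairing δ m) (hmp : m.card = p)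
    (ht : IsIndepColoring (ZMod 2) (extVec φ) (E.disjSum m) Cs t) :
    ∃ c, IsLift φ X Cs E δ m t c := by
  classical
  have hex : ∀ i, ∃ S, i ∈ Cs → (pairFiber m t i).Nonempty → IsTransversal φ E δ m t i S := by
    intro i
    by_cases hi : i ∈ Cs ∧ (pairFiber m t i).Nonempty
    · obtain ⟨S, hS⟩ := h.exists_transversal_of_nonempty hm hmp ht hi.1 hi.2
      exact ⟨S, fun _ _ => hS⟩
    · exact ⟨∅, fun h1 h2 => absurd ⟨h1, h2⟩ hi⟩
  choose S hS using hex
  obtain ⟨c, hc, -⟩ := h.exists_isLift hm hmp ht S hS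
  exact ⟨c, hc⟩

lemma exists_isLift_transversal (hm : IsPairing δ m) (hmp : m.card = p)
    (ht : IsIndepColoring (ZMod 2) (extVec φ) (E.disjSum m) Cs t) {l : C} (hl : l ∈ Cs)
    (hne : (pairFiber m t l).Nonempty) {T : Finset κ} (hT : IsTransversal φ E δ m t l T) :
    ∃ c, IsLift φ X Cs E δ m t c ∧ fiber δ c l = T := by
  classical
  have hex : ∀ i, ∃ S, i ∈ Cs → (pairFiber m t i).Nonempty → IsTransversal φ E δ m t i S := by
    intro i
    by_cases hi : i ∈ Cs ∧ (pairFiber m t i).Nonempty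
    · obtain ⟨S, hS⟩ := h.exists_transversal_of_nonempty hm hmp ht hi.1 hi.2
      exact ⟨S, fun _ _ => hS⟩
    · exact ⟨∅, fun h1 h2 => absurd ⟨h1, h2⟩ hi⟩
  choose S hS using hex
  obtain ⟨c, hc, hcS⟩ := h.exists_isLift hm hmp ht (Function.update S l T) (by
    intro i hi hne
    rcases eq_or_ne i l with rfl | hil
    · rwa [Function.update_self]
    · rw [Function.update_of_ne hil]; exact hS i hi hne)
  exact ⟨c, hc, by rw [hcS l hl hne, Function.update_self]⟩

lemma exists_isLift_singleton (hm : IsPairing δ m) (hmp : m.card = p)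
    (ht : IsIndepColoring (ZMod 2) (extVec φ) (E.disjSum m) Cs t) {l : C} (hl : l ∈ Cs)
    (hleaf : ∀ s ∈ m, t (Sum.inr s) ≠ l) {g : κ} (hg : g ∈ δ) (hgm : ∀ s ∈ m, g ∉ s) :
    ∃ c, IsLift φ X Cs E δ m t c ∧ fiber δ c l = {g} := by
  obtain ⟨c, hc⟩ := h.exists_isLift' hm hmp ht
  obtain ⟨f, hf⟩ := h.fiber_eq_singleton hm hmp ht hc hl hleaf
  have hff : f ∈ fiber δ c l := by rw [hf]; exact mem_singleton_self f
  rw [mem_fiber] at hff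
  by_cases hgl : c g = l
  · refine ⟨c, hc, ?_⟩
    have : g ∈ fiber δ c l := mem_fiber.2 ⟨hg, hgl⟩
    rw [hf] at this ⊢
    rw [mem_singleton.1 this]
  · have hlift := h.isLift_swap_leaf hm hmp ht hc hg hff.1 (by rwa [hff.2])
      (fun s hs hst => by
        obtain ⟨s', hs', -, hgs'⟩ := hc.cover g hg s hs hst
        exact hgm s' hs' hgs') (by rwa [hff.2])
    refine ⟨_, hlift, ?_⟩
    obtain ⟨f', hf'⟩ := h.fiber_eq_singleton hm hmp ht hlift hl hleaf
    have : g ∈ fiber δ (c ∘ Equiv.swap g f) l := by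
      rw [mem_fiber, Function.comp_apply, Equiv.swap_apply_left]; exact ⟨hg, hff.2⟩
    rw [hf'] at this ⊢
    rw [mem_singleton.1 this]

end IsStar

end Lifts

/-! ### Lifting a swap -/

section LiftSteps

variable {V κ C : Type*} [DecidableEq V] [DecidableEq κ] [DecidableEq C]
variable {φ : κ → V → ZMod 2} {X : Finset κ} {Cs : Finset C}
  {L : Submodule (ZMod 2) (V → ZMod 2)} {v : V} {E δ : Finset κ} {p : ℕ}
  [FiniteDimensional (ZMod 2) L] {m m' : Finset (Sym2 κ)} {t t' : κ ⊕ Sym2 κ → C} {c c' : κ → C}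

lemma IsPairing.exists_uncovered (hm : IsPairing δ m) (hlt : 2 * m.card < δ.card) :
    ∃ g ∈ δ, ∀ s ∈ m, g ∉ s := by
  by_contra! hcon
  have hsub : δ ⊆ m.biUnion Sym2.toFinset := fun g hg => by
    obtain ⟨s, hs, hgs⟩ := hcon g hg
    exact mem_biUnion.2 ⟨s, hs, by simpa using hgs⟩
  have h1 := card_le_card hsub
  have h2 : (m.biUnion Sym2.toFinset).card ≤ m.card * 2 :=
    card_biUnion_le_card_mul _ _ _ fun s hs =>
      (Sym2.card_toFinset_of_not_isDiag s (hm.not_isDiag s hs)).le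
  omega

lemma IsIndepColoring.pair_notMem_span
    (ht : IsIndepColoring (ZMod 2) (extVec φ) (E.disjSum m) Cs t) {s : Sym2 κ} (hs : s ∈ m) :
    pairVec φ s ∉ span (ZMod 2) (φ '' (leftFiber E t (t (Sum.inr s)) : Set κ)) := by
  intro hmem
  refine (ht.indep (t (Sum.inr s))).notMem_span (i := Sum.inr s) (by simp [hs]) ?_
  refine span_mono ?_ hmem
  rintro _ ⟨e, he, rfl⟩
  exact ⟨Sum.inl e, ⟨by simpa using he, by simp⟩, rfl⟩

namespace IsStar

variable (h : IsStar φ X Cs L v E δ p)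
include h

lemma isLift_congr
    (htt' : ∀ x ∈ E.disjSum m, t' x = t x) (hc : IsLift φ X Cs E δ m t c) :
    IsLift φ X Cs E δ m t' c := by
  refine ⟨hc.coloring, fun e he => ?_, fun a ha s hs hst => ?_⟩
  · rw [htt' _ (by simpa using he)]; exact hc.eq_left e he
  · rw [htt' _ (by simpa using hs)] at hst
    obtain ⟨s', hs', hst', has'⟩ := hc.cover a ha s hs hst
    exact ⟨s', hs', by rw [htt' _ (by simpa using hs')]; exact hst', has'⟩

/-- Colourings with a common colour class have lifts with a common colour class. -/
lemma exists_isLift_fiber_eq (hm : IsPairing δ m) (hmp : m.card = p)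
    (ht : IsIndepColoring (ZMod 2) (extVec φ) (E.disjSum m) Cs t)
    (ht' : IsIndepColoring (ZMod 2) (extVec φ) (E.disjSum m) Cs t') {l : C} (hl : l ∈ Cs)
    (hfib : ∀ x ∈ E.disjSum m, t x = l ↔ t' x = l) :
    ∃ c c', IsLift φ X Cs E δ m t c ∧ IsLift φ X Cs E δ m t' c' ∧
      fiber X c l = fiber X c' l := by
  have hleft : leftFiber E t l = leftFiber E t' l := by
    ext e; simp only [mem_fiber, Function.comp_apply]
    exact and_congr_right fun he => hfib _ (by simpa using he)
  have hpair : pairFiber m t l = pairFiber m t' l := by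
    ext s; simp only [mem_fiber, Function.comp_apply]
    exact and_congr_right fun hs => hfib _ (by simpa using hs)
  obtain ⟨c, c', hc, hc', hcc⟩ : ∃ c c', IsLift φ X Cs E δ m t c ∧ IsLift φ X Cs E δ m t' c' ∧
      fiber δ c l = fiber δ c' l := by
    rcases (pairFiber m t l).eq_empty_or_nonempty with h0 | hne
    · have h0' := hpair ▸ h0
      have leaf : ∀ {t : κ ⊕ Sym2 κ → C}, pairFiber m t l = ∅ → ∀ s ∈ m, t (Sum.inr s) ≠ l := by
        intro t h0 s hs hst
        have : s ∈ pairFiber m t l := mem_fiber.2 ⟨hs, hst⟩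
        rw [h0] at this
        exact notMem_empty s this
      have hlt := h.lt
      obtain ⟨g, hg, hgm⟩ := hm.exists_uncovered (by rw [hmp, h.card_right]; omega)
      obtain ⟨c, hc, hcl⟩ := h.exists_isLift_singleton hm hmp ht hl (leaf h0) hg hgm
      obtain ⟨c', hc', hcl'⟩ := h.exists_isLift_singleton hm hmp ht' hl (leaf h0') hg hgm
      exact ⟨c, c', hc, hc', hcl.trans hcl'.symm⟩
    · obtain ⟨S, hS⟩ := h.exists_transversal_of_nonempty hm hmp ht hl hne
      have hS' : IsTransversal φ E δ m t' l S := by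
        refine ⟨hS.subset, fun a ha => ?_, hleft ▸ hS.indep, hpair ▸ hS.card⟩
        obtain ⟨s, hs, hst, has⟩ := hS.cover a ha
        exact ⟨s, hs, (hfib _ (by simpa using hs)).1 hst, has⟩
      obtain ⟨c, hc, hcl⟩ := h.exists_isLift_transversal hm hmp ht hl hne hS
      obtain ⟨c', hc', hcl'⟩ := h.exists_isLift_transversal hm hmp ht' hl (hpair ▸ hne) hS'
      exact ⟨c, c', hc, hc', hcl.trans hcl'.symm⟩
  refine ⟨c, c', hc, hc', ?_⟩
  rw [h.fiber_eq, h.fiber_eq, hcc, fiber_congr hc.eq_left, fiber_congr hc'.eq_left]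
  exact congrArg (· ∪ _) hleft

/-- With two colours: a swap of two edges that avoid `v` lifts to the same swap. -/
lemma exists_isLift_of_swap_left (hm : IsPairing δ m) (hmp : m.card = p) (hp : p ≤ 1)
    (ht : IsIndepColoring (ZMod 2) (extVec φ) (E.disjSum m) Cs t)
    (ht' : IsIndepColoring (ZMod 2) (extVec φ) (E.disjSum m) Cs t') {g k : κ} (hg : g ∈ E)
    (hk : k ∈ E) (htt' : ∀ x ∈ E.disjSum m, t' x = t (Equiv.swap (Sum.inl g) (Sum.inl k) x)) :
    ∃ c c', IsLift φ X Cs E δ m t c ∧ IsLift φ X Cs E δ m t' c' ∧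
      SwapEquiv (ZMod 2) φ X Cs c c' := by
  obtain ⟨c, hc⟩ := h.exists_isLift' hm hmp ht
  obtain ⟨c', hc'⟩ := h.exists_isLift' hm hmp ht'
  have hδE : ∀ a ∈ δ, a ∉ E := fun a ha haE => disjoint_left.1 h.disjoint haE ha
  have hr : ∀ s ∈ m, t' (Sum.inr s) = t (Sum.inr s) := by
    intro s hs
    rw [htt' _ (by simpa using hs), Equiv.swap_apply_of_ne_of_ne (by simp) (by simp)]
  have hpair : ∀ i, pairFiber m t' i = pairFiber m t i := fun i => fiber_congr hr i
  let d : κ → C := fun x => if x ∈ E then t' (Sum.inl x) else c x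
  have hdE : ∀ x ∈ E, d x = t' (Sum.inl x) := fun x hx => by simp [d, hx]
  have hdδ : ∀ x ∈ δ, d x = c x := fun x hx => by simp [d, hδE x hx]
  have hfib : ∀ i, fiber δ d i = fiber δ c i := fun i => fiber_congr hdδ i
  have hd : IsLift φ X Cs E δ m t' d := by
    refine h.isLift_of ht' hdE (fun a ha => ?_) (fun i hi => ?_) (fun a ha s hs hst => ?_)
    · rw [hdδ a ha]; exact hc.coloring.mem a (h.right_subset ha)
    · rw [hfib]
      rcases (pairFiber m t i).eq_empty_or_nonempty with h0 | ⟨s, hs⟩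
      · have h1 := h.card_right_fiber hm hmp ht hc hi
        rw [h0, card_empty] at h1
        obtain ⟨a, ha⟩ := card_eq_one.1 h1
        have : a ∈ fiber δ c i := by rw [ha]; exact mem_singleton_self a
        rw [ha, union_comm, ← insert_eq]
        exact h.indep_insert (h.indep_left ht' i) (filter_subset _ _) (mem_fiber.1 this).1
      · -- The only pair of this colour consists of the edges at `v` of this colour.
        have hone : pairFiber m t i = {s} := by
          refine eq_singleton_iff_unique_mem.2 ⟨hs, fun s' hs' => ?_⟩
          exact card_le_one.1 (hmp.le.trans hp) _ (mem_fiber.1 hs').1 _ (mem_fiber.1 hs).1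
        have hsm := (mem_fiber.1 hs).1
        have key : ∀ {t : κ ⊕ Sym2 κ → C} {c : κ → C},
            IsIndepColoring (ZMod 2) (extVec φ) (E.disjSum m) Cs t → IsLift φ X Cs E δ m t c →
            pairFiber m t i = {s} → fiber δ c i = s.toFinset := by
          intro t c ht hc hone
          refine eq_of_subset_of_card_le (fun a ha => ?_) ?_
          · rw [mem_fiber] at ha
            have hs : s ∈ pairFiber m t i := by rw [hone]; exact mem_singleton_self s
            obtain ⟨s', hs', hst', has'⟩ := hc.cover a ha.1 s (mem_fiber.1 hs).1
              ((mem_fiber.1 hs).2.trans ha.2.symm)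
            have : s' ∈ pairFiber m t i := mem_fiber.2 ⟨hs', hst'.trans ha.2⟩
            rw [hone, mem_singleton] at this
            rw [Sym2.mem_toFinset, ← this]; exact has'
          · rw [h.card_right_fiber hm hmp ht hc hi, hone, card_singleton,
              Sym2.card_toFinset_of_not_isDiag s (hm.not_isDiag s hsm)]
        rw [key ht hc hone, ← key ht' hc' ((hpair i).trans hone),
          ← show fiber E c' i = leftFiber E t' i from fiber_congr hc'.eq_left i, ← h.fiber_eq]
        exact hc'.coloring.indep i
    · rw [hdδ a ha, hr s hs] at hst
      obtain ⟨s', hs', hst', has'⟩ := hc.cover a ha s hs hst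
      exact ⟨s', hs', by rw [hr s' hs', hst', hdδ a ha], has'⟩
  refine ⟨c, d, hc, hd, .single ⟨hc.coloring, hd.coloring,
    Or.inr ⟨g, h.left_subset hg, k, h.left_subset hk, fun x hx => ?_⟩⟩⟩
  rw [← h.union_eq, mem_union] at hx
  rcases hx with hx | hx
  · have hsw : Equiv.swap (Sum.inl g) (Sum.inl k) (Sum.inl x : κ ⊕ Sym2 κ) =
        Sum.inl (Equiv.swap g k x) := by
      by_cases hxg : x = g
      · simp [hxg]
      · by_cases hxk : x = k
        · simp [hxk]
        · rw [Equiv.swap_apply_of_ne_of_ne (by simpa) (by simpa),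
            Equiv.swap_apply_of_ne_of_ne hxg hxk]
    rw [hdE x hx, htt' _ (by simpa using hx), hsw, hc.eq_left _ (swap_mem hg hk hx)]
  · have h1 : x ≠ g := by rintro rfl; exact hδE _ hx hg
    have h2 : x ≠ k := by rintro rfl; exact hδE _ hx hk
    rw [hdδ x hx, Equiv.swap_apply_of_ne_of_ne h1 h2]

/-- With two colours: a swap of a pair and an edge that avoids `v` lifts to two swaps. -/
lemma exists_isLift_of_swap_pair (hm : IsPairing δ m) (hmp : m.card = p) (hp : p ≤ 1)
    (hCs : Cs.card = 2)
    (ht : IsIndepColoring (ZMod 2) (extVec φ) (E.disjSum m) Cs t)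
    (ht' : IsIndepColoring (ZMod 2) (extVec φ) (E.disjSum m) Cs t') {s : Sym2 κ} {k : κ}
    (hs : s ∈ m) (hk : k ∈ E) (hne : t (Sum.inr s) ≠ t (Sum.inl k))
    (htt' : ∀ x ∈ E.disjSum m, t' x = t (Equiv.swap (Sum.inr s) (Sum.inl k) x)) :
    ∃ c c', IsLift φ X Cs E δ m t c ∧ IsLift φ X Cs E δ m t' c' ∧
      SwapEquiv (ZMod 2) φ X Cs c c' := by
  obtain ⟨c, hc⟩ := h.exists_isLift' hm hmp ht
  obtain ⟨c', hc'⟩ := h.exists_isLift' hm hmp ht'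
  refine ⟨c, c', hc, hc', ?_⟩
  have hms : ∀ s' ∈ m, s' = s := fun s' hs' => card_le_one.1 (hmp.le.trans hp) _ hs' _ hs
  have hkm : Sum.inl k ∈ E.disjSum m := by simpa using hk
  have hsm : Sum.inr s ∈ E.disjSum m := by simpa using hs
  obtain ⟨i, hi⟩ : ∃ i, i = t (Sum.inr s) := ⟨_, rfl⟩
  obtain ⟨j, hj⟩ : ∃ j, j = t (Sum.inl k) := ⟨_, rfl⟩
  have hs' : t' (Sum.inr s) = j := by rw [htt' _ hsm, Equiv.swap_apply_left, hj]
  have hk' : t' (Sum.inl k) = i := by rw [htt' _ hkm, Equiv.swap_apply_right, hi]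
  have hij : i ≠ j := by rw [hi, hj]; exact hne
  have hiC : i ∈ Cs := hi ▸ ht.mem _ hsm
  have hjC : j ∈ Cs := hj ▸ ht.mem _ hkm
  have hCij : ∀ l ∈ Cs, l = i ∨ l = j := by
    intro l hl
    by_contra! hcon
    have : ({l, i, j} : Finset C) ⊆ Cs := by
      intro x; simp only [mem_insert, mem_singleton]; rintro (rfl | rfl | rfl) <;> assumption
    have := card_le_card this
    rw [card_insert_of_notMem (by simp [hcon.1, hcon.2]), card_pair hij] at this
    omega
  obtain ⟨e, he⟩ := h.fiber_eq_singleton hm hmp ht hc hjC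
    (fun s' hs' => by rw [hms s' hs', ← hi]; exact hij)
  obtain ⟨e', he'⟩ := h.fiber_eq_singleton hm hmp ht' hc' hiC
    (fun s' hs'' => by rw [hms s' hs'', hs']; exact hij.symm)
  have heδ : e ∈ δ ∧ c e = j := by
    rw [← mem_fiber, he]; exact mem_singleton_self e
  have heδ' : e' ∈ δ ∧ c' e' = i := by
    rw [← mem_fiber, he']; exact mem_singleton_self e'
  have hcs : ∀ a ∈ δ, c a = i ↔ a ∈ s := by
    intro a ha
    refine ⟨fun hca => ?_, fun has => ?_⟩
    · obtain ⟨s', hs', -, has'⟩ := hc.cover a ha s hs (by rw [hca, hi])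
      rwa [hms s' hs'] at has'
    · by_contra hca
      have hcj := (hCij _ (hc.coloring.mem a (h.right_subset ha))).resolve_left hca
      have h1 := h.card_right_fiber hm hmp ht hc hiC
      have hsub : fiber δ c i ⊆ s.toFinset.erase a := by
        intro x hx
        rw [mem_fiber] at hx
        obtain ⟨s', hs', -, hxs'⟩ := hc.cover x hx.1 s hs (by rw [hx.2, hi])
        rw [hms s' hs'] at hxs'
        refine mem_erase.2 ⟨?_, by simpa using hxs'⟩
        rintro rfl; exact hca hx.2
      have h2 := card_le_card hsub
      rw [card_erase_of_mem (by simpa using has),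
        Sym2.card_toFinset_of_not_isDiag s (hm.not_isDiag s hs)] at h2
      have : 0 < (pairFiber m t i).card := card_pos.2 ⟨s, mem_fiber.2 ⟨hs, hi.symm⟩⟩
      omega
  have hcs' : ∀ a ∈ δ, c' a = j ↔ a ∈ s := by
    intro a ha
    refine ⟨fun hca => ?_, fun has => ?_⟩
    · obtain ⟨s'', hs'', -, has'⟩ := hc'.cover a ha s hs (by rw [hca, hs'])
      rwa [hms s'' hs''] at has'
    · by_contra hca
      have hcj := (hCij _ (hc'.coloring.mem a (h.right_subset ha))).resolve_right hca
      have h1 := h.card_right_fiber hm hmp ht' hc' hjC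
      have hsub : fiber δ c' j ⊆ s.toFinset.erase a := by
        intro x hx
        rw [mem_fiber] at hx
        obtain ⟨s'', hs'', -, hxs'⟩ := hc'.cover x hx.1 s hs (by rw [hx.2, hs'])
        rw [hms s'' hs''] at hxs'
        refine mem_erase.2 ⟨?_, by simpa using hxs'⟩
        rintro rfl; exact hca hx.2
      have h2 := card_le_card hsub
      rw [card_erase_of_mem (by simpa using has),
        Sym2.card_toFinset_of_not_isDiag s (hm.not_isDiag s hs)] at h2
      have : 0 < (pairFiber m t' j).card := card_pos.2 ⟨s, mem_fiber.2 ⟨hs, hs'⟩⟩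
      omega
  have hes : e ∉ s := fun hes => hij (((hcs e heδ.1).2 hes).symm.trans heδ.2)
  have hes' : e' ∉ s := fun hes => hij (heδ'.2.symm.trans ((hcs' e' heδ'.1).2 hes))
  have hee : e' = e := by
    have : e' ∈ fiber δ c j := mem_fiber.2 ⟨heδ'.1,
      (hCij _ (hc.coloring.mem e' (h.right_subset heδ'.1))).resolve_left
        fun h1 => hes' ((hcs e' heδ'.1).1 h1)⟩
    rwa [he, mem_singleton] at this
  subst hee
  have hδs : ∀ a ∈ δ, a ∈ s ∨ a = e' := by
    intro a ha
    by_cases has : a ∈ s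
    · exact Or.inl has
    · right
      have : a ∈ fiber δ c j := mem_fiber.2 ⟨ha,
        (hCij _ (hc.coloring.mem a (h.right_subset ha))).resolve_left
          fun h1 => has ((hcs a ha).1 h1)⟩
      rwa [he, mem_singleton] at this
  have hpn := ht'.pair_notMem_span hs
  rw [hs'] at hpn
  -- One of the two members `x` of the pair can enter the colour `j` while `e'` is still there.
  obtain ⟨x, y, rfl, hx⟩ : ∃ x y, s = s(x, y) ∧
      φ x + φ e' ∉ span (ZMod 2) (φ '' (leftFiber E t' j : Set κ)) := by
    induction s with
    | _ a b =>
      rw [pairVec_mk] at hpn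
      rcases add_notMem_or (φ e') hpn with h1 | h1
      · exact ⟨a, b, rfl, h1⟩
      · exact ⟨b, a, Sym2.eq_swap, by rwa [add_comm]⟩
  have hxδ := hm.mem _ hs x (Sym2.mem_mk_left _ _)
  have hyδ := hm.mem _ hs y (Sym2.mem_mk_right _ _)
  have hxy : x ≠ y := by simpa using hm.not_isDiag _ hs
  have hxe : x ≠ e' := by rintro rfl; exact hes (Sym2.mem_mk_left _ _)
  have hye : y ≠ e' := by rintro rfl; exact hes (Sym2.mem_mk_right _ _)
  have hδ3 : ∀ a ∈ δ, a = x ∨ a = y ∨ a = e' := by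
    intro a ha
    rcases hδs a ha with has | rfl
    · rcases Sym2.mem_iff.1 has with rfl | rfl <;> simp
    · simp
  have hδE : ∀ a ∈ δ, ∀ z ∈ E, z ≠ a := by
    rintro a ha z hz rfl; exact disjoint_left.1 h.disjoint hz ha
  have hcx := (hcs x hxδ).2 (Sym2.mem_mk_left _ _)
  have hcy := (hcs y hyδ).2 (Sym2.mem_mk_right _ _)
  have hcx' := (hcs' x hxδ).2 (Sym2.mem_mk_left _ _)
  have hcy' := (hcs' y hyδ).2 (Sym2.mem_mk_right _ _)
  set d := c' ∘ Equiv.swap y e' with hd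
  have hdx : d x = j := by
    rw [hd, Function.comp_apply, Equiv.swap_apply_of_ne_of_ne hxy hxe, hcx']
  have hdy : d y = i := by rw [hd, Function.comp_apply, Equiv.swap_apply_left, heδ'.2]
  have hde : d e' = j := by rw [hd, Function.comp_apply, Equiv.swap_apply_right, hcy']
  have hdE : ∀ z ∈ E, d z = t' (Sum.inl z) := by
    intro z hz
    rw [hd, Function.comp_apply,
      Equiv.swap_apply_of_ne_of_ne (hδE y hyδ z hz) (hδE e' heδ.1 z hz)]
    exact hc'.eq_left z hz
  have hdcol : IsIndepColoring (ZMod 2) φ X Cs d := by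
    have hdmem : ∀ z ∈ X, d z ∈ Cs := fun z hz =>
      hc'.coloring.mem _ (swap_mem (h.right_subset hyδ) (h.right_subset heδ.1) hz)
    refine ⟨hdmem, fun l => ?_⟩
    by_cases hl : l ∈ Cs
    · rcases hCij l hl with rfl | rfl
      · refine (h.indep_insert (h.indep_left ht' l) (filter_subset _ _) hyδ).mono fun z hz => ?_
        simp only [mem_coe, mem_insert] at hz ⊢
        rw [mem_fiber, ← h.union_eq, mem_union] at hz
        rcases hz with ⟨hz | hz, hzl⟩
        · rw [hdE z hz] at hzl
          exact Or.inr (mem_fiber.2 ⟨hz, hzl⟩)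
        · rcases hδ3 z hz with rfl | rfl | rfl
          · exact absurd (hzl.symm.trans hdx) hij
          · exact Or.inl rfl
          · exact absurd (hzl.symm.trans hde) hij
      · have h1 := h.indep_insert (h.indep_left ht' l) (filter_subset _ _) heδ.1
        have h2 : φ x ∉ span (ZMod 2) (φ '' ((insert e' (leftFiber E t' l) : Finset κ) :
            Set κ)) := by
          rw [coe_insert, Set.image_insert_eq, mem_span_insert]
          rintro ⟨α, w, hw, hxw⟩
          refine hx ?_
          have hvan : span (ZMod 2) (φ '' (leftFiber E t' l : Set κ)) ≤
              LinearMap.ker (LinearMap.proj v : (V → ZMod 2) →ₗ[ZMod 2] ZMod 2) := by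
            rw [span_le]
            rintro _ ⟨z, hz, rfl⟩
            exact ((h.mem_left z).1 (mem_fiber.1 hz).1).2
          have hwv : w v = 0 := hvan hw
          have hev := congrFun hxw v
          rw [((h.mem_right x).1 hxδ).2, Pi.add_apply, Pi.smul_apply,
            ((h.mem_right e').1 heδ.1).2, hwv, smul_eq_mul, mul_one, add_zero] at hev
          rw [hxw, ← hev, one_smul, add_comm, ← add_assoc, add_self_eq_zero', zero_add]
          exact hw
        refine (h1.insert h2).mono fun z hz => ?_
        simp only [mem_coe, Set.mem_insert_iff, mem_insert] at hz ⊢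
        rw [mem_fiber, ← h.union_eq, mem_union] at hz
        rcases hz with ⟨hz | hz, hzl⟩
        · rw [hdE z hz] at hzl
          exact Or.inr (Or.inr (mem_fiber.2 ⟨hz, hzl⟩))
        · rcases hδ3 z hz with rfl | rfl | rfl
          · exact Or.inl rfl
          · exact absurd (hdy.symm.trans hzl) hij
          · exact Or.inr (Or.inl rfl)
    · have : fiber X d l = ∅ := by
        ext z; simp only [mem_fiber, notMem_empty, iff_false]
        rintro ⟨hz, rfl⟩; exact hl (hdmem z hz)
      rw [this]; simp
  have step1 : SwapStep (ZMod 2) φ X Cs c d := by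
    refine ⟨hc.coloring, hdcol, Or.inr ⟨x, h.right_subset hxδ, k, h.left_subset hk, ?_⟩⟩
    intro z hz
    have hckj : c k = j := by rw [hc.eq_left k hk, hj]
    rw [← h.union_eq, mem_union] at hz
    rcases hz with hz | hz
    · rw [hdE z hz]
      by_cases hzk : z = k
      · rw [hzk, Equiv.swap_apply_right, hk', hcx]
      · rw [Equiv.swap_apply_of_ne_of_ne (hδE x hxδ z hz) hzk, htt' _ (by simpa using hz),
          Equiv.swap_apply_of_ne_of_ne (by simp) (by simpa using hzk), hc.eq_left z hz]
    · rcases hδ3 z hz with rfl | rfl | rfl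
      · rw [Equiv.swap_apply_left, hdx, hckj]
      · rw [Equiv.swap_apply_of_ne_of_ne hxy.symm (hδE z hyδ k hk).symm, hdy, hcy]
      · rw [Equiv.swap_apply_of_ne_of_ne hxe.symm (hδE z heδ.1 k hk).symm, hde, heδ.2]
  have step2 : SwapStep (ZMod 2) φ X Cs d c' :=
    SwapStep.symm ⟨hc'.coloring, hdcol,
      Or.inr ⟨y, h.right_subset hyδ, e', h.right_subset heδ.1, fun _ _ => rfl⟩⟩
  exact (ReflTransGen.single step1).tail step2

/-- A swap of two elements among the edges in `E` and the pairs in `m` can be lifted, if colourings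
that share a colour class are known to be connected. The latter applies as soon as there is a third
colour. With two colours there is at most one pair. -/
lemma exists_isLift_of_swapStep
    (hshare : ∀ c c', IsIndepColoring (ZMod 2) φ X Cs c → IsIndepColoring (ZMod 2) φ X Cs c' →
      ∀ l ∈ Cs, fiber X c l = fiber X c' l → SwapEquiv (ZMod 2) φ X Cs c c')
    (hm : IsPairing δ m) (hmp : m.card = p)
    (hstep : SwapStep (ZMod 2) (extVec φ) (E.disjSum m) Cs t t') :
    ∃ c c', IsLift φ X Cs E δ m t c ∧ IsLift φ X Cs E δ m t' c' ∧
      SwapEquiv (ZMod 2) φ X Cs c c' := by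
  obtain ⟨ht, ht', hor⟩ := hstep
  have same : (∀ x ∈ E.disjSum m, t' x = t x) → ∃ c c', IsLift φ X Cs E δ m t c ∧
      IsLift φ X Cs E δ m t' c' ∧ SwapEquiv (ZMod 2) φ X Cs c c' := by
    intro heq
    obtain ⟨c, hc⟩ := h.exists_isLift' hm hmp ht
    exact ⟨c, c, hc, h.isLift_congr heq hc, .refl⟩
  rcases hor with heq | ⟨g, hg, k, hk, hgk⟩
  · exact same heq
  by_cases htgk : t g = t k
  · refine same fun x hx => ?_
    rw [hgk x hx]
    by_cases hxg : x = g
    · rw [hxg, Equiv.swap_apply_left, htgk]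
    · by_cases hxk : x = k
      · rw [hxk, Equiv.swap_apply_right, htgk]
      · rw [Equiv.swap_apply_of_ne_of_ne hxg hxk]
  have htwo : ({t g, t k} : Finset C) ⊆ Cs := by
    intro x; simp only [mem_insert, mem_singleton]
    rintro (rfl | rfl)
    · exact ht.mem g hg
    · exact ht.mem k hk
  by_cases hthree : Cs.card ≤ 2
  · have hCs : Cs.card = 2 := le_antisymm hthree (by
      rw [← card_pair htgk]; exact card_le_card htwo)
    have hp : p ≤ 1 := by have := h.lt; omega
    rcases g with g | s <;> rcases k with k | s'
    · exact h.exists_isLift_of_swap_left hm hmp hp ht ht' (by simpa using hg) (by simpa using hk)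
        hgk
    · rw [Equiv.swap_comm] at hgk
      exact h.exists_isLift_of_swap_pair hm hmp hp hCs ht ht' (by simpa using hk)
        (by simpa using hg) (Ne.symm htgk) hgk
    · exact h.exists_isLift_of_swap_pair hm hmp hp hCs ht ht' (by simpa using hg)
        (by simpa using hk) htgk hgk
    · have : s = s' := card_le_one.1 (hmp.le.trans hp) _ (by simpa using hg) _ (by simpa using hk)
      exact absurd (by rw [this]) htgk
  · obtain ⟨l, hl, hl'⟩ : ∃ l ∈ Cs, l ∉ ({t g, t k} : Finset C) := by
      by_contra! hcon
      have := card_le_card (show Cs ⊆ {t g, t k} from hcon)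
      rw [card_pair htgk] at this
      exact hthree this
    simp only [mem_insert, mem_singleton, not_or] at hl'
    obtain ⟨c, c', hc, hc', hcc⟩ := h.exists_isLift_fiber_eq hm hmp ht ht' hl (by
      intro x hx
      rw [hgk x hx]
      by_cases hxg : x = g
      · rw [hxg, Equiv.swap_apply_left]
        exact ⟨fun h => absurd h.symm hl'.1, fun h => absurd h.symm hl'.2⟩
      · by_cases hxk : x = k
        · rw [hxk, Equiv.swap_apply_right]
          exact ⟨fun h => absurd h.symm hl'.2, fun h => absurd h.symm hl'.1⟩
        · rw [Equiv.swap_apply_of_ne_of_ne hxg hxk])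
    exact ⟨c, c', hc, hc', hshare c c' hc.coloring hc'.coloring l hl hcc⟩

end IsStar

end LiftSteps

/-! ### Lifts of adjacent pairings -/

section AdjacentPairings

variable {V κ C : Type*} [DecidableEq V] [DecidableEq κ] [DecidableEq C]
variable {φ : κ → V → ZMod 2} {X : Finset κ} {Cs : Finset C}
  {L : Submodule (ZMod 2) (V → ZMod 2)} {v : V} {E δ : Finset κ} {p : ℕ}
  [FiniteDimensional (ZMod 2) L] {m m' J : Finset (Sym2 κ)} {t t' : κ ⊕ Sym2 κ → C} {c c' : κ → C}

/-- `c` is a lift of some independent colouring of the edges in `E` and the pairs in `m`. -/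
def IsPairLift (φ : κ → V → ZMod 2) (X : Finset κ) (Cs : Finset C) (E δ : Finset κ)
    (m : Finset (Sym2 κ)) (c : κ → C) : Prop :=
  ∃ t, IsIndepColoring (ZMod 2) (extVec φ) (E.disjSum m) Cs t ∧ IsLift φ X Cs E δ m t c

namespace IsStar

variable (h : IsStar φ X Cs L v E δ p)
include h

/-- If a pair `ab` is replaced by `bz` within its colour class, then there are lifts that agree or
differ by the swap of `a` and `z`. -/
lemma exists_isLift_of_replace {a b z : κ} (haz : a ≠ z) (hab : a ≠ b) (hbz : b ≠ z)
    (ha : ∀ s ∈ J, a ∉ s) (hb : ∀ s ∈ J, b ∉ s) (hz : ∀ s ∈ J, z ∉ s)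
    (hm : IsPairing δ (insert s(a, b) J)) (hmp : (insert s(a, b) J).card = p)
    (hm' : IsPairing δ (insert s(b, z) J)) (hmp' : (insert s(b, z) J).card = p)
    (ht : IsIndepColoring (ZMod 2) (extVec φ) (E.disjSum (insert s(a, b) J)) Cs t)
    (ht' : IsIndepColoring (ZMod 2) (extVec φ) (E.disjSum (insert s(b, z) J)) Cs t')
    (hl : ∀ e ∈ E, t' (Sum.inl e) = t (Sum.inl e)) (hr : ∀ s ∈ J, t' (Sum.inr s) = t (Sum.inr s))
    (hi : t' (Sum.inr s(b, z)) = t (Sum.inr s(a, b))) :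
    ∃ c c', IsLift φ X Cs E δ (insert s(a, b) J) t c ∧
      IsLift φ X Cs E δ (insert s(b, z) J) t' c' ∧ SwapEquiv (ZMod 2) φ X Cs c c' := by
  have habm : s(a, b) ∈ insert s(a, b) J := mem_insert_self _ _
  have hbzm : s(b, z) ∈ insert s(b, z) J := mem_insert_self _ _
  have haδ : a ∈ δ := hm.mem _ habm a (Sym2.mem_mk_left _ _)
  have hbδ : b ∈ δ := hm.mem _ habm b (Sym2.mem_mk_right _ _)
  have hzδ : z ∈ δ := hm'.mem _ hbzm z (Sym2.mem_mk_right _ _)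
  obtain ⟨i, hti⟩ : ∃ i, i = t (Sum.inr s(a, b)) := ⟨_, rfl⟩
  rw [← hti] at hi
  have hiC : i ∈ Cs := hti ▸ ht.mem _ (by simp)
  have hleft : ∀ j, leftFiber E t' j = leftFiber E t j := fun j => fiber_congr hl j
  -- the edge `b` and the members of the pairs of colour `i` other than `ab`
  set U := insert b ((fiber J (t ∘ Sum.inr) i).biUnion Sym2.toFinset) with hU
  have memU : ∀ x, x ∈ U ↔ x = b ∨ ∃ s ∈ J, t (Sum.inr s) = i ∧ x ∈ s := by
    intro x; simp [hU, and_assoc]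
  have hUδ : U ⊆ δ := by
    intro x hx
    rcases (memU x).1 hx with rfl | ⟨s, hs, -, hxs⟩
    · exact hbδ
    · exact hm.mem s (mem_insert_of_mem hs) x hxs
  have hUc : ∀ x ∈ U, ∃ s ∈ insert s(a, b) J, t (Sum.inr s) = i ∧ x ∈ s := by
    intro x hx
    rcases (memU x).1 hx with rfl | ⟨s, hs, hst, hxs⟩
    · exact ⟨_, habm, hti.symm, Sym2.mem_mk_right _ _⟩
    · exact ⟨s, mem_insert_of_mem hs, hst, hxs⟩
  have hUc' : ∀ x ∈ U, ∃ s ∈ insert s(b, z) J, t' (Sum.inr s) = i ∧ x ∈ s := by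
    intro x hx
    rcases (memU x).1 hx with rfl | ⟨s, hs, hst, hxs⟩
    · exact ⟨_, hbzm, hi, Sym2.mem_mk_left _ _⟩
    · exact ⟨s, mem_insert_of_mem hs, (hr s hs).trans hst, hxs⟩
  have hzU : z ∉ U := by
    intro hmem
    rcases (memU z).1 hmem with hzb | ⟨s, hs, -, hzs⟩
    · exact hbz hzb.symm
    · exact hz s hs hzs
  have haU : a ∉ U := by
    intro hmem
    rcases (memU a).1 hmem with hab' | ⟨s, hs, -, has⟩
    · exact hab hab'
    · exact ha s hs has
  have hδE : ∀ x ∈ δ, ∀ y ∈ E, y ≠ x := by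
    rintro x hx y hy rfl; exact disjoint_left.1 h.disjoint hy hx
  -- colours other than `i` are not affected
  have hcov : ∀ {c : κ → C}, IsLift φ X Cs E δ (insert s(a, b) J) t c → ∀ x ∈ δ, c x ≠ i →
      ∀ s ∈ insert s(b, z) J, t' (Sum.inr s) = c x →
        ∃ s' ∈ insert s(b, z) J, t' (Sum.inr s') = c x ∧ x ∈ s' := by
    intro c hc x hx hxi s hs hst
    rcases mem_insert.1 hs with rfl | hs
    · exact absurd (hst.symm.trans hi) hxi
    · rw [hr s hs] at hst
      obtain ⟨s', hs', hst', hxs'⟩ := hc.cover x hx s (mem_insert_of_mem hs) hst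
      rcases mem_insert.1 hs' with rfl | hs'
      · exact absurd (hst'.symm.trans hti.symm) hxi
      · exact ⟨s', mem_insert_of_mem hs', (hr s' hs').trans hst', hxs'⟩
  have hneT : (pairFiber (insert s(a, b) J) t i).Nonempty := ⟨_, mem_fiber.2 ⟨habm, hti.symm⟩⟩
  by_cases hspan : ∀ S : Submodule (ZMod 2) (V → ZMod 2), (∀ e ∈ leftFiber E t i, φ e ∈ S) →
      (∀ x ∈ U, φ x ∈ S) → L ≤ S
  · -- There is a common transversal that avoids `a` and `z`.
    obtain ⟨T, hTU, hT⟩ := h.exists_transversal hm hmp ht hiC hUδ hUc hspan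
    obtain ⟨c, hc, hcT⟩ := h.exists_isLift_transversal hm hmp ht hiC hneT hT
    refine ⟨c, c, hc, ⟨hc.coloring, fun e he => (hc.eq_left e he).trans (hl e he).symm,
      fun x hx s hs hst => ?_⟩, .refl⟩
    by_cases hxi : c x = i
    · rw [hxi]
      exact hUc' x (hTU (by rw [← hcT, mem_fiber]; exact ⟨hx, hxi⟩))
    · exact hcov hc x hx hxi s hs hst
  · push Not at hspan
    obtain ⟨S₀, hFS₀, hUS₀, hS₀⟩ := hspan
    have hbS₀ : φ b ∈ S₀ := hUS₀ b (mem_insert_self _ _)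
    have haS₀ : φ a ∉ S₀ := by
      intro haS
      refine hS₀ (h.le_span_of_cover hm hmp ht hiC hFS₀ (fun s hs hst x hx => ?_) ⟨b, hbδ, hbS₀⟩)
      rcases mem_insert.1 hs with rfl | hs
      · rcases Sym2.mem_iff.1 hx with rfl | rfl <;> assumption
      · exact hUS₀ x ((memU x).2 (Or.inr ⟨s, hs, hst, hx⟩))
    have hzS₀ : φ z ∉ S₀ := by
      intro hzS
      refine hS₀ (h.le_span_of_cover hm' hmp' ht' hiC (by rw [hleft]; exact hFS₀)
        (fun s hs hst x hx => ?_) ⟨b, hbδ, hbS₀⟩)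
      rcases mem_insert.1 hs with rfl | hs
      · rcases Sym2.mem_iff.1 hx with rfl | rfl <;> assumption
      · exact hUS₀ x ((memU x).2 (Or.inr ⟨s, hs, (hr s hs).symm.trans hst, hx⟩))
    obtain ⟨S, hSU, -, hind, hspanS⟩ := exists_extension (h.indep_left ht i) U
    have hspan_le : span (ZMod 2) (φ '' ((leftFiber E t i ∪ S : Finset κ) : Set κ)) ≤ S₀ := by
      rw [span_le]
      rintro _ ⟨x, hx, rfl⟩
      rcases mem_union.1 (mem_coe.1 hx) with hx | hx
      · exact hFS₀ x hx
      · exact hUS₀ x (hSU hx)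
    have hins : ∀ x, φ x ∉ S₀ → LinearIndepOn (ZMod 2) φ
        ((leftFiber E t i ∪ insert x S : Finset κ) : Set κ) := by
      intro x hx
      rw [union_insert, coe_insert]
      exact hind.insert fun hmem => hx (hspan_le hmem)
    have hT : IsTransversal φ E δ (insert s(a, b) J) t i (insert a S) := by
      refine h.isTransversal_of_span hm hmp ht hiC
        (insert_subset haδ (hSU.trans hUδ)) (fun x hx => ?_) (hins a haS₀) ?_
      · rcases mem_insert.1 hx with rfl | hx
        · exact ⟨_, habm, hti.symm, Sym2.mem_mk_left _ _⟩
        · exact hUc x (hSU hx)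
      · have hmono : span (ZMod 2) (φ '' ((leftFiber E t i ∪ S : Finset κ) : Set κ)) ≤
            span (ZMod 2) (φ '' ((leftFiber E t i ∪ insert a S : Finset κ) : Set κ)) := by
          refine span_mono (Set.image_mono ?_)
          rw [union_insert]; exact_mod_cast subset_insert _ _
        refine h.le_span_of_cover hm hmp ht hiC
          (fun e he => subset_span ⟨e, mem_coe.2 (mem_union_left _ he), rfl⟩)
          (fun s hs hst x hx => ?_) ⟨b, hbδ, hmono (hspanS b (mem_insert_self _ _))⟩
        rcases mem_insert.1 hs with rfl | hs
        · rcases Sym2.mem_iff.1 hx with rfl | rfl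
          · exact subset_span ⟨x, mem_coe.2 (mem_union_right _ (mem_insert_self _ _)), rfl⟩
          · exact hmono (hspanS x (mem_insert_self _ _))
        · exact hmono (hspanS x ((memU x).2 (Or.inr ⟨s, hs, hst, hx⟩)))
    obtain ⟨c, hc, hcT⟩ := h.exists_isLift_transversal hm hmp ht hiC hneT hT
    have hcT' : ∀ x ∈ δ, c x = i ↔ x = a ∨ x ∈ S := by
      intro x hx
      rw [← mem_insert, ← hcT, mem_fiber]
      exact ⟨fun h => ⟨hx, h⟩, fun h => h.2⟩
    have hca : c a = i := (hcT' a haδ).2 (Or.inl rfl)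
    have hcz : c z ≠ i := by
      intro hcz
      rcases (hcT' z hzδ).1 hcz with h1 | h1
      · exact haz h1.symm
      · exact hzU (hSU h1)
    have hzC : c z ∈ Cs := hc.coloring.mem z (h.right_subset hzδ)
    have hleaf : ∀ s ∈ insert s(a, b) J, t (Sum.inr s) ≠ c z := by
      intro s hs hst
      obtain ⟨s', hs', -, hzs⟩ := hc.cover z hzδ s hs hst
      rcases mem_insert.1 hs' with rfl | hs'
      · rcases Sym2.mem_iff.1 hzs with h1 | h1
        · exact haz h1.symm
        · exact hbz h1.symm
      · exact hz s' hs' hzs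
    obtain ⟨f, hf⟩ := h.fiber_eq_singleton hm hmp ht hc hzC hleaf
    have hzf : ∀ x ∈ δ, c x = c z → x = z := by
      have h1 : z ∈ fiber δ c (c z) := mem_fiber.2 ⟨hzδ, rfl⟩
      rw [hf, mem_singleton] at h1
      intro x hx hxz
      have h2 : x ∈ fiber δ c (c z) := mem_fiber.2 ⟨hx, hxz⟩
      rwa [hf, mem_singleton, ← h1] at h2
    set d := c ∘ Equiv.swap a z with hd
    have hda : d a = c z := by rw [hd, Function.comp_apply, Equiv.swap_apply_left]
    have hdz : d z = i := by rw [hd, Function.comp_apply, Equiv.swap_apply_right, hca]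
    have hdx : ∀ x, x ≠ a → x ≠ z → d x = c x := fun x h1 h2 => by
      rw [hd, Function.comp_apply, Equiv.swap_apply_of_ne_of_ne h1 h2]
    have hdl : IsLift φ X Cs E δ (insert s(b, z) J) t' d := by
      refine h.isLift_of ht' (fun e he => ?_) (fun x hx => ?_) (fun j hj => ?_)
        (fun x hx s hs hst => ?_)
      · rw [hdx e (hδE a haδ e he) (hδE z hzδ e he), hc.eq_left e he, hl e he]
      · exact hc.coloring.mem _ (h.right_subset (swap_mem haδ hzδ hx))
      · rw [hleft]
        by_cases hji : j = i
        · subst hji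
          refine (hins z hzS₀).mono ?_
          rw [coe_subset]
          refine union_subset_union_right fun x hx => ?_
          rw [mem_fiber] at hx
          rw [mem_insert]
          by_cases hxz : x = z
          · exact Or.inl hxz
          · by_cases hxa : x = a
            · rw [hxa, hda] at hx; exact absurd hx.2 hcz
            · rw [hdx x hxa hxz, hcT' x hx.1] at hx
              exact Or.inr (hx.2.resolve_left hxa)
        · by_cases hjz : j = c z
          · refine (h.indep_insert (h.indep_left ht j) (filter_subset _ _) haδ).mono ?_
            rw [coe_subset, insert_eq, union_comm]
            refine union_subset_union_left fun x hx => ?_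
            rw [mem_fiber] at hx
            rw [mem_singleton]
            by_contra hxa
            by_cases hxz : x = z
            · rw [hxz, hdz] at hx; exact hji hx.2.symm
            · rw [hdx x hxa hxz, hjz] at hx
              exact hxz (hzf x hx.1 hx.2)
          · have h1 := hc.coloring.indep j
            rw [h.fiber_eq, fiber_congr hc.eq_left] at h1
            refine h1.mono ?_
            rw [coe_subset]
            refine union_subset_union_right fun x hx => ?_
            rw [mem_fiber] at hx ⊢
            refine ⟨hx.1, ?_⟩
            rw [← hx.2]
            refine (hdx x ?_ ?_).symm
            · rintro rfl; exact hjz (hx.2.symm.trans hda)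
            · rintro rfl; exact hji (hx.2.symm.trans hdz)
      · by_cases hxa : x = a
        · rw [hxa, hda] at hst
          rcases mem_insert.1 hs with rfl | hs
          · exact absurd (hst.symm.trans hi) hcz
          · exact absurd ((hr s hs).symm.trans hst) (hleaf s (mem_insert_of_mem hs))
        · by_cases hxz : x = z
          · rw [hxz, hdz]
            exact ⟨_, hbzm, hi, Sym2.mem_mk_right _ _⟩
          · rw [hdx x hxa hxz] at hst ⊢
            by_cases hxi : c x = i
            · rw [hxi]
              exact hUc' x (hSU (((hcT' x hx).1 hxi).resolve_left hxa))
            · exact hcov hc x hx hxi s hs hst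
    exact ⟨c, d, hc, hdl, .single ⟨hc.coloring, hdl.coloring,
      Or.inr ⟨a, h.right_subset haδ, z, h.right_subset hzδ, fun _ _ => rfl⟩⟩⟩

/-- Lifts of adjacent pairings are connected, provided that this holds for any two lifts of the
same pairing. -/
lemma swapEquiv_of_pairStep
    (hsame : ∀ m, IsPairing δ m → m.card = p → ∀ c c', IsPairLift φ X Cs E δ m c →
      IsPairLift φ X Cs E δ m c' → SwapEquiv (ZMod 2) φ X Cs c c')
    (hstep : PairStep φ E δ Cs p m m') (hc : IsPairLift φ X Cs E δ m c)
    (hc' : IsPairLift φ X Cs E δ m' c') : SwapEquiv (ZMod 2) φ X Cs c c' := by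
  obtain ⟨hm, hm', J, a, b, z, hab, hbz, haz, ha, hb, hz, rfl, rfl⟩ := hstep
  have hJ : IsPairing δ J := hm.pairing.mono (subset_insert _ _)
  have haδ : a ∈ δ := hm.pairing.mem _ (mem_insert_self _ _) a (Sym2.mem_mk_left _ _)
  have hbδ : b ∈ δ := hm.pairing.mem _ (mem_insert_self _ _) b (Sym2.mem_mk_right _ _)
  have hzδ : z ∈ δ := hm'.pairing.mem _ (mem_insert_self _ _) z (Sym2.mem_mk_right _ _)
  have hp : J.card + 1 = p := by
    have := hm.card
    rwa [card_insert_of_notMem (notMem_of_forall_notMem ha)] at this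
  -- a pair `x y` may be replaced by `y w` if the latter fits into the same colour class
  have replace : ∀ {x y w : κ} {t : κ ⊕ Sym2 κ → C}, x ∈ δ → y ∈ δ → w ∈ δ → x ≠ y → y ≠ w →
      x ≠ w → (∀ s ∈ J, x ∉ s) → (∀ s ∈ J, y ∉ s) → (∀ s ∈ J, w ∉ s) →
      IsIndepColoring (ZMod 2) (extVec φ) (E.disjSum (insert s(x, y) J)) Cs t →
      φ y + φ w ∉ span (ZMod 2) (extVec φ '' (fiber (E.disjSum J) t (t (Sum.inr s(x, y))) :
        Set (κ ⊕ Sym2 κ))) →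
      ∀ c c', IsPairLift φ X Cs E δ (insert s(x, y) J) c →
        IsPairLift φ X Cs E δ (insert s(y, w) J) c' → SwapEquiv (ZMod 2) φ X Cs c c' := by
    intro x y w t hx hy hw hxy hyw hxw hxJ hyJ hwJ ht hspan c c' hc hc'
    have hm₁ := hJ.insert hx hy hxy hxJ hyJ
    have hm₂ := hJ.insert hy hw hyw hyJ hwJ
    have hp₁ : (insert s(x, y) J).card = p := by
      rw [card_insert_of_notMem (notMem_of_forall_notMem hxJ), hp]
    have hp₂ : (insert s(y, w) J).card = p := by
      rw [card_insert_of_notMem (notMem_of_forall_notMem hyJ), hp]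
    have hsub : E.disjSum J ⊆ E.disjSum (insert s(x, y) J) :=
      disjSum_mono_right' (subset_insert _ _)
    have ht' := (ht.mono hsub).update (e := Sum.inr s(y, w))
      (ht.mem (Sum.inr s(x, y)) (by simp)) (by rwa [extVec_inr, pairVec_mk])
    have hins : insert (Sum.inr s(y, w)) (E.disjSum J) = E.disjSum (insert s(y, w) J) := by
      ext u; cases u <;> simp
    rw [hins] at ht'
    obtain ⟨d, d', hd, hd', hdd⟩ := h.exists_isLift_of_replace hxw hxy hyw hxJ hyJ hwJ hm₁ hp₁ hm₂
      hp₂ ht ht' (fun e _ => Function.update_of_ne (by simp) _ _)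
      (fun s hs => Function.update_of_ne (fun heq => by
        rw [Sum.inr.injEq] at heq
        exact hyJ s hs (heq ▸ Sym2.mem_mk_left _ _)) _ _)
      (Function.update_self _ _ _)
    exact ((hsame _ hm₁ hp₁ c d hc ⟨t, ht, hd⟩).trans hdd).trans
      (hsame _ hm₂ hp₂ d' c' ⟨_, ht', hd'⟩ hc')
  have notMem : ∀ {x y : κ} {t : κ ⊕ Sym2 κ → C}, (∀ s ∈ J, x ∉ s) →
      IsIndepColoring (ZMod 2) (extVec φ) (E.disjSum (insert s(x, y) J)) Cs t →
      φ x + φ y ∉ span (ZMod 2) (extVec φ '' (fiber (E.disjSum J) t (t (Sum.inr s(x, y))) :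
        Set (κ ⊕ Sym2 κ))) := by
    intro x y t hx ht hmem
    refine (ht.indep (t (Sum.inr s(x, y)))).notMem_span (i := Sum.inr s(x, y)) (by simp) ?_
    refine span_mono (Set.image_mono ?_) hmem
    intro u hu
    rw [mem_coe, mem_fiber] at hu
    refine ⟨by simpa using ⟨disjSum_mono_right' (subset_insert _ _) hu.1, hu.2⟩, ?_⟩
    rintro rfl
    exact notMem_of_forall_notMem hx (by simpa using hu.1)
  obtain ⟨t, ht, -⟩ := id hc
  obtain ⟨t', ht', -⟩ := id hc'
  rw [Sym2.eq_swap] at hc' ht'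
  rcases add_notMem_or (φ a) (notMem hz ht') with h1 | h1
  · rcases add_notMem_or (φ z) (notMem ha ht) with h2 | h2
    · -- via the pairing that contains `a z`
      have hz' : IsPairing δ (insert s(a, z) J) := hJ.insert haδ hzδ haz ha hz
      have hcol : Colorable (ZMod 2) (extVec φ) Cs (E.disjSum (insert s(a, z) J)) := by
        have := (ht.mono (disjSum_mono_right' (subset_insert _ _))).update (e := Sum.inr s(a, z))
          (ht.mem (Sum.inr s(a, b)) (by simp)) (by rwa [extVec_inr, pairVec_mk])
        refine ⟨_, this.mono ?_⟩
        intro u; cases u <;> simp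
      obtain ⟨s, hs⟩ := hcol
      obtain ⟨d, hd⟩ := h.exists_isLift' hz'
        (by rw [card_insert_of_notMem (notMem_of_forall_notMem ha), hp]) hs
      have e1 : SwapEquiv (ZMod 2) φ X Cs c d := by
        rw [Sym2.eq_swap] at hc ht
        refine replace hbδ haδ hzδ hab.symm haz hbz hb ha hz ht ?_ c d hc ⟨s, hs, hd⟩
        rwa [Sym2.eq_swap]
      have e2 : SwapEquiv (ZMod 2) φ X Cs c' d := by
        have hd' : IsPairLift φ X Cs E δ (insert s(z, a) J) d := by
          rw [Sym2.eq_swap]; exact ⟨s, hs, hd⟩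
        rw [Sym2.eq_swap] at hc' ht'
        refine replace hbδ hzδ haδ hbz haz.symm hab.symm hb hz ha ht' ?_ c' d hc' hd'
        rwa [Sym2.eq_swap]
      exact e1.trans e2.symm
    · refine replace haδ hbδ hzδ hab hbz haz ha hb hz ht (by rwa [add_comm]) c c' hc ?_
      rwa [Sym2.eq_swap]
  · refine (replace hzδ hbδ haδ hbz.symm hab.symm haz.symm hz hb ha ht' (by rwa [add_comm]) c' c
      hc' ?_).symm
    rwa [Sym2.eq_swap]

end IsStar

end AdjacentPairings

/-! ### Colourings with at most two edges at a vertex in each class -/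

section Swaps

variable {K W κ C : Type*} [Field K] [AddCommGroup W] [Module K W] [DecidableEq κ] [DecidableEq C]
  {φ : κ → W} {X : Finset κ} {Cs : Finset C} {c c' : κ → C}

lemma SwapEquiv.of_eqOn (hc : IsIndepColoring K φ X Cs c) (hcc : ∀ x ∈ X, c' x = c x) :
    SwapEquiv K φ X Cs c c' :=
  .single ⟨hc, hc.congr fun x hx => (hcc x hx).symm, Or.inl hcc⟩

lemma IsIndepColoring.swap (hc : IsIndepColoring K φ X Cs c) {e f : κ} (he : e ∈ X) (hf : f ∈ X)
    (hne : c e ≠ c f) (hfe : φ f ∉ span K (φ '' (((fiber X c (c e)).erase e : Finset κ) : Set κ)))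
    (hef : φ e ∉ span K (φ '' (((fiber X c (c f)).erase f : Finset κ) : Set κ))) :
    IsIndepColoring K φ X Cs (c ∘ Equiv.swap e f) := by
  refine ⟨fun x hx => hc.mem _ (swap_mem he hf hx), fun i => ?_⟩
  have hx : ∀ x, x ≠ e → x ≠ f → (c ∘ Equiv.swap e f) x = c x := fun x h1 h2 => by
    rw [Function.comp_apply, Equiv.swap_apply_of_ne_of_ne h1 h2]
  have he' : (c ∘ Equiv.swap e f) e = c f := by rw [Function.comp_apply, Equiv.swap_apply_left]
  have hf' : (c ∘ Equiv.swap e f) f = c e := by rw [Function.comp_apply, Equiv.swap_apply_right]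
  have key : ∀ {i : C} {e f : κ}, φ f ∉ span K (φ '' (((fiber X c i).erase e : Finset κ) : Set κ)) →
      (∀ x ∈ fiber X (c ∘ Equiv.swap e f) i, x = f ∨ x ∈ (fiber X c i).erase e) →
      LinearIndepOn K φ (fiber X (c ∘ Equiv.swap e f) i : Set κ) := by
    intro i e f h1 h2
    refine (((hc.indep i).mono (by simp)).insert h1).mono fun x hx => ?_
    rcases h2 x hx with rfl | h
    · exact Set.mem_insert _ _
    · exact Set.mem_insert_of_mem _ h
  by_cases hie : i = c e
  · subst hie
    refine key hfe fun x hxi => ?_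
    rw [mem_fiber] at hxi
    by_cases hxf : x = f
    · exact Or.inl hxf
    · have hxe : x ≠ e := by rintro rfl; exact hne (hxi.2.symm.trans he')
      rw [hx x hxe hxf] at hxi
      exact Or.inr (mem_erase.2 ⟨hxe, mem_fiber.2 hxi⟩)
  · by_cases hif : i = c f
    · subst hif
      rw [Equiv.swap_comm] at he' hf' hx ⊢
      refine key hef fun x hxi => ?_
      rw [mem_fiber] at hxi
      by_cases hxe : x = e
      · exact Or.inl hxe
      · have hxf : x ≠ f := by rintro rfl; exact hne (hf'.symm.trans hxi.2)
        rw [hx x hxe hxf] at hxi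
        exact Or.inr (mem_erase.2 ⟨hxf, mem_fiber.2 hxi⟩)
    · refine (hc.indep i).mono fun x hxi => ?_
      rw [mem_coe, mem_fiber] at hxi ⊢
      have hxe : x ≠ e := by rintro rfl; exact hif (hxi.2.symm.trans he')
      have hxf : x ≠ f := by rintro rfl; exact hie (hxi.2.symm.trans hf')
      rwa [hx x hxe hxf] at hxi

/-- Swaps that do not affect a colour class `Z` may be performed in its presence. -/
lemma SwapEquiv.extend {Z : Finset κ} {l : C} (hl : l ∈ Cs)
    (hZ : LinearIndepOn K φ (Z : Set κ)) (h : SwapEquiv K φ (X \ Z) (Cs.erase l) c c') :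
    SwapEquiv K φ X Cs (fun x => if x ∈ Z then l else c x)
      (fun x => if x ∈ Z then l else c' x) := by
  refine ReflTransGen.lift (p := SwapStep K φ X Cs)
    (fun (c : κ → C) x => if x ∈ Z then l else c x) (fun d d' hd => ?_) _ _ h
  have hcol : ∀ d : κ → C, IsIndepColoring K φ (X \ Z) (Cs.erase l) d →
      IsIndepColoring K φ X Cs (fun x => if x ∈ Z then l else d x) := by
    intro d hd
    refine ⟨fun x hx => ?_, fun i => ?_⟩
    · split_ifs with hxZ
      · exact hl
      · exact mem_of_mem_erase (hd.mem x (mem_sdiff.2 ⟨hx, hxZ⟩))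
    · by_cases hil : i = l
      · refine hZ.mono fun x hx => ?_
        rw [mem_coe, mem_fiber] at hx
        by_contra hxZ
        rw [mem_coe] at hxZ
        simp only [hxZ, if_false] at hx
        exact (mem_erase.1 (hd.mem x (mem_sdiff.2 ⟨hx.1, hxZ⟩))).1 (hx.2.trans hil)
      · refine (hd.indep i).mono fun x hx => ?_
        rw [mem_coe, mem_fiber] at hx ⊢
        by_cases hxZ : x ∈ Z
        · simp only [hxZ, if_true] at hx
          exact absurd hx.2.symm hil
        · simp only [hxZ, if_false] at hx
          exact ⟨mem_sdiff.2 ⟨hx.1, hxZ⟩, hx.2⟩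
  refine ⟨hcol d hd.1, hcol d' hd.2.1, ?_⟩
  rcases hd.2.2 with h | ⟨e, he, f, hf, h⟩
  · refine Or.inl fun x hx => ?_
    dsimp only
    split_ifs with hxZ
    · rfl
    · exact h x (mem_sdiff.2 ⟨hx, hxZ⟩)
  · refine Or.inr ⟨e, (mem_sdiff.1 he).1, f, (mem_sdiff.1 hf).1, fun x hx => ?_⟩
    by_cases hxZ : x ∈ Z
    · have h1 : x ≠ e := by rintro rfl; exact (mem_sdiff.1 he).2 hxZ
      have h2 : x ≠ f := by rintro rfl; exact (mem_sdiff.1 hf).2 hxZ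
      simp only [hxZ, if_true, Equiv.swap_apply_of_ne_of_ne h1 h2]
    · have hx' := mem_sdiff.2 ⟨hx, hxZ⟩
      have := (mem_sdiff.1 (swap_mem he hf hx')).2
      simp only [hxZ, this, if_false]
      exact h x hx'

end Swaps

section Sparse

variable {V κ C : Type*} [DecidableEq V] [DecidableEq κ] [DecidableEq C]
variable {φ : κ → V → ZMod 2} {X : Finset κ} {Cs : Finset C}
  {L : Submodule (ZMod 2) (V → ZMod 2)} {v : V} {E δ : Finset κ} {p : ℕ}
  [FiniteDimensional (ZMod 2) L] {c c' : κ → C}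

namespace IsStar

variable (h : IsStar φ X Cs L v E δ p)
include h

lemma right_fiber_nonempty (hc : IsIndepColoring (ZMod 2) φ X Cs c) {i : C} (hi : i ∈ Cs) :
    (fiber δ c i).Nonempty := by
  by_contra hne
  rw [not_nonempty_iff_eq_empty] at hne
  have hle : L ≤ vanishAt L v := by
    nth_rewrite 1 [← span_fiber_eq h.card h.mem hc hi]
    rw [span_le]
    rintro _ ⟨e, he, rfl⟩
    rw [h.fiber_eq, hne, union_empty] at he
    have he' := (h.mem_left e).1 (mem_fiber.1 he).1
    exact ⟨h.mem e he'.1, he'.2⟩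
  have h1 := Submodule.finrank_mono hle
  have h2 := h.finrank
  omega

/-- If some colour class has at least three edges at `v`, then one of them can be exchanged for an
edge of a class that has a single edge at `v`. -/
lemma exists_swap_of_three_le {A : Finset V}
    (hA : ∀ x ∈ X, ∃ y ∈ A, ∃ z ∈ A, φ x = edgeVec y z)
    (hc : IsIndepColoring (ZMod 2) φ X Cs c) {i : C} (hi : i ∈ Cs)
    (h3 : 3 ≤ (fiber δ c i).card) :
    ∃ d, SwapEquiv (ZMod 2) φ X Cs c d ∧
      ∑ j ∈ Cs, ((fiber δ d j).card - 2) < ∑ j ∈ Cs, ((fiber δ c j).card - 2) := by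
  obtain ⟨l, hl, hl1⟩ : ∃ l ∈ Cs, (fiber δ c l).card = 1 := by
    by_contra! hcon
    have h1 : ∀ l ∈ Cs, 2 ≤ (fiber δ c l).card := fun l hl => by
      have := (h.right_fiber_nonempty hc hl).card_pos
      have := hcon l hl
      omega
    have h2 := Finset.card_nsmul_le_sum Cs _ _ h1
    rw [sum_card_fiber fun x hx => hc.mem x (h.right_subset hx), h.card_right, smul_eq_mul] at h2
    have := h.lt
    omega
  have hil : i ≠ l := by rintro rfl; omega
  obtain ⟨g, hg⟩ := card_eq_one.1 hl1
  have hgl : g ∈ δ ∧ c g = l := by rw [← mem_fiber, hg]; exact mem_singleton_self g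
  obtain ⟨s₁, hs₁, s₂, hs₂, hne⟩ := one_lt_card.1 (show 1 < (fiber δ c i).card by omega)
  have hmono : ∀ s ∈ fiber δ c i, s ∈ fiber X c i := fun s hs => by
    rw [h.fiber_eq]; exact mem_union_right _ hs
  have hgX := h.right_subset hgl.1
  have hv : ∀ s ∈ fiber δ c i, φ s v = 1 := fun s hs =>
    ((h.mem_right s).1 (mem_fiber.1 hs).1).2
  obtain ⟨s, hs, hgs⟩ : ∃ s ∈ fiber δ c i,
      φ g ∈ span (ZMod 2) (φ '' (((fiber X c i).erase s : Finset κ) : Set κ)) := by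
    rcases mem_span_erase_or_of_star (T := fiber X c i) (fun e he => hA e (mem_fiber.1 he).1)
      (hA g hgX) (by rw [span_fiber_eq h.card h.mem hc hi]; exact h.mem g hgX)
      ((h.mem_right g).1 hgl.1).2 (hv s₁ hs₁) (hv s₂ hs₂) hne with h1 | h1
    · exact ⟨s₁, hs₁, h1⟩
    · exact ⟨s₂, hs₂, h1⟩
  have hs' := mem_fiber.1 hs
  have hsX := h.right_subset hs'.1
  obtain ⟨f, hf, hfs, hsf⟩ := exists_symmetric_exchange (hc.indep i) (hc.indep l) (hmono s hs)
    (by rw [span_fiber_eq h.card h.mem hc hl]; exact h.mem s hsX)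
  rw [mem_fiber] at hf
  have hfδ : f ∉ δ := by
    intro hfδ
    have : f ∈ fiber δ c l := mem_fiber.2 ⟨hfδ, hf.2⟩
    rw [hg, mem_singleton] at this
    exact hfs (this ▸ hgs)
  have hcol := hc.swap hsX hf.1 (by rw [hs'.2, hf.2]; exact hil) (by rw [hs'.2]; exact hfs)
    (by rw [hf.2]; exact hsf)
  refine ⟨_, .single ⟨hc, hcol, Or.inr ⟨s, hsX, f, hf.1, fun _ _ => rfl⟩⟩, ?_⟩
  have hne' : ∀ x ∈ δ, x ≠ f := by rintro x hx rfl; exact hfδ hx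
  have hfib : ∀ j, j ≠ l → fiber δ (c ∘ Equiv.swap s f) j ⊆ (fiber δ c j).erase s := by
    intro j hj x hx
    rw [mem_fiber, Function.comp_apply] at hx
    have hxs : x ≠ s := by
      rintro rfl
      rw [Equiv.swap_apply_left, hf.2] at hx
      exact hj hx.2.symm
    rw [Equiv.swap_apply_of_ne_of_ne hxs (hne' x hx.1)] at hx
    exact mem_erase.2 ⟨hxs, mem_fiber.2 hx⟩
  refine sum_lt_sum (fun j hj => ?_) ⟨i, hi, ?_⟩
  · by_cases hjl : j = l
    · subst hjl
      have hsub : fiber δ (c ∘ Equiv.swap s f) j ⊆ insert s (fiber δ c j) := by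
        intro x hx
        rw [mem_fiber, Function.comp_apply] at hx
        by_cases hxs : x = s
        · exact mem_insert.2 (Or.inl hxs)
        · rw [Equiv.swap_apply_of_ne_of_ne hxs (hne' x hx.1)] at hx
          exact mem_insert_of_mem (mem_fiber.2 hx)
      have h1 := card_le_card hsub
      have h2 := card_insert_le s (fiber δ c j)
      omega
    · exact Nat.sub_le_sub_right (card_le_card ((hfib j hjl).trans (erase_subset _ _))) _
  · have h1 := card_le_card (hfib i hil)
    rw [card_erase_of_mem hs] at h1
    omega

lemma exists_card_le_two {A : Finset V} (hA : ∀ x ∈ X, ∃ y ∈ A, ∃ z ∈ A, φ x = edgeVec y z)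
    (hc : IsIndepColoring (ZMod 2) φ X Cs c) :
    ∃ d, IsIndepColoring (ZMod 2) φ X Cs d ∧ SwapEquiv (ZMod 2) φ X Cs c d ∧
      ∀ i ∈ Cs, (fiber δ d i).card ≤ 2 := by
  obtain ⟨k, hk⟩ : ∃ k, k = ∑ j ∈ Cs, ((fiber δ c j).card - 2) := ⟨_, rfl⟩
  induction k using Nat.strong_induction_on generalizing c with
  | _ k ih =>
    by_cases hall : ∀ i ∈ Cs, (fiber δ c i).card ≤ 2
    · exact ⟨c, hc, .refl, hall⟩
    push Not at hall
    obtain ⟨i, hi, h3⟩ := hall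
    obtain ⟨d, hcd, hlt⟩ := h.exists_swap_of_three_le hA hc hi h3
    have hd : IsIndepColoring (ZMod 2) φ X Cs d := by
      rcases ReflTransGen.cases_tail hcd with rfl | ⟨_, -, hs⟩
      · exact hc
      · exact hs.2.1
    obtain ⟨d', hd', hdd', hall⟩ := ih _ (hk ▸ hlt) hd rfl
    exact ⟨d', hd', hcd.trans hdd', hall⟩

/-- A colouring whose classes have at most two edges at `v` is a lift: it belongs to the pairing of
the edges at `v` of equal colour. -/
lemma exists_isPairLift (hc : IsIndepColoring (ZMod 2) φ X Cs c)
    (h2 : ∀ i ∈ Cs, (fiber δ c i).card ≤ 2) :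
    ∃ m, IsRealized φ E δ Cs p m ∧ IsPairLift φ X Cs E δ m c := by
  classical
  set m := δ.sym2.filter fun s => ¬ s.IsDiag ∧ ∀ a ∈ s, ∀ b ∈ s, c a = c b with hm
  have hcC : ∀ a ∈ δ, c a ∈ Cs := fun a ha => hc.mem a (h.right_subset ha)
  have mem_m : ∀ a b, s(a, b) ∈ m ↔ a ∈ δ ∧ b ∈ δ ∧ a ≠ b ∧ c a = c b := by
    intro a b
    simp only [hm, mem_filter, mk_mem_sym2_iff, Sym2.mk_isDiag_iff, Sym2.mem_iff]
    constructor
    · rintro ⟨⟨h1, h2⟩, h3, h4⟩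
      exact ⟨h1, h2, h3, h4 a (Or.inl rfl) b (Or.inr rfl)⟩
    · rintro ⟨h1, h2, h3, h4⟩
      refine ⟨⟨h1, h2⟩, h3, ?_⟩
      rintro x (rfl | rfl) y (rfl | rfl) <;> simp [h4]
  have hpair : ∀ {a b x : κ}, s(a, b) ∈ m → x ∈ δ → c x = c a → x = a ∨ x = b := by
    intro a b x hab hx hxa
    obtain ⟨ha, hb, hne, hcab⟩ := (mem_m a b).1 hab
    by_contra! hcon
    have hsub : ({x, a, b} : Finset κ) ⊆ fiber δ c (c a) := by
      intro y; simp only [mem_insert, mem_singleton]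
      rintro (rfl | rfl | rfl) <;> rw [mem_fiber]
      · exact ⟨hx, hxa⟩
      · exact ⟨ha, rfl⟩
      · exact ⟨hb, hcab.symm⟩
    have h3 := card_le_card hsub
    rw [card_insert_of_notMem (by simp [hcon.1, hcon.2]), card_pair hne] at h3
    have := h2 _ (hcC a ha)
    omega
  let t : κ ⊕ Sym2 κ → C := Sum.elim c fun s => c s.out.1
  have hts : ∀ a b, s(a, b) ∈ m → t (Sum.inr s(a, b)) = c a := by
    intro a b hab
    have h1 := Sym2.out_fst_mem s(a, b)
    rcases Sym2.mem_iff.1 h1 with h1 | h1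
    · exact congrArg c h1
    · exact (congrArg c h1).trans ((mem_m a b).1 hab).2.2.2.symm
  have hmP : IsPairing δ m := by
    refine ⟨fun s hs a ha => ?_, fun s hs => (mem_filter.1 hs).2.1, fun s hs s' hs' a ha ha' => ?_⟩
    · exact mem_sym2_iff.1 (mem_filter.1 hs).1 a ha
    · obtain ⟨b, rfl⟩ := ha
      obtain ⟨b', rfl⟩ := ha'
      obtain ⟨ha, hb, hne, hcab⟩ := (mem_m a b).1 hs
      rcases hpair hs' hb hcab.symm with h1 | h1
      · exact absurd h1.symm hne
      · rw [h1]
  have hfib : ∀ i ∈ Cs, (∃ a, fiber δ c i = {a} ∧ pairFiber m t i = ∅) ∨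
      ∃ a b, s(a, b) ∈ m ∧ fiber δ c i = {a, b} ∧ pairFiber m t i = {s(a, b)} := by
    intro i hi
    have h1 := (h.right_fiber_nonempty hc hi).card_pos
    have h2' := h2 i hi
    obtain h3 | h3 : (fiber δ c i).card = 1 ∨ (fiber δ c i).card = 2 := by omega
    · obtain ⟨a, ha⟩ := card_eq_one.1 h3
      refine Or.inl ⟨a, ha, ?_⟩
      ext s
      simp only [mem_fiber, notMem_empty, iff_false]
      rintro ⟨hs, hst⟩
      induction s with
      | _ x y =>
        rw [Function.comp_apply, hts x y hs] at hst
        obtain ⟨hx, hy, hne, hxy⟩ := (mem_m x y).1 hs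
        have h4 : x ∈ fiber δ c i := mem_fiber.2 ⟨hx, hst⟩
        have h5 : y ∈ fiber δ c i := mem_fiber.2 ⟨hy, hxy.symm.trans hst⟩
        rw [ha, mem_singleton] at h4 h5
        exact hne (h4.trans h5.symm)
    · obtain ⟨a, b, hab, hf⟩ := card_eq_two.1 h3
      have ha : a ∈ fiber δ c i := by rw [hf]; simp
      have hb : b ∈ fiber δ c i := by rw [hf]; simp
      rw [mem_fiber] at ha hb
      have habm := (mem_m a b).2 ⟨ha.1, hb.1, hab, ha.2.trans hb.2.symm⟩
      refine Or.inr ⟨a, b, habm, hf, eq_singleton_iff_unique_mem.2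
        ⟨mem_fiber.2 ⟨habm, (hts a b habm).trans ha.2⟩, fun s hs => ?_⟩⟩
      rw [mem_fiber] at hs
      induction s with
      | _ x y =>
        have hsm := hs.1
        rw [Function.comp_apply, hts x y hsm] at hs
        obtain ⟨hx, hy, hne, hxy⟩ := (mem_m x y).1 hsm
        refine hmP.eq_of_mem _ hsm _ habm x (Sym2.mem_mk_left _ _) ?_
        rw [Sym2.mem_iff]
        exact hpair habm hx (hs.2.trans ha.2.symm)
  have ht : IsIndepColoring (ZMod 2) (extVec φ) (E.disjSum m) Cs t := by
    have htmem : ∀ x ∈ E.disjSum m, t x ∈ Cs := by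
      intro x hx
      cases x with
      | inl e => exact hc.mem e (h.left_subset (by simpa using hx))
      | inr s => exact hcC _ (hmP.mem s (by simpa using hx) _ s.out_fst_mem)
    refine ⟨htmem, fun i => ?_⟩
    by_cases hi : i ∈ Cs
    · have hleft : LinearIndepOn (ZMod 2) (extVec φ)
          (Sum.inl '' (fiber E c i : Set κ) : Set (κ ⊕ Sym2 κ)) :=
        LinearIndepOn.image_of_comp _ _ ((hc.indep i).mono (by
          rw [h.fiber_eq]; exact_mod_cast subset_union_left))
      have hl : leftFiber E t i = fiber E c i := rfl
      rw [fiber_disjSum, hl]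
      rcases hfib i hi with ⟨a, -, h0⟩ | ⟨a, b, hab, hf, h1⟩
      · refine hleft.mono ?_
        rw [h0]
        rintro (e | s) hx
        · exact ⟨e, by simpa using hx, rfl⟩
        · simp at hx
      · refine (hleft.insert (x := Sum.inr s(a, b)) ?_).mono ?_
        · intro hmem
          rw [← Set.image_comp, extVec_inr, pairVec_mk] at hmem
          have ha : a ∈ fiber δ c i := by rw [hf]; simp
          rw [mem_fiber] at ha
          refine (hc.indep i).notMem_span (mem_coe.2 (mem_fiber.2 ⟨h.right_subset ha.1, ha.2⟩)) ?_
          have hsub : fiber E c i ⊆ fiber X c i := by rw [h.fiber_eq]; exact subset_union_left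
          have hb : b ∈ fiber δ c i := by rw [hf]; simp
          rw [mem_fiber] at hb
          have h4 : φ a + φ b ∈ span (ZMod 2) (φ '' ((fiber X c i : Set κ) \ {a})) := by
            refine span_mono ?_ hmem
            rintro _ ⟨e, he, rfl⟩
            refine ⟨e, ⟨hsub he, ?_⟩, rfl⟩
            rintro rfl
            exact disjoint_left.1 h.disjoint (mem_fiber.1 he).1 ha.1
          have h5 : φ b ∈ span (ZMod 2) (φ '' ((fiber X c i : Set κ) \ {a})) :=
            subset_span ⟨b, ⟨mem_coe.2 (mem_fiber.2 ⟨h.right_subset hb.1, hb.2⟩),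
              ((mem_m a b).1 hab).2.2.1.symm⟩, rfl⟩
          have := add_mem h4 h5
          rwa [add_assoc, add_self_eq_zero', add_zero] at this
        · rw [h1]
          rintro (e | s) hx
          · exact Or.inr ⟨e, by simpa using hx, rfl⟩
          · exact Or.inl (by simpa using hx)
    · have : fiber (E.disjSum m) t i = ∅ := by
        ext x; simp only [mem_fiber, notMem_empty, iff_false]
        rintro ⟨hx, rfl⟩; exact hi (htmem x hx)
      rw [this]; simp
  have hmp : m.card = p := by
    have h1 : ∑ i ∈ Cs, ((pairFiber m t i).card + 1) = ∑ i ∈ Cs, (fiber δ c i).card := by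
      refine sum_congr rfl fun i hi => ?_
      rcases hfib i hi with ⟨a, h1, h0⟩ | ⟨a, b, hab, hf, h1⟩
      · rw [h1, h0, card_empty, card_singleton]
      · rw [h1, hf, card_singleton, card_pair ((mem_m a b).1 hab).2.2.1]
    rw [sum_card_fiber hcC, sum_add_distrib,
      sum_card_fiber (c := t ∘ Sum.inr) (fun s hs => ht.mem (Sum.inr s)
        (by simpa using hs)), h.card_right] at h1
    simp at h1
    omega
  refine ⟨m, ⟨hmP, hmp, t, ht⟩, t, ht, hc, fun _ _ => rfl, fun a ha s hs hst => ⟨s, hs, hst, ?_⟩⟩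
  induction s with
  | _ x y =>
    rw [hts x y hs] at hst
    exact Sym2.mem_iff.2 (hpair hs ha hst.symm)

end IsStar

end Sparse

/-! ### Colourings of graphs are connected by swaps -/

section Connectivity

universe w

variable {V C : Type*} [DecidableEq V] [DecidableEq C]

/-- The rank of a space spanned by edges on the vertex set `A` is less than the size of `A`. -/
lemma card_lt_of_linearIndepOn_edgeVec {κ : Type*} [DecidableEq κ] {φ : κ → V → ZMod 2}
    {A : Finset V} (hA : A.Nonempty) {T : Finset κ} (hT : LinearIndepOn (ZMod 2) φ (T : Set κ))
    (h : ∀ x ∈ T, ∃ y ∈ A, ∃ z ∈ A, φ x = edgeVec y z) : T.card < A.card := by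
  obtain ⟨x₀, hx₀⟩ := hA
  have h1 := card_le_finrank (L := span (ZMod 2) (edgeVec x₀ '' ((A.erase x₀ : Finset V) : Set V)))
    hT fun e he => by
      have key : ∀ y ∈ A, edgeVec x₀ y ∈
          span (ZMod 2) (edgeVec x₀ '' ((A.erase x₀ : Finset V) : Set V)) := by
        intro y hy
        by_cases hyx : y = x₀
        · rw [hyx, edgeVec_self]; exact zero_mem _
        · exact subset_span ⟨y, by simp [hy, hyx], rfl⟩
      obtain ⟨y, hy, z, hz, hyz⟩ := h e he
      rw [hyz, ← edgeVec_add x₀]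
      exact add_mem (key y hy) (key z hz)
  have h2 := finrank_span_image_le (K := ZMod 2) (φ := edgeVec x₀) (A.erase x₀)
  have h3 := card_erase_add_one hx₀
  omega

/-- Since the rank is less than the number of vertices, some vertex has degree less than twice the
number of bases. -/
lemma exists_card_filter_lt {κ : Type*} [DecidableEq κ] {φ : κ → V → ZMod 2} {A : Finset V}
    {X : Finset κ} {r n : ℕ} (hX : X.card = n * r) (hr : r < A.card) (hn : 0 < n)
    (h : ∀ x ∈ X, ∃ y ∈ A, ∃ z ∈ A, φ x = edgeVec y z) :
    ∃ v ∈ A, (X.filter fun x => φ x v = 1).card < 2 * n := by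
  by_contra! hcon
  have h1 := Finset.card_nsmul_le_sum A _ _ hcon
  have h2 : ∑ v ∈ A, (X.filter fun x => φ x v = 1).card ≤ X.card * 2 := by
    simp_rw [card_filter]
    rw [sum_comm, ← smul_eq_mul]
    refine sum_le_card_nsmul _ _ _ fun x hx => ?_
    rw [← card_filter]
    obtain ⟨y, -, z, -, hyz⟩ := h x hx
    refine (card_le_card (t := {y, z}) fun u hu => ?_).trans card_le_two
    rw [mem_filter, hyz, edgeVec_apply] at hu
    by_contra hcon
    simp only [mem_insert, mem_singleton, not_or] at hcon
    simp [hcon.1, hcon.2] at hu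
  rw [smul_eq_mul] at h1
  have h3 : A.card * (2 * n) ≤ r * (2 * n) := by
    calc A.card * (2 * n) ≤ X.card * 2 := h1.trans h2
      _ = r * (2 * n) := by rw [hX]; ring
  exact absurd (Nat.le_of_mul_le_mul_right h3 (by omega)) (not_le.2 hr)

lemma finrank_vanishAt_add_one {L : Submodule (ZMod 2) (V → ZMod 2)}
    [FiniteDimensional (ZMod 2) L] {v : V} {w : V → ZMod 2} (hw : w ∈ L) (hwv : w v = 1) :
    Module.finrank (ZMod 2) (vanishAt L v) + 1 = Module.finrank (ZMod 2) L := by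
  let f : Module.Dual (ZMod 2) L :=
    (LinearMap.proj v : (V → ZMod 2) →ₗ[ZMod 2] ZMod 2) ∘ₗ L.subtype
  have hf : f ≠ 0 := by
    intro hf
    have h0 : f ⟨w, hw⟩ = 0 := by rw [hf]; rfl
    have h1 : f ⟨w, hw⟩ = w v := rfl
    rw [h1, hwv] at h0
    exact one_ne_zero h0
  rw [← Module.Dual.finrank_ker_add_one_of_ne_zero hf, vanishAt, ← Submodule.map_comap_subtype,
    Submodule.finrank_map_subtype_eq]
  rfl

/-- Two independent colourings are connected by swaps if they partition the same edges into bases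
of the same space. The induction is on the number of vertices plus the number of colours. -/
theorem swapEquiv_of_edgeVec (N : ℕ) : ∀ {κ : Type w} [DecidableEq κ] {φ : κ → V → ZMod 2}
    {X : Finset κ} {Cs : Finset C} {L : Submodule (ZMod 2) (V → ZMod 2)}
    [FiniteDimensional (ZMod 2) L] {A : Finset V} {c c' : κ → C}, A.card + Cs.card ≤ N →
    (∀ x ∈ X, ∃ y ∈ A, ∃ z ∈ A, φ x = edgeVec y z) → (∀ x ∈ X, φ x ∈ L) →
    X.card = Cs.card * Module.finrank (ZMod 2) L → IsIndepColoring (ZMod 2) φ X Cs c →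
    IsIndepColoring (ZMod 2) φ X Cs c' → SwapEquiv (ZMod 2) φ X Cs c c' := by
  induction N with
  | zero =>
    intro κ _ φ X Cs L _ A c c' hN hA hL hX hc hc'
    have hCs : Cs = ∅ := card_eq_zero.1 (by omega)
    refine .of_eqOn hc fun x hx => ?_
    have := hc.mem x hx
    simp [hCs] at this
  | succ N ih =>
    intro κ _ φ X Cs L _ A c c' hN hA hL hX hc hc'
    by_cases hCs : Cs.card ≤ 1
    · exact .of_eqOn hc fun x hx => card_le_one.1 hCs _ (hc'.mem x hx) _ (hc.mem x hx)
    rcases X.eq_empty_or_nonempty with hX0 | ⟨x₀, hx₀⟩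
    · exact .of_eqOn hc fun x hx => by simp [hX0] at hx
    have hAne : A.Nonempty := by
      obtain ⟨y, hy, -⟩ := hA x₀ hx₀
      exact ⟨y, hy⟩
    have hr : Module.finrank (ZMod 2) L < A.card := by
      rw [← card_fiber_eq_finrank hX hL hc (hc.mem x₀ hx₀)]
      exact card_lt_of_linearIndepOn_edgeVec hAne (hc.indep _)
        fun e he => hA e (mem_fiber.1 he).1
    obtain ⟨v, hvA, hv⟩ := exists_card_filter_lt hX hr (by omega) hA
    set E := X.filter fun x => φ x v = 0 with hE
    set δ := X.filter fun x => φ x v = 1 with hδ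
    rcases δ.eq_empty_or_nonempty with hδ0 | ⟨e₀, he₀⟩
    · -- an isolated vertex is deleted
      refine ih (A := A.erase v) (L := L) (by have := card_erase_add_one hvA; omega)
        (fun x hx => ?_) hL hX hc hc'
      obtain ⟨y, hy, z, hz, hyz⟩ := hA x hx
      have hne : φ x ≠ 0 := (hc.indep (c x)).ne_zero (mem_coe.2 (mem_fiber.2 ⟨hx, rfl⟩))
      have hyz' : y ≠ z := by rintro rfl; exact hne (by rw [hyz, edgeVec_self])
      have h0 : φ x v ≠ 1 := by
        intro h1
        have : x ∈ δ := mem_filter.2 ⟨hx, h1⟩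
        rw [hδ0] at this
        exact notMem_empty _ this
      rw [hyz, edgeVec_apply] at h0
      refine ⟨y, mem_erase.2 ⟨?_, hy⟩, z, mem_erase.2 ⟨?_, hz⟩, hyz⟩
      · rintro rfl; simp [hyz'] at h0
      · rintro rfl; simp [hyz'.symm] at h0
    have hfin := finrank_vanishAt_add_one (hL e₀ (mem_filter.1 he₀).1) (mem_filter.1 he₀).2
    have hδcard : Cs.card ≤ δ.card := by
      rw [← sum_card_fiber (X := δ) (Cs := Cs) (c := c)
        fun x hx => hc.mem x (mem_filter.1 hx).1, card_eq_sum_ones]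
      refine sum_le_sum fun i hi => card_pos.2 ?_
      by_contra hne
      rw [not_nonempty_iff_eq_empty] at hne
      have hle : L ≤ vanishAt L v := by
        nth_rewrite 1 [← span_fiber_eq hX hL hc hi]
        rw [span_le]
        rintro _ ⟨e, he, rfl⟩
        have he' := mem_fiber.1 (mem_coe.1 he)
        refine ⟨hL e he'.1, (zmod_two_cases (φ e v)).resolve_right fun h1 => ?_⟩
        have : e ∈ fiber δ c i := mem_fiber.2 ⟨mem_filter.2 ⟨he'.1, h1⟩, he'.2⟩
        rw [hne] at this
        exact notMem_empty _ this
      have := Submodule.finrank_mono hle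
      omega
    obtain ⟨p, hp⟩ := Nat.exists_eq_add_of_le hδcard
    have hstar : IsStar φ X Cs L v E δ p := by
      refine ⟨hX, hL, fun x hx => ?_, fun e => ?_, fun e => ?_, hp, by omega, hfin⟩
      · obtain ⟨y, -, z, -, h⟩ := hA x hx
        exact ⟨y, z, h⟩
      · rw [hE, mem_filter]
      · rw [hδ, mem_filter]
    -- a common colour class is deleted
    have hshare : ∀ c c', IsIndepColoring (ZMod 2) φ X Cs c → IsIndepColoring (ZMod 2) φ X Cs c' →
        ∀ l ∈ Cs, fiber X c l = fiber X c' l → SwapEquiv (ZMod 2) φ X Cs c c' := by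
      intro c c' hc hc' l hl hcc
      set Z := fiber X c l with hZ
      have hZX : Z ⊆ X := filter_subset _ _
      have hsub : ∀ d, fiber X d l = Z → IsIndepColoring (ZMod 2) φ X Cs d →
          IsIndepColoring (ZMod 2) φ (X \ Z) (Cs.erase l) d := by
        intro d hdZ hd
        refine ⟨fun x hx => mem_erase.2 ⟨fun hxl => ?_, hd.mem x (mem_sdiff.1 hx).1⟩,
          (hd.mono sdiff_subset).indep⟩
        rw [mem_sdiff, ← hdZ, mem_fiber] at hx
        exact hx.2 ⟨hx.1, hxl⟩
      have hcl := card_erase_add_one hl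
      have h1 := ih (A := A) (L := L) (Cs := Cs.erase l) (by omega)
        (fun x hx => hA x (mem_sdiff.1 hx).1) (fun x hx => hL x (mem_sdiff.1 hx).1) (by
          rw [card_sdiff_of_subset hZX, card_fiber_eq_finrank hX hL hc hl, hX, ← hcl, add_mul,
            one_mul, Nat.add_sub_cancel]) (hsub c rfl hc) (hsub c' hcc.symm hc')
      have h2 := SwapEquiv.extend hl (hc.indep l) h1
      have key : ∀ d, fiber X d l = Z → ∀ x ∈ X, (if x ∈ Z then l else d x) = d x := by
        intro d hd x hx
        split_ifs with hxZ
        · rw [← hd, mem_fiber] at hxZ; exact hxZ.2.symm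
        · rfl
      have h3 := SwapEquiv.of_eqOn hc (key c rfl)
      have h4 := SwapEquiv.of_eqOn hc' (key c' hcc.symm)
      exact (h3.trans h2).trans h4.symm
    -- the colourings of `E` and `m` live on the vertex set `A.erase v`
    have hsame : ∀ m, IsPairing δ m → m.card = p → ∀ c c', IsPairLift φ X Cs E δ m c →
        IsPairLift φ X Cs E δ m c' → SwapEquiv (ZMod 2) φ X Cs c c' := by
      rintro m hm hmp c c' ⟨t, ht, hc⟩ ⟨t', ht', hc'⟩
      have htt' : SwapEquiv (ZMod 2) (extVec φ) (E.disjSum m) Cs t t' := by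
        refine ih (A := A.erase v) (L := vanishAt L v)
          (by have := card_erase_add_one hvA; omega) (fun x hx => ?_) (hstar.disjSum_mem hm)
          (hstar.card_disjSum hmp) ht ht'
        have hne : extVec φ x ≠ 0 := (ht.indep (t x)).ne_zero (mem_coe.2 (mem_fiber.2 ⟨hx, rfl⟩))
        obtain ⟨y, hy, z, hz, hyz⟩ : ∃ y ∈ A, ∃ z ∈ A, extVec φ x = edgeVec y z := by
          cases x with
          | inl e => exact hA e (hstar.left_subset (by simpa using hx))
          | inr s =>
            have hs : s ∈ m := by simpa using hx
            induction s with
            | _ a b =>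
              have hvert : ∀ a ∈ δ, ∃ y ∈ A, φ a = edgeVec v y := by
                intro a ha
                obtain ⟨haX, hav⟩ := (hstar.mem_right a).1 ha
                obtain ⟨y, hy, z, hz, hyz⟩ := hA a haX
                by_cases hvy : v = y
                · exact ⟨z, hz, by rw [hyz, hvy]⟩
                · by_cases hvz : v = z
                  · exact ⟨y, hy, by rw [hyz, hvz, edgeVec_comm]⟩
                  · rw [hyz, edgeVec_apply] at hav
                    simp [hvy, hvz] at hav
              obtain ⟨y, hy, hay⟩ := hvert a (hm.mem _ hs a (Sym2.mem_mk_left _ _))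
              obtain ⟨z, hz, hbz⟩ := hvert b (hm.mem _ hs b (Sym2.mem_mk_right _ _))
              exact ⟨y, hy, z, hz, by rw [extVec_inr, pairVec_mk, hay, hbz, edgeVec_add]⟩
        have h0 : extVec φ x v = 0 := (hstar.disjSum_mem hm x hx).2
        have hyz' : y ≠ z := by rintro rfl; exact hne (by rw [hyz, edgeVec_self])
        rw [hyz, edgeVec_apply] at h0
        refine ⟨y, mem_erase.2 ⟨?_, hy⟩, z, mem_erase.2 ⟨?_, hz⟩, hyz⟩
        · rintro rfl; simp [hyz'] at h0
        · rintro rfl; simp [hyz'.symm] at h0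
      clear ht'
      induction htt' generalizing c' with
      | refl => exact hstar.swapEquiv_of_isLift hm hmp ht hc hc'
      | tail _ hs ih' =>
        obtain ⟨d, d', hd, hd', hdd⟩ := hstar.exists_isLift_of_swapStep hshare hm hmp hs
        exact ((ih' _ hd).trans hdd).trans (hstar.swapEquiv_of_isLift hm hmp hs.2.1 hd' hc')
    have hpair : ∀ m m', IsRealized φ E δ Cs p m → IsRealized φ E δ Cs p m' → ∀ c c',
        IsPairLift φ X Cs E δ m c → IsPairLift φ X Cs E δ m' c' →
        SwapEquiv (ZMod 2) φ X Cs c c' := by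
      intro m m' hm hm' c c' hc hc'
      have hmm := pairStep_connected hstar.left_edge hstar.right_edge (by omega) hm hm'
      clear hm'
      induction hmm generalizing c' with
      | refl => exact hsame m hm.pairing hm.card c c' hc hc'
      | tail _ hs ih' =>
        obtain ⟨t, ht⟩ := hs.1.colorable
        obtain ⟨d, hd⟩ := hstar.exists_isLift' hs.1.pairing hs.1.card ht
        exact (ih' d ⟨t, ht, hd⟩).trans (hstar.swapEquiv_of_pairStep hsame hs ⟨t, ht, hd⟩ hc')
    obtain ⟨d, hd, hcd, hd2⟩ := hstar.exists_card_le_two hA hc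
    obtain ⟨d', hd', hcd', hd2'⟩ := hstar.exists_card_le_two hA hc'
    obtain ⟨m, hm, hdm⟩ := hstar.exists_isPairLift hd hd2
    obtain ⟨m', hm', hdm'⟩ := hstar.exists_isPairLift hd' hd2'
    exact (hcd.trans (hpair m m' hm hm' d d' hdm hdm')).trans hcd'.symm

end Connectivity

/-! ### Representation of cycle matroids -/

section Graphic

variable {V α : Type*} [DecidableEq V] {G : Graph V α} {φ : α → V → ZMod 2}

lemma exists_edgeVec (G : Graph V α) :
    ∃ φ : α → V → ZMod 2, ∀ e x y, G.IsLink e x y → φ e = edgeVec x y := by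
  classical
  refine ⟨fun e => if h : ∃ s : V × V, G.IsLink e s.1 s.2 then edgeVec h.choose.1 h.choose.2 else 0,
    fun e x y h => ?_⟩
  have hex : ∃ s : V × V, G.IsLink e s.1 s.2 := ⟨(x, y), h⟩
  dsimp only
  rw [dif_pos hex]
  rcases hex.choose_spec.eq_and_eq_or_eq_and_eq h with ⟨h1, h2⟩ | ⟨h1, h2⟩
  · rw [h1, h2]
  · rw [h1, h2, edgeVec_comm]

lemma sum_edgeVec_cycle {n : ℕ} (v : Fin (n + 1) → V) : ∑ i, edgeVec (v i) (v (i + 1)) = 0 := by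
  simp only [edgeVec]
  have h := Equiv.sum_comp (Equiv.addRight (1 : Fin (n + 1)))
    (fun i => (Pi.single (v i) 1 : V → ZMod 2))
  simp only [Equiv.coe_addRight] at h
  rw [sum_add_distrib, h]
  exact add_self_eq_zero' _

/-- The edge set of a cycle is obtained from the first return of a walk that never uses the same
edge twice in a row. -/
lemma exists_isCycleEdgeSet_of_walk {S : Set α} {x : ℕ → V} {e : ℕ → α} (heS : ∀ k, e k ∈ S)
    (hlink : ∀ k, G.IsLink (e k) (x k) (x (k + 1))) (hne : ∀ k, e (k + 1) ≠ e k)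
    (hrep : ∃ d, 0 < d ∧ ∃ i, x i = x (i + d)) : ∃ C ⊆ S, G.IsCycleEdgeSet C := by
  classical
  obtain ⟨hpos, i, hi⟩ := Nat.find_spec hrep
  have hmin : ∀ d, 0 < d → d < Nat.find hrep → ∀ i, x i ≠ x (i + d) := fun d hd hlt i hx =>
    Nat.find_min hrep hlt ⟨hd, i, hx⟩
  obtain ⟨n, hn⟩ : ∃ n, Nat.find hrep = n + 1 := ⟨Nat.find hrep - 1, by omega⟩
  rw [hn] at hi hmin
  have hinj : ∀ a b, a < b → b ≤ n → x (i + a) ≠ x (i + b) := by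
    intro a b hab hb
    have := hmin (b - a) (by omega) (by omega) (i + a)
    rwa [show i + a + (b - a) = i + b by omega] at this
  have einj : ∀ a b, a < b → b ≤ n → e (i + a) ≠ e (i + b) := by
    intro a b hab hb heq
    have h1 := hlink (i + a)
    rw [heq] at h1
    rcases h1.eq_and_eq_or_eq_and_eq (hlink (i + b)) with ⟨h2, -⟩ | ⟨h2, h3⟩
    · exact hinj a b hab hb h2
    · have hb' : b = n := by
        by_contra hbn
        exact hinj a (b + 1) (by omega) (by omega) h2
      have ha' : a + 1 = b := by
        by_contra hab'
        exact hinj (a + 1) b (by omega) hb h3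
      have ha0 : a = 0 := by
        by_contra ha0
        refine hinj 0 a (by omega) (by omega) ?_
        rw [h2, hb', add_zero, hi, ← add_assoc]
      subst ha0
      rw [← ha'] at heq
      exact hne (i + 0) heq.symm
  refine ⟨Set.range fun k : Fin (n + 1) => e (i + k), ?_, n, fun k => x (i + k),
    fun k => e (i + k), ?_, ?_, fun k => ?_, rfl⟩
  · rintro _ ⟨k, rfl⟩; exact heS _
  · intro a b hab
    rcases lt_trichotomy (a : ℕ) b with h | h | h
    · exact absurd hab (hinj a b h (by omega))
    · exact Fin.ext h
    · exact absurd hab.symm (hinj b a h (by omega))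
  · intro a b hab
    rcases lt_trichotomy (a : ℕ) b with h | h | h
    · exact absurd hab (einj a b h (by omega))
    · exact Fin.ext h
    · exact absurd hab.symm (einj b a h (by omega))
  · have h1 := hlink (i + k)
    dsimp only
    rw [Fin.val_add_one]
    split_ifs with hk
    · rw [hk, Fin.val_last] at h1 ⊢
      rw [add_zero, hi]
      exact h1
    · exact h1

/-- A nonempty set of edges whose vectors sum to zero has only even degrees, hence contains a
cycle. -/
lemma exists_isCycleEdgeSet_of_sum_eq_zero (hφ : ∀ e x y, G.IsLink e x y → φ e = edgeVec x y)
    (hV : G.vertexSet.Finite) {S : Finset α} (hS : S.Nonempty) (hSE : (S : Set α) ⊆ G.edgeSet)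
    (hsum : ∑ e ∈ S, φ e = 0) : ∃ C ⊆ (S : Set α), G.IsCycleEdgeSet C := by
  by_cases hloop : ∃ e ∈ S, ∃ x, G.IsLink e x x
  · obtain ⟨e, he, x, hx⟩ := hloop
    exact ⟨{e}, by simpa using he, 0, fun _ => x, fun _ => e,
      fun a b _ => Subsingleton.elim (α := Fin 1) a b,
      fun a b _ => Subsingleton.elim (α := Fin 1) a b, fun _ => hx, by simp⟩
  push Not at hloop
  have step : ∀ e ∈ S, ∀ y x, G.IsLink e y x → ∃ f ∈ S, f ≠ e ∧ ∃ z, G.IsLink f x z := by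
    intro e he y x hyx
    have hxy : x ≠ y := by rintro rfl; exact hloop e he _ hyx
    have h1 : φ e x = 1 := by rw [hφ e y x hyx, edgeVec_apply]; simp [hxy]
    obtain ⟨f, hf, hfe, hfx⟩ : ∃ f ∈ S, f ≠ e ∧ φ f x ≠ 0 := by
      by_contra! hcon
      have h2 := congrFun hsum x
      rw [Finset.sum_apply, sum_eq_single_of_mem e he fun f hf hfe => hcon f hf hfe, h1] at h2
      exact one_ne_zero h2
    obtain ⟨a, b, hab⟩ := G.exists_isLink_of_mem_edgeSet (hSE hf)
    refine ⟨f, hf, hfe, ?_⟩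
    rw [hφ f a b hab, edgeVec_apply] at hfx
    by_cases hxa : x = a
    · exact ⟨b, hxa ▸ hab⟩
    · by_cases hxb : x = b
      · exact ⟨a, hxb ▸ hab.symm⟩
      · simp [hxa, hxb] at hfx
  let T := {s : V × α // s.2 ∈ S ∧ ∃ y, G.IsLink s.2 y s.1}
  have hnext : ∀ s : T, ∃ s' : T, G.IsLink s'.1.2 s.1.1 s'.1.1 ∧ s'.1.2 ≠ s.1.2 := by
    rintro ⟨⟨x, e⟩, he, y, hyx⟩
    obtain ⟨f, hf, hfe, z, hz⟩ := step e he y x hyx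
    exact ⟨⟨(z, f), hf, x, hz⟩, hz, hfe⟩
  choose next hlink hne using hnext
  obtain ⟨e₀, he₀⟩ := hS
  obtain ⟨y₀, x₀, hx₀⟩ := G.exists_isLink_of_mem_edgeSet (hSE he₀)
  let s : ℕ → T := fun k => next^[k] ⟨(x₀, e₀), he₀, y₀, hx₀⟩
  have hs : ∀ k, s (k + 1) = next (s k) := fun k => Function.iterate_succ_apply' _ _ _
  refine exists_isCycleEdgeSet_of_walk (x := fun k => (s k).1.1) (e := fun k => (s (k + 1)).1.2)
    (fun k => (s (k + 1)).2.1) (fun k => ?_) (fun k => ?_) ?_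
  · have := hlink (s k)
    rwa [← hs] at this
  · have := hne (s (k + 1))
    rwa [← hs] at this
  · obtain ⟨a, b, hab, heq⟩ := Set.Finite.exists_lt_map_eq_of_forall_mem
      (f := fun k => (s k).1.1) (t := G.vertexSet)
      (fun k => by obtain ⟨y, hy⟩ := (s k).2.2; exact hy.right_mem) hV
    exact ⟨b - a, by omega, a, by rw [Nat.add_sub_cancel' hab.le]; exact heq⟩

/-- Cycle matroids are represented over `ZMod 2` by the incidence vectors of the edges. -/
lemma indep_iff_linearIndepOn {M : Matroid α} (hM : M.IsCycleMatroidOf G)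
    (hV : G.vertexSet.Finite) (hφ : ∀ e x y, G.IsLink e x y → φ e = edgeVec x y) {I : Finset α}
    (hI : (I : Set α) ⊆ M.E) : M.Indep I ↔ LinearIndepOn (ZMod 2) φ (I : Set α) := by
  classical
  rw [Matroid.indep_iff_forall_subset_not_isCircuit hI]
  constructor
  · intro hC
    rw [linearIndepOn_finset_iff]
    intro g hg i hi
    by_contra hgi
    have hsum : ∑ e ∈ I.filter (fun e => g e = 1), φ e = 0 := by
      rw [← hg, sum_filter]
      refine sum_congr rfl fun e _ => ?_
      rcases zmod_two_cases (g e) with h | h <;> simp [h]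
    obtain ⟨C, hCI, hcyc⟩ := exists_isCycleEdgeSet_of_sum_eq_zero hφ hV
      ⟨i, mem_filter.2 ⟨hi, (zmod_two_cases (g i)).resolve_left hgi⟩⟩
      (fun e he => hM.1 ▸ hI (mem_filter.1 he).1) hsum
    exact hC C (fun e he => (mem_filter.1 (hCI he)).1) ((hM.2 C).2 hcyc)
  · intro hlin C hCI hC
    obtain ⟨n, v, e, -, hinj, hlink, rfl⟩ := (hM.2 C).1 hC
    have hlin' := hlin.mono hCI
    have h2 : LinearIndependent (ZMod 2) (φ ∘ e) := by
      have := LinearIndepOn.comp_of_image (s := Set.univ) (f := e) (v := φ)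
        (by rwa [Set.image_univ]) hinj.injOn
      exact linearIndepOn_univ_iff.1 this
    have h3 := Fintype.linearIndependent_iff.1 h2 (fun _ => 1) (by
      rw [← sum_edgeVec_cycle v]
      exact sum_congr rfl fun i _ => by rw [one_smul]; exact hφ _ _ _ (hlink i)) 0
    exact one_ne_zero h3

end Graphic

/-! ### Sequences of bases as colourings -/

section Represented

variable {W α : Type*} [AddCommGroup W] {K : Type*} [Field K] [Module K W] {M : Matroid α}
  {φ : α → W} {n : ℕ}

/-- The vectors `φ x` represent `M` over `K`. Only finite sets are tested, which suffices if the
ground set is finite. -/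
def IsRep (K : Type*) [Field K] [Module K W] (M : Matroid α) (φ : α → W) : Prop :=
  ∀ I : Finset α, (I : Set α) ⊆ M.E → (M.Indep I ↔ LinearIndepOn K φ (I : Set α))

lemma IsRep.span_eq [DecidableEq α] (h : IsRep K M φ) {B : Finset α} (hB : M.IsBase B) :
    span K (φ '' (B : Set α)) = span K (φ '' M.E) := by
  refine le_antisymm (span_mono (Set.image_mono hB.subset_ground)) (span_le.2 ?_)
  rintro _ ⟨x, hx, rfl⟩
  by_cases hxB : x ∈ B
  · exact subset_span ⟨x, hxB, rfl⟩
  by_contra hspan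
  have hins : ((insert x B : Finset α) : Set α) ⊆ M.E := by
    rw [coe_insert]; exact Set.insert_subset hx hB.subset_ground
  have hind : M.Indep ((insert x B : Finset α) : Set α) := by
    rw [h _ hins, coe_insert]
    exact ((h B hB.subset_ground).1 hB.indep).insert hspan
  have heq := hB.eq_of_subset_indep hind (by simp)
  have : x ∈ (B : Set α) := by rw [heq]; simp
  exact hxB this

lemma IsRep.isBase [DecidableEq α] (h : IsRep K M φ) {B : Finset α} (hBE : (B : Set α) ⊆ M.E)
    (hB : LinearIndepOn K φ (B : Set α)) (hspan : span K (φ '' (B : Set α)) = span K (φ '' M.E)) :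
    M.IsBase B := by
  refine ((h B hBE).2 hB).isBase_of_forall_insert fun e he hind => ?_
  have hins : insert e (B : Set α) = ((insert e B : Finset α) : Set α) := by simp
  rw [hins, h _ (by rw [← hins]; exact Set.insert_subset he.1 hBE), ← hins] at hind
  refine hind.notMem_span (Set.mem_insert e _) ?_
  rw [Set.insert_sdiff_of_mem _ (Set.mem_singleton e), Set.sdiff_singleton_eq_self he.2, hspan]
  exact subset_span ⟨e, he.1, rfl⟩

/-- The elements of colour `j`, where `X` consists of elements of the matroid with labels that
distinguish several copies of the same element. -/
abbrev colorClass [DecidableEq α] (X : Finset (α × Fin n)) (c : α × Fin n → Fin n) (j : Fin n) :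
    Finset α := (fiber X c j).image Prod.fst

variable [DecidableEq α] {X : Finset (α × Fin n)} {c c' : α × Fin n → Fin n}

lemma injOn_fst_fiber (hc : IsIndepColoring K (φ ∘ Prod.fst) X univ c) (j : Fin n) :
    Set.InjOn Prod.fst (fiber X c j : Set (α × Fin n)) :=
  fun _ hx _ hy hxy => (hc.indep j).injOn hx hy (congrArg φ hxy)

lemma IsRep.isBase_colorClass (h : IsRep K M φ) [FiniteDimensional K (span K (φ '' M.E))]
    (hXE : ∀ x ∈ X, x.1 ∈ M.E)
    (hX : X.card = n * Module.finrank K (span K (φ '' M.E)))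
    (hc : IsIndepColoring K (φ ∘ Prod.fst) X univ c) (j : Fin n) :
    M.IsBase (colorClass X c j : Set α) := by
  refine h.isBase ?_ ?_ ?_
  · rw [coe_image]
    rintro _ ⟨x, hx, rfl⟩
    exact hXE x (mem_fiber.1 hx).1
  · rw [coe_image]
    exact LinearIndepOn.image_of_comp _ _ (hc.indep j)
  · rw [coe_image, ← Set.image_comp]
    exact span_fiber_eq (L := span K (φ '' M.E)) (by simpa using hX)
      (fun x hx => subset_span ⟨x.1, hXE x hx, rfl⟩) hc (mem_univ j)

/-- A swap of colours induces a symmetric exchange of the bases formed by the colour classes. -/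
lemma symmExchange_of_swapStep {B D : M.BaseSeq n}
    (hB : ∀ j, (B j : Set α) = colorClass X c j) (hD : ∀ j, (D j : Set α) = colorClass X c' j)
    (hstep : SwapStep K (φ ∘ Prod.fst) X univ c c') : B = D ∨ Matroid.SymmExchange B D := by
  obtain ⟨hc, hc', hor⟩ := hstep
  have same : (∀ x ∈ X, c' x = c x) → B = D := by
    intro heq
    funext j
    apply Subtype.ext
    rw [hB, hD, colorClass, colorClass, fiber_congr heq]
  rcases hor with heq | ⟨e, he, f, hf, hef⟩
  · exact Or.inl (same heq)
  by_cases hcef : c e = c f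
  · refine Or.inl (same fun x hx => ?_)
    rw [hef x hx]
    by_cases hxe : x = e
    · rw [hxe, Equiv.swap_apply_left, hcef]
    · by_cases hxf : x = f
      · rw [hxf, Equiv.swap_apply_right, hcef]
      · rw [Equiv.swap_apply_of_ne_of_ne hxe hxf]
  have hx : ∀ x ∈ X, x ≠ e → x ≠ f → c' x = c x := fun x hx h1 h2 => by
    rw [hef x hx, Equiv.swap_apply_of_ne_of_ne h1 h2]
  have he' : c' e = c f := by rw [hef e he, Equiv.swap_apply_left]
  have hf' : c' f = c e := by rw [hef f hf, Equiv.swap_apply_right]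
  have key : ∀ {e f : α × Fin n}, e ∈ X → f ∈ X → c e ≠ c f → c' e = c f → c' f = c e →
      (∀ x ∈ X, x ≠ e → x ≠ f → c' x = c x) →
      (D (c e) : Set α) = insert f.1 ((B (c e) : Set α) \ {e.1}) := by
    intro e f he hf hef he' hf' hx
    have hinj := injOn_fst_fiber hc (c e)
    rw [hB, hD]
    ext y
    simp only [colorClass, coe_image, Set.mem_image, mem_coe, mem_fiber, Set.mem_insert_iff,
      Set.mem_sdiff, Set.mem_singleton_iff]
    constructor
    · rintro ⟨x, ⟨hxX, hxe⟩, rfl⟩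
      by_cases hxf : x = f
      · exact Or.inl (by rw [hxf])
      · have hxe' : x ≠ e := by rintro rfl; exact hef (hxe.symm.trans he')
        rw [hx x hxX hxe' hxf] at hxe
        exact Or.inr ⟨⟨x, ⟨hxX, hxe⟩, rfl⟩, fun heq => hxe'
          (hinj (mem_coe.2 (mem_fiber.2 ⟨hxX, hxe⟩)) (mem_coe.2 (mem_fiber.2 ⟨he, rfl⟩)) heq)⟩
    · rintro (rfl | ⟨⟨x, ⟨hxX, hxe⟩, rfl⟩, hne⟩)
      · exact ⟨f, ⟨hf, hf'⟩, rfl⟩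
      · have hxe' : x ≠ e := by rintro rfl; exact hne rfl
        have hxf : x ≠ f := by rintro rfl; exact hef hxe.symm
        exact ⟨x, ⟨hxX, (hx x hxX hxe' hxf).trans hxe⟩, rfl⟩
  refine Or.inr ⟨c e, c f, hcef, ⟨(B _).2, (B _).2, (D _).2, (D _).2, e.1, ?_, f.1, ?_, ?_, ?_⟩, ?_⟩
  · rw [hB, coe_image]; exact ⟨e, mem_coe.2 (mem_fiber.2 ⟨he, rfl⟩), rfl⟩
  · rw [hB, coe_image]; exact ⟨f, mem_coe.2 (mem_fiber.2 ⟨hf, rfl⟩), rfl⟩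
  · exact key he hf hcef he' hf' hx
  · exact key hf he (Ne.symm hcef) hf' he' fun x hxX h1 h2 => hx x hxX h2 h1
  · intro k hke hkf
    apply Subtype.ext
    rw [hB, hD, colorClass, colorClass]
    congr 2
    ext x
    rw [mem_fiber, mem_fiber]
    refine and_congr_right fun hxX => ?_
    by_cases hxe : x = e
    · rw [hxe, he']; exact ⟨fun h => absurd h.symm hkf, fun h => absurd h.symm hke⟩
    · by_cases hxf : x = f
      · rw [hxf, hf']; exact ⟨fun h => absurd h.symm hke, fun h => absurd h.symm hkf⟩
      · rw [hx x hxX hxe hxf]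

lemma IsRep.rel₁_of_swapEquiv (h : IsRep K M φ) [FiniteDimensional K (span K (φ '' M.E))]
    (hXE : ∀ x ∈ X, x.1 ∈ M.E) (hX : X.card = n * Module.finrank K (span K (φ '' M.E)))
    {B D : M.BaseSeq n}
    (hB : ∀ j, (B j : Set α) = colorClass X c j) (hD : ∀ j, (D j : Set α) = colorClass X c' j)
    (hcc : SwapEquiv K (φ ∘ Prod.fst) X univ c c') : Matroid.Rel₁ B D := by
  induction hcc generalizing D with
  | refl =>
    have : B = D := funext fun j => Subtype.ext ((hB j).trans (hD j).symm)
    rw [this]; exact .refl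
  | tail _ hs ih =>
    have hD₁ := ih (D := fun j => ⟨_, h.isBase_colorClass hXE hX hs.1 j⟩) (fun _ => rfl)
    rcases symmExchange_of_swapStep (B := fun j => ⟨_, h.isBase_colorClass hXE hX hs.1 j⟩)
      (fun _ => rfl) hD hs with heq | hex
    · rwa [heq] at hD₁
    · exact hD₁.tail hex

lemma exists_perm_of_ncard_eq {p q : Fin n → Prop} (h : {i | p i}.ncard = {i | q i}.ncard) :
    ∃ σ : Equiv.Perm (Fin n), ∀ i, p i ↔ q (σ i) := by
  classical
  have hcard : Fintype.card {i // p i} = Fintype.card {i // q i} := by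
    rw [← Nat.card_eq_fintype_card, ← Nat.card_eq_fintype_card]
    exact h
  let e := Fintype.equivOfCardEq hcard
  refine ⟨e.extendSubtype, fun i => ⟨e.extendSubtype_mem i, fun hq => ?_⟩⟩
  by_contra hp
  exact e.extendSubtype_not_mem i hp hq

end Represented

open Matroid in
/-- The colours of a labelled element `(x, i)` are `i` for the sequence `B`, and `β x i` for the
sequence `D`, where `β x` maps the positions of `x` in `B` to those in `D`. -/
theorem rel₁_of_graphical {α : Type*} {M : Matroid α} (hE : M.E.Finite) (hM : M.Graphical) {n : ℕ}
    {B D : M.BaseSeq n} (hBD : Compatible B D) : Rel₁ B D := by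
  classical
  obtain ⟨V, G, hV, hMG⟩ := hM
  obtain ⟨φ, hφ⟩ := exists_edgeVec G
  have hrep : IsRep (ZMod 2) M φ := fun I hI => indep_iff_linearIndepOn hMG hV hφ hI
  have : FiniteDimensional (ZMod 2) (span (ZMod 2) (φ '' M.E)) :=
    FiniteDimensional.span_of_finite _ (hE.image φ)
  -- an element that occurs in several bases is represented by several labelled copies
  set X : Finset (α × Fin n) :=
    (hE.toFinset ×ˢ univ).filter fun x => x.1 ∈ (B x.2 : Set α) with hXdef
  have memX : ∀ x : α × Fin n, x ∈ X ↔ x.1 ∈ (B x.2 : Set α) := by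
    intro x
    rw [hXdef, mem_filter, mem_product, Set.Finite.mem_toFinset]
    exact ⟨fun h => h.2, fun h => ⟨⟨(B x.2).2.subset_ground h, mem_univ _⟩, h⟩⟩
  have hXE : ∀ x ∈ X, x.1 ∈ M.E := fun x hx => (B x.2).2.subset_ground ((memX x).1 hx)
  choose β hβ using fun x : α => exists_perm_of_ncard_eq (hBD x)
  have hcol : ∀ (D : M.BaseSeq n) (c : α × Fin n → Fin n),
      (∀ x i, (x, i) ∈ X → x ∈ (D (c (x, i)) : Set α)) →
      (∀ x, Function.Injective fun i => c (x, i)) →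
      IsIndepColoring (ZMod 2) (φ ∘ Prod.fst) X univ c := by
    intro D c h1 h2
    refine ⟨fun _ _ => mem_univ _, fun j => ?_⟩
    have hfin := hE.subset (D j).2.subset_ground
    have hD : LinearIndepOn (ZMod 2) φ (D j : Set α) := by
      have := (hrep hfin.toFinset (by simpa using (D j).2.subset_ground)).1
        (by simpa using (D j).2.indep)
      simpa using this
    refine LinearIndepOn.comp_of_image (hD.mono ?_) ?_
    · rintro _ ⟨⟨x, i⟩, hx, rfl⟩
      obtain ⟨hxX, hxj⟩ := mem_fiber.1 (mem_coe.1 hx)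
      have := h1 x i hxX
      rwa [hxj] at this
    · rintro ⟨x, i⟩ hx ⟨y, k⟩ hy (rfl : x = y)
      have h3 := (mem_fiber.1 (mem_coe.1 hx)).2.trans (mem_fiber.1 (mem_coe.1 hy)).2.symm
      rw [h2 x h3]
  have hclass : ∀ (D : M.BaseSeq n) (c : α × Fin n → Fin n),
      (∀ x i, (x, i) ∈ X → x ∈ (D (c (x, i)) : Set α)) →
      (∀ x j, x ∈ (D j : Set α) → ∃ i, (x, i) ∈ X ∧ c (x, i) = j) →
      ∀ j, (D j : Set α) = colorClass X c j := by
    intro D c h1 h2 j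
    ext x
    simp only [colorClass, coe_image, Set.mem_image, mem_coe, mem_fiber]
    constructor
    · intro hx
      obtain ⟨i, hi, hij⟩ := h2 x j hx
      exact ⟨(x, i), ⟨hi, hij⟩, rfl⟩
    · rintro ⟨⟨y, i⟩, ⟨hy, rfl⟩, rfl⟩
      exact h1 y i hy
  have h1 : ∀ x i, (x, i) ∈ X → x ∈ (B i : Set α) := fun x i hx => (memX _).1 hx
  have h2 : ∀ x i, (x, i) ∈ X → x ∈ (D (β x i) : Set α) := fun x i hx =>
    (hβ x i).1 ((memX _).1 hx)
  have hB := hclass B (fun x => x.2) h1 fun x j hx => ⟨j, (memX _).2 hx, rfl⟩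
  have hD := hclass D (fun x => β x.1 x.2) h2 fun x j hx => by
    refine ⟨(β x).symm j, (memX _).2 ((hβ x _).2 ?_), ?_⟩ <;> simp [hx]
  have hcB := hcol B (fun x => x.2) h1 fun x => Function.injective_id
  have hcD := hcol D (fun x => β x.1 x.2) h2 fun x => (β x).injective
  have hX : X.card = n * Module.finrank (ZMod 2) (span (ZMod 2) (φ '' M.E)) := by
    rw [← sum_card_fiber hcB.mem]
    have : ∀ j ∈ (univ : Finset (Fin n)), (fiber X (fun x => x.2) j).card =
        Module.finrank (ZMod 2) (span (ZMod 2) (φ '' M.E)) := by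
      intro j _
      have hbase : M.IsBase (colorClass X (fun x => x.2) j : Set α) := by
        rw [← hB]; exact (B j).2
      rw [← card_image_of_injOn (injOn_fst_fiber hcB j), ← hrep.span_eq hbase]
      refine le_antisymm (card_le_finrank ?_ fun e he => subset_span ⟨e, he, rfl⟩)
        (finrank_span_image_le _)
      exact (hrep _ hbase.subset_ground).1 hbase.indep
    rw [sum_congr rfl this, sum_const, card_univ, Fintype.card_fin, smul_eq_mul]
  refine hrep.rel₁_of_swapEquiv hXE hX hB hD ?_
  refine swapEquiv_of_edgeVec _ (A := hV.toFinset) (L := span (ZMod 2) (φ '' M.E)) le_rfl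
    (fun x hx => ?_) (fun x hx => subset_span ⟨x.1, hXE x hx, rfl⟩) (by simpa using hX) hcB hcD
  obtain ⟨y, z, hyz⟩ := G.exists_isLink_of_mem_edgeSet (hMG.1 ▸ hXE x hx)
  exact ⟨y, by simpa using hyz.left_mem, z, by simpa using hyz.right_mem, hφ _ _ _ hyz⟩

end BaseExchange

/-! ### Symmetric exchanges, duality and direct sums -/

namespace Matroid

variable {α : Type*} {M : Matroid α} {n : ℕ} {B D : M.BaseSeq n}

section Exchange

lemma IsBase.notMem_of_insert_sdiff {B : Set α} (hB : M.IsBase B) {e f : α} (he : e ∈ B)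
    (h : M.IsBase (insert f (B \ {e}))) (hne : e ≠ f) : f ∉ B := by
  intro hf
  rw [Set.insert_eq_of_mem (show f ∈ B \ {e} from ⟨hf, hne.symm⟩)] at h
  have := h.eq_of_subset_isBase hB Set.sdiff_subset
  have he' : e ∈ B \ {e} := by rw [this]; exact he
  exact he'.2 rfl

lemma DoubleSwap.eq_or_notMem {B₁ B₂ D₁ D₂ : Set α} (h : M.DoubleSwap B₁ B₂ D₁ D₂) :
    (D₁ = B₁ ∧ D₂ = B₂) ∨ ∃ e ∈ B₁, ∃ f ∈ B₂, f ∉ B₁ ∧ e ∉ B₂ ∧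
      D₁ = insert f (B₁ \ {e}) ∧ D₂ = insert e (B₂ \ {f}) := by
  obtain ⟨hB₁, hB₂, hD₁, hD₂, e, he, f, hf, rfl, rfl⟩ := h
  by_cases hef : e = f
  · subst hef
    left; simp [Set.insert_eq_of_mem he, Set.insert_eq_of_mem hf]
  · exact Or.inr ⟨e, he, f, hf, hB₁.notMem_of_insert_sdiff he hD₁ hef,
      hB₂.notMem_of_insert_sdiff hf hD₂ (Ne.symm hef), rfl, rfl⟩

lemma SymmExchange.symm (h : SymmExchange B D) : SymmExchange D B := by
  obtain ⟨i, j, hij, hs, hk⟩ := h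
  refine ⟨i, j, hij, ?_, fun k hi hj => (hk k hi hj).symm⟩
  rcases hs.eq_or_notMem with ⟨h1, h2⟩ | ⟨e, he, f, hf, hf', he', h1, h2⟩
  · rw [h1, h2] at hs ⊢; exact hs
  · refine ⟨(D i).2, (D j).2, (B i).2, (B j).2, f, by simp [h1], e, by simp [h2], ?_, ?_⟩
    · rw [h1]; ext x; by_cases hx : x = e <;> by_cases hx' : x = f <;> simp_all
    · rw [h2]; ext x; by_cases hx : x = e <;> by_cases hx' : x = f <;> simp_all

lemma Rel₁.symm (h : Rel₁ B D) : Rel₁ D B := by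
  induction h with
  | refl => exact .refl
  | tail _ hs ih => exact ih.head hs.symm

lemma Rel₁.rel₂ (h : Rel₁ B D) : Rel₂ B D :=
  Relation.ReflTransGen.mono (fun _ _ => Or.inl) _ _ h

lemma Rel₁.comp (h : Rel₁ B D) (σ : Equiv.Perm (Fin n)) : Rel₁ (B ∘ σ) (D ∘ σ) := by
  refine Relation.ReflTransGen.lift (p := SymmExchange) (fun X : M.BaseSeq n => X ∘ σ)
    (fun X Y hXY => ?_) _ _ h
  obtain ⟨i, j, hij, hs, hk⟩ := hXY
  refine ⟨σ.symm i, σ.symm j, by simpa using hij, by simpa using hs, fun k hi hj => ?_⟩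
  exact hk (σ k) (fun h => hi (by simp [← h])) (fun h => hj (by simp [← h]))

end Exchange

section Dual

/-- The complements of the members of a sequence of bases of `M✶`. -/
def complSeq (B : M✶.BaseSeq n) : M.BaseSeq n :=
  fun i => ⟨M.E \ (B i : Set α), (dual_isBase_iff (M := M) (B i).2.subset_ground).1 (B i).2⟩

lemma complSeq_symmExchange {B D : M✶.BaseSeq n} (h : SymmExchange B D) :
    complSeq B = complSeq D ∨ SymmExchange (complSeq B) (complSeq D) := by
  obtain ⟨i, j, hij, hs, hk⟩ := h
  rcases hs.eq_or_notMem with ⟨h1, h2⟩ | ⟨e, he, f, hf, hf', he', h1, h2⟩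
  · left
    funext k
    apply Subtype.ext
    by_cases hki : k = i
    · subst hki; simp [complSeq, h1]
    · by_cases hkj : k = j
      · subst hkj; simp [complSeq, h2]
      · simp [complSeq, hk k hki hkj]
  · have heE : e ∈ M.E := (B i).2.subset_ground he
    have hfE : f ∈ M.E := (B j).2.subset_ground hf
    refine Or.inr ⟨i, j, hij, ⟨Subtype.prop _, Subtype.prop _, Subtype.prop _, Subtype.prop _,
      f, ⟨hfE, hf'⟩, e, ⟨heE, he'⟩, ?_, ?_⟩, fun k hki hkj => ?_⟩
    · simp only [complSeq, h1]
      ext x; by_cases hx : x = e <;> by_cases hx' : x = f <;> simp_all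
    · simp only [complSeq, h2]
      ext x; by_cases hx : x = e <;> by_cases hx' : x = f <;> simp_all
    · simp [complSeq, hk k hki hkj]

lemma rel₁_of_dual (h : ∀ B D : M✶.BaseSeq n, Compatible B D → Rel₁ B D)
    (hBD : Compatible B D) : Rel₁ B D := by
  let f : M.BaseSeq n → M✶.BaseSeq n := fun B i => ⟨M.E \ B i, (B i).2.compl_isBase_dual⟩
  have hf : ∀ B : M.BaseSeq n, complSeq (f B) = B := fun B => funext fun i =>
    Subtype.ext (Set.sdiff_sdiff_cancel_left (B i).2.subset_ground)
  have hcomp : Compatible (f B) (f D) := by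
    intro x
    by_cases hx : x ∈ M.E
    · have key : ∀ B : M.BaseSeq n, {i | x ∈ (f B i : Set α)} = {i | x ∈ (B i : Set α)}ᶜ := by
        intro B; ext i; simp [f, hx]
      rw [key, key, Set.ncard_compl, Set.ncard_compl, hBD x]
    · simp [f, hx]
  rw [← hf B, ← hf D]
  have h1 := h _ _ hcomp
  generalize f B = B' at h1 ⊢
  generalize f D = D' at h1 ⊢
  induction h1 with
  | refl => exact .refl
  | tail _ hs ih =>
    rcases complSeq_symmExchange hs with heq | hex
    · rwa [heq] at ih
    · exact Relation.ReflTransGen.tail ih hex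

end Dual

section Sum

variable {β : Type*} {N : Matroid β}

/-- The traces of a sequence of bases of a direct sum on the left summand. -/
def leftSeq (B : (M.sum N).BaseSeq n) : M.BaseSeq n :=
  fun i => ⟨Sum.inl ⁻¹' (B i : Set (α ⊕ β)), (sum_isBase_iff.1 (B i).2).1⟩

/-- The traces of a sequence of bases of a direct sum on the right summand. -/
def rightSeq (B : (M.sum N).BaseSeq n) : N.BaseSeq n :=
  fun i => ⟨Sum.inr ⁻¹' (B i : Set (α ⊕ β)), (sum_isBase_iff.1 (B i).2).2⟩

/-- A symmetric exchange in a direct sum takes place in one of the summands. -/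
lemma rel₁_of_symmExchange_sum {B D : (M.sum N).BaseSeq n} (h : SymmExchange B D) :
    Rel₁ (leftSeq B) (leftSeq D) ∧ Rel₁ (rightSeq B) (rightSeq D) := by
  obtain ⟨i, j, hij, ⟨-, -, -, -, e, he, f, hf, h1, h2⟩, hk⟩ := h
  have bases : ∀ i, M.IsBase (Sum.inl ⁻¹' (B i : Set (α ⊕ β))) ∧
      N.IsBase (Sum.inr ⁻¹' (B i : Set (α ⊕ β))) := fun i => sum_isBase_iff.1 (B i).2
  have bases' : ∀ i, M.IsBase (Sum.inl ⁻¹' (D i : Set (α ⊕ β))) ∧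
      N.IsBase (Sum.inr ⁻¹' (D i : Set (α ⊕ β))) := fun i => sum_isBase_iff.1 (D i).2
  have hkl : ∀ k, k ≠ i → k ≠ j → leftSeq D k = leftSeq B k := fun k hi hj => by
    simp only [leftSeq, hk k hi hj]
  have hkr : ∀ k, k ≠ i → k ≠ j → rightSeq D k = rightSeq B k := fun k hi hj => by
    simp only [rightSeq, hk k hi hj]
  rcases e with e | e <;> rcases f with f | f
  · constructor
    · refine .single ⟨i, j, hij, ⟨(bases i).1, (bases j).1, (bases' i).1, (bases' j).1,
        e, he, f, hf, ?_, ?_⟩, hkl⟩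
      · simp only [leftSeq, h1]; ext x; simp
      · simp only [leftSeq, h2]; ext x; simp
    · have : rightSeq B = rightSeq D := by
        funext k
        by_cases hki : k = i
        · subst hki; apply Subtype.ext; simp only [rightSeq, h1]; ext x; simp
        · by_cases hkj : k = j
          · subst hkj; apply Subtype.ext; simp only [rightSeq, h2]; ext x; simp
          · exact (hkr k hki hkj).symm
      rw [this]; exact .refl
  · have h3 := (bases' i).1
    rw [h1] at h3
    have h4 := h3.eq_of_subset_isBase (bases i).1 (fun x hx => by
      simp at hx; exact hx.1)
    have h5 : e ∈ Sum.inl ⁻¹' (B i : Set (α ⊕ β)) := he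
    rw [← h4] at h5
    simp at h5
  · have h3 := (bases' i).2
    rw [h1] at h3
    have h4 := h3.eq_of_subset_isBase (bases i).2 (fun x hx => by
      simp at hx; exact hx.1)
    have h5 : e ∈ Sum.inr ⁻¹' (B i : Set (α ⊕ β)) := he
    rw [← h4] at h5
    simp at h5
  · constructor
    · have : leftSeq B = leftSeq D := by
        funext k
        by_cases hki : k = i
        · subst hki; apply Subtype.ext; simp only [leftSeq, h1]; ext x; simp
        · by_cases hkj : k = j
          · subst hkj; apply Subtype.ext; simp only [leftSeq, h2]; ext x; simp
          · exact (hkl k hki hkj).symm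
      rw [this]; exact .refl
    · refine .single ⟨i, j, hij, ⟨(bases i).2, (bases j).2, (bases' i).2, (bases' j).2,
        e, he, f, hf, ?_, ?_⟩, hkr⟩
      · simp only [rightSeq, h1]; ext x; simp
      · simp only [rightSeq, h2]; ext x; simp

/-- In a direct sum, the same permutation is applied to the traces on both summands. -/
lemma exists_perm_of_rel₂_sum {B D : (M.sum N).BaseSeq n} (h : Rel₂ B D) :
    ∃ σ : Equiv.Perm (Fin n), Rel₁ (leftSeq B ∘ σ) (leftSeq D) ∧
      Rel₁ (rightSeq B ∘ σ) (rightSeq D) := by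
  induction h with
  | refl => exact ⟨1, .refl, .refl⟩
  | tail _ hs ih =>
    obtain ⟨σ, h1, h2⟩ := ih
    rcases hs with hs | ⟨τ, rfl⟩
    · obtain ⟨h3, h4⟩ := rel₁_of_symmExchange_sum hs
      exact ⟨σ, h1.trans h3, h2.trans h4⟩
    · exact ⟨σ * τ, h1.comp τ, h2.comp τ⟩

/-- If compatible sequences of bases of `M ⊕ M` are related up to permutations, then permuting the
bases of `M` can be achieved by symmetric exchanges: only one of the two traces is permuted. -/
lemma rel₁_comp_of_sum
    (h : ∀ B D : (M.sum M).BaseSeq n, Compatible B D → Rel₂ B D) (B : M.BaseSeq n)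
    (σ : Equiv.Perm (Fin n)) : Rel₁ B (B ∘ σ) := by
  have hbase : ∀ B D : Set α, M.IsBase B → M.IsBase D →
      (M.sum M).IsBase (Sum.inl '' B ∪ Sum.inr '' D) := by
    intro B D hB hD
    rw [sum_isBase_iff]
    have h1 : Sum.inl ⁻¹' (Sum.inl '' B ∪ Sum.inr '' D) = B := by ext; simp
    have h2 : Sum.inr ⁻¹' (Sum.inl '' B ∪ Sum.inr '' D) = D := by ext; simp
    rw [h1, h2]; exact ⟨hB, hD⟩
  let S : M.BaseSeq n → M.BaseSeq n → (M.sum M).BaseSeq n := fun B D i =>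
    ⟨_, hbase (B i) (D i) (B i).2 (D i).2⟩
  have hleft : ∀ B D, leftSeq (S B D) = B := fun B D => funext fun i => Subtype.ext (by
    simp only [leftSeq, S]; ext; simp)
  have hright : ∀ B D, rightSeq (S B D) = D := fun B D => funext fun i => Subtype.ext (by
    simp only [rightSeq, S]; ext; simp)
  have hcomp : Compatible (S B B) (S B (B ∘ σ)) := by
    rintro (x | x)
    · simp [S]
    · have h1 : {i | Sum.inr x ∈ (S B B i : Set (α ⊕ α))} = {i | x ∈ (B i : Set α)} := by
        ext; simp [S]
      have h2 : {i | Sum.inr x ∈ (S B (B ∘ σ) i : Set (α ⊕ α))} =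
          σ.symm '' {i | x ∈ (B i : Set α)} := by
        ext; simp [S, Equiv.image_symm_eq_preimage]
      rw [h1, h2, Set.ncard_image_of_injective _ σ.symm.injective]
  obtain ⟨ρ, h1, h2⟩ := exists_perm_of_rel₂_sum (h _ _ hcomp)
  rw [hleft, hleft] at h1
  rw [hright, hright] at h2
  exact h1.symm.trans h2

lemma rel₁_of_rel₂ (h : ∀ (B : M.BaseSeq n) (σ : Equiv.Perm (Fin n)), Rel₁ B (B ∘ σ))
    (hBD : Rel₂ B D) : Rel₁ B D := by
  induction hBD with
  | refl => exact .refl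
  | tail _ hs ih =>
    rcases hs with hs | ⟨σ, rfl⟩
    · exact Relation.ReflTransGen.tail ih hs
    · exact Relation.ReflTransGen.trans ih (h _ σ)

end Sum

end Matroid

/-! ### Strongly base orderable matroids -/

section Matchings

open Equiv

/-- An involution without fixed points admits a 2-colouring in which every point differs from its
image. -/
lemma exists_bool_of_involutive {β : Type*} {s : β → β} (hs : Function.Involutive s)
    (hfix : ∀ x, s x ≠ x) : ∃ χ : β → Bool, ∀ x, χ (s x) = !χ x := by
  classical
  let _ : LinearOrder β := linearOrderOfSTO WellOrderingRel
  refine ⟨fun x => decide (x < s x), fun x => ?_⟩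
  dsimp only
  rw [hs x]
  rcases lt_or_gt_of_ne (hfix x) with h | h
  · simp [h, h.le]
  · simp [h, h.le]

/-- Two involutions without fixed points admit a common 2-colouring. An orbit of the product of
the involutions is disjoint from its image under each of them, and these images agree. -/
lemma exists_bool_of_perm_involutive {β : Type*} {s t : Perm β} (hs : s * s = 1) (ht : t * t = 1)
    (hsf : ∀ x, s x ≠ x) (htf : ∀ x, t x ≠ x) :
    ∃ χ : β → Bool, ∀ x, χ (s x) = !χ x ∧ χ (t x) = !χ x := by
  set r := s * t with hr
  have hsi : s⁻¹ = s := inv_eq_of_mul_eq_one_left hs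
  have hti : t⁻¹ = t := inv_eq_of_mul_eq_one_left ht
  have hrinv : s * r * s⁻¹ = r⁻¹ := by
    rw [hr, mul_inv_rev, hsi, hti, ← mul_assoc, hs, one_mul]
  have hpow : ∀ (k : ℤ) x, s ((r ^ k) x) = (r ^ (-k)) (s x) := by
    intro k x
    have h1 : s * r ^ k = r ^ (-k) * s := by
      rw [zpow_neg, ← inv_zpow, ← hrinv, conj_zpow]; group
    exact congrArg (fun p : Perm β => p x) h1
  have htr : t = s * r := by rw [hr, ← mul_assoc, hs, one_mul]
  let q := Perm.SameCycle.setoid r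
  have hnot : ∀ x, ¬ r.SameCycle (s x) x := by
    rintro x ⟨k, hk⟩
    have hss : s (s x) = x := congrArg (fun p : Perm β => p x) hs
    obtain ⟨l, rfl | rfl⟩ := Int.even_or_odd' k
    · refine hsf ((r ^ l) (s x)) ?_
      rw [hpow, hss, zpow_neg, Perm.inv_eq_iff_eq, ← Perm.mul_apply, ← zpow_add, ← two_mul, hk]
    · refine htf ((r ^ l) (s x)) ?_
      rw [htr, Perm.mul_apply, ← Perm.mul_apply r, ← zpow_one_add, hpow, hss, zpow_neg,
        Perm.inv_eq_iff_eq, ← Perm.mul_apply, ← zpow_add, show 1 + l + l = 2 * l + 1 by ring, hk]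
  let s' : Quotient q → Quotient q := Quotient.map s (fun x y hxy => by
    obtain ⟨k, hk⟩ := hxy
    exact ⟨-k, by rw [← hk, hpow]⟩)
  obtain ⟨χ, hχ⟩ := exists_bool_of_involutive (s := s')
    (fun x => by
      induction x using Quotient.inductionOn with
      | _ x => exact congrArg _ (congrArg (fun p : Perm β => p x) hs))
    (fun x => by
      induction x using Quotient.inductionOn with
      | _ x => exact fun h => hnot x (Quotient.exact h))
  refine ⟨fun x => χ (Quotient.mk q x), fun x => ⟨hχ (Quotient.mk q x), ?_⟩⟩
  have h3 : Quotient.mk q (t x) = Quotient.mk q (s x) := by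
    refine Quotient.sound ⟨1, ?_⟩
    rw [zpow_one, hr, Perm.mul_apply, show t (t x) = x from congrArg (fun p : Perm β => p x) ht]
  dsimp only
  rw [h3]
  exact hχ (Quotient.mk q x)

/-- The union of two matchings is bipartite. -/
lemma exists_bool_of_two_involutive {α : Type*} {s t : α → α} (hs : Function.Involutive s)
    (ht : Function.Involutive t) :
    ∃ χ : α → Bool, ∀ x, (s x ≠ x → χ (s x) = !χ x) ∧ (t x ≠ x → χ (t x) = !χ x) := by
  classical
  -- fixed points are removed by passing to two copies, which are interchanged there
  have double : ∀ {s : α → α}, Function.Involutive s → ∃ p : Perm (α × Bool), p * p = 1 ∧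
      (∀ x, p x ≠ x) ∧ ∀ x, s x ≠ x → p (x, false) = (s x, false) := by
    intro s hs
    let f : α × Bool → α × Bool := fun x => if s x.1 = x.1 then (x.1, !x.2) else (s x.1, x.2)
    have hf : Function.Involutive f := by
      rintro ⟨x, b⟩
      by_cases h : s x = x
      · simp [f, h]
      · have h' : ¬ s (s x) = s x := by rw [hs x]; exact fun h' => h h'.symm
        have h1 : f (x, b) = (s x, b) := if_neg h
        have h2 : f (s x, b) = (s (s x), b) := if_neg h'
        rw [h1, h2, hs x]
    refine ⟨hf.toPerm, Equiv.ext hf, ?_, fun x hx => if_neg hx⟩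
    rintro ⟨x, b⟩ hx
    by_cases h : s x = x
    · have h1 : f (x, b) = (x, !b) := if_pos h
      have h2 : f (x, b) = (x, b) := hx
      rw [h1] at h2
      simp at h2
    · have h1 : f (x, b) = (s x, b) := if_neg h
      have h2 : f (x, b) = (x, b) := hx
      rw [h1] at h2
      exact h (Prod.ext_iff.1 h2).1
  obtain ⟨p, hp, hpf, hps⟩ := double hs
  obtain ⟨q, hq, hqf, hqt⟩ := double ht
  obtain ⟨χ, hχ⟩ := exists_bool_of_perm_involutive hp hq hpf hqf
  refine ⟨fun x => χ (x, false), fun x => ⟨fun h => ?_, fun h => ?_⟩⟩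
  · have := (hχ (x, false)).1
    rwa [hps x h] at this
  · have := (hχ (x, false)).2
    rwa [hqt x h] at this

end Matchings

namespace Matroid

open Finset

variable {α : Type*} {M : Matroid α} {n : ℕ} {B D : M.BaseSeq n}

section StronglyBaseOrderable

lemma eq_of_mem_inter {B₁ B₂ : Set α} {π : α → α} (hπ : Set.BijOn π B₁ B₂) (h₁ : M.IsBase B₁)
    (hA : ∀ A ⊆ B₁, M.IsBase ((B₁ \ A) ∪ π '' A)) {x : α} (hx₁ : x ∈ B₁) (hx₂ : x ∈ B₂) :
    π x = x := by
  obtain ⟨z, hz, rfl⟩ := hπ.surjOn hx₂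
  by_contra hne
  have hne' : π z ≠ z := fun h => hne (by rw [h, h])
  have hb := hA {z} (by simpa using hz)
  rw [Set.image_singleton, Set.union_singleton] at hb
  exact h₁.notMem_of_insert_sdiff hz hb hne'.symm hx₁

/-- All elements of `A` can be exchanged for their images one by one. -/
lemma exists_rel₁_image {i j : Fin n} (hij : i ≠ j) {π : α → α}
    (hπ : Set.BijOn π (B i : Set α) (B j))
    (hA : ∀ A ⊆ (B i : Set α), M.IsBase (((B i : Set α) \ A) ∪ π '' A)) (A : Finset α)
    (hAi : (A : Set α) ⊆ (B i : Set α) \ B j) :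
    ∃ B' : M.BaseSeq n, Rel₁ B B' ∧ (B' i : Set α) = ((B i : Set α) \ A) ∪ π '' A ∧
      (B' j : Set α) = ((B j : Set α) \ π '' A) ∪ A ∧ ∀ k, k ≠ i → k ≠ j → B' k = B k := by
  classical
  induction A using Finset.induction_on with
  | empty => exact ⟨B, .refl, by simp, by simp, fun _ _ _ => rfl⟩
  | insert a A haA ih =>
    rw [coe_insert, Set.insert_subset_iff] at hAi
    obtain ⟨B', hB', hi, hj, hk⟩ := ih hAi.2
    have hbase₁ := hA (insert a A : Finset α) (by
      rw [coe_insert]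
      exact Set.insert_subset hAi.1.1 fun x hx => (hAi.2 hx).1)
    have hbase₂ : M.IsBase (((B j : Set α) \ π '' (insert a A : Finset α)) ∪
        (insert a A : Finset α)) := by
      have hsub : ((insert a A : Finset α) : Set α) ⊆ B i := by
        rw [coe_insert]
        exact Set.insert_subset hAi.1.1 fun x hx => (hAi.2 hx).1
      have h1 := hA ((B i : Set α) \ (insert a A : Finset α)) Set.sdiff_subset
      rwa [Set.sdiff_sdiff_cancel_left hsub, hπ.injOn.image_sdiff_subset hsub, hπ.image_eq,
        Set.union_comm] at h1
    let D : M.BaseSeq n := Function.update (Function.update B' i ⟨_, hbase₁⟩) j ⟨_, hbase₂⟩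
    have hDi : (D i : Set α) = ((B i : Set α) \ (insert a A : Finset α)) ∪
        π '' (insert a A : Finset α) := by
      simp only [D]
      rw [Function.update_of_ne hij, Function.update_self]
    have hDj : (D j : Set α) = ((B j : Set α) \ π '' (insert a A : Finset α)) ∪
        (insert a A : Finset α) := by
      simp only [D]
      rw [Function.update_self]
    have hDk : ∀ k, k ≠ i → k ≠ j → D k = B' k := fun k hki hkj => by
      simp only [D]
      rw [Function.update_of_ne hkj, Function.update_of_ne hki]
    refine ⟨D, hB'.tail ⟨i, j, hij, ⟨(B' i).2, (B' j).2, (D i).2, (D j).2, a, ?_, π a, ?_, ?_, ?_⟩,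
      hDk⟩, hDi, hDj, fun k hki hkj => (hDk k hki hkj).trans (hk k hki hkj)⟩
    · rw [hi]; exact Or.inl ⟨hAi.1.1, haA⟩
    · rw [hj]
      refine Or.inl ⟨hπ.mapsTo hAi.1.1, ?_⟩
      rintro ⟨x, hx, hxa⟩
      exact haA (hπ.injOn (hAi.2 hx).1 hAi.1.1 hxa ▸ hx)
    · rw [hDi, hi, coe_insert, Set.image_insert_eq]
      have h1 : a ∉ π '' (A : Set α) := by
        rintro ⟨x, hx, rfl⟩
        exact hAi.1.2 (hπ.mapsTo (hAi.2 hx).1)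
      ext x
      simp only [Set.mem_union, Set.mem_sdiff, Set.mem_insert_iff, Set.mem_singleton_iff]
      have h2 : x ∈ π '' (A : Set α) → x ≠ a := by rintro hx rfl; exact h1 hx
      tauto
    · rw [hDj, hj, coe_insert, Set.image_insert_eq]
      have h1 : π a ∉ (A : Set α) := fun h => (hAi.2 h).2 (hπ.mapsTo hAi.1.1)
      ext x
      simp only [Set.mem_union, Set.mem_sdiff, Set.mem_insert_iff, Set.mem_singleton_iff]
      have h2 : x ∈ (A : Set α) → x ≠ π a := by rintro hx rfl; exact h1 hx
      tauto

/-- The bijection between the bases at positions `i` and `j` induces a matching on their symmetric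
difference. Each 2-colouring of this matching prescribes a new distribution of the symmetric
difference among the two positions, which can be realized by symmetric exchanges. -/
lemma StronglyBaseOrderable.exists_involutive (hM : M.StronglyBaseOrderable) (hE : M.E.Finite)
    (B : M.BaseSeq n) {i j : Fin n} (hij : i ≠ j) :
    ∃ s : α → α, Function.Involutive s ∧ ∀ χ : α → Bool, (∀ x, s x ≠ x → χ (s x) = !χ x) →
      ∃ B' : M.BaseSeq n, Rel₁ B B' ∧
        (∀ x, x ∈ (B' i : Set α) ↔ (x ∈ (B i : Set α) ∧ x ∈ (B j : Set α)) ∨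
          ((x ∈ (B i : Set α) ∨ x ∈ (B j : Set α)) ∧ χ x = true)) ∧
        (∀ x, x ∈ (B' j : Set α) ↔ (x ∈ (B i : Set α) ∧ x ∈ (B j : Set α)) ∨
          ((x ∈ (B i : Set α) ∨ x ∈ (B j : Set α)) ∧ χ x = false)) ∧
        ∀ k, k ≠ i → k ≠ j → B' k = B k := by
  classical
  obtain ⟨π, hπ, hA⟩ := hM _ _ (B i).2 (B j).2
  have hex : ∀ x, ∃ y, x ∈ (B j : Set α) → y ∈ (B i : Set α) ∧ π y = x := by
    intro x
    by_cases hx : x ∈ (B j : Set α)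
    · obtain ⟨y, hy, hyx⟩ := hπ.surjOn hx
      exact ⟨y, fun _ => ⟨hy, hyx⟩⟩
    · exact ⟨x, fun h => absurd h hx⟩
  choose ψ hψ using hex
  have hψm : ∀ x ∈ (B j : Set α), ψ x ∈ (B i : Set α) := fun x hx => (hψ x hx).1
  have hπψ : ∀ x ∈ (B j : Set α), π (ψ x) = x := fun x hx => (hψ x hx).2
  have hψπ : ∀ x ∈ (B i : Set α), ψ (π x) = x := fun x hx =>
    hπ.injOn (hψm _ (hπ.mapsTo hx)) hx (hπψ _ (hπ.mapsTo hx))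
  have hfix : ∀ x ∈ (B i : Set α), x ∈ (B j : Set α) → π x = x := fun x h1 h2 =>
    eq_of_mem_inter hπ (B i).2 hA h1 h2
  have hπ' : ∀ x ∈ (B i : Set α), x ∉ (B j : Set α) → π x ∉ (B i : Set α) := by
    intro x h1 h2 h3
    have h4 := hπ.mapsTo h1
    rw [hπ.injOn h3 h1 (hfix _ h3 h4)] at h4
    exact h2 h4
  have hψ' : ∀ x ∈ (B j : Set α), x ∉ (B i : Set α) → ψ x ∉ (B j : Set α) := by
    intro x h1 h2 h3
    have h4 := hfix _ (hψm x h1) h3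
    rw [hπψ x h1] at h4
    exact h2 (h4 ▸ hψm x h1)
  let s : α → α := fun x => if x ∈ (B i : Set α) ∧ x ∉ (B j : Set α) then π x else
    if x ∈ (B j : Set α) ∧ x ∉ (B i : Set α) then ψ x else x
  have hs₁ : ∀ x ∈ (B i : Set α), x ∉ (B j : Set α) → s x = π x := fun x h1 h2 => if_pos ⟨h1, h2⟩
  have hs₂ : ∀ x ∈ (B j : Set α), x ∉ (B i : Set α) → s x = ψ x := fun x h1 h2 => by
    simp only [s]
    rw [if_neg (fun h => h2 h.1), if_pos ⟨h1, h2⟩]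
  refine ⟨s, fun x => ?_, fun χ hχ => ?_⟩
  · by_cases h1 : x ∈ (B i : Set α) ∧ x ∉ (B j : Set α)
    · rw [hs₁ x h1.1 h1.2, hs₂ _ (hπ.mapsTo h1.1) (hπ' x h1.1 h1.2), hψπ x h1.1]
    · by_cases h2 : x ∈ (B j : Set α) ∧ x ∉ (B i : Set α)
      · rw [hs₂ x h2.1 h2.2, hs₁ _ (hψm x h2.1) (hψ' x h2.1 h2.2), hπψ x h2.1]
      · have h3 : s x = x := by
          simp only [s]
          rw [if_neg h1, if_neg h2]
        rw [h3, h3]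
  · have hχ₁ : ∀ x ∈ (B i : Set α), x ∉ (B j : Set α) → χ (π x) = !χ x := by
      intro x h1 h2
      rw [← hs₁ x h1 h2]
      refine hχ x fun h => h2 ?_
      rw [← h, hs₁ x h1 h2]; exact hπ.mapsTo h1
    have hχ₂ : ∀ x ∈ (B j : Set α), x ∉ (B i : Set α) → χ (ψ x) = !χ x := by
      intro x h1 h2
      rw [← hs₂ x h1 h2]
      refine hχ x fun h => h2 ?_
      rw [← h, hs₂ x h1 h2]; exact hψm x h1
    let A : Finset α := hE.toFinset.filter fun x =>
      x ∈ (B i : Set α) ∧ x ∉ (B j : Set α) ∧ χ x = false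
    have memA : ∀ x, x ∈ (A : Set α) ↔ x ∈ (B i : Set α) ∧ x ∉ (B j : Set α) ∧ χ x = false := by
      intro x
      simp only [A, coe_filter, Set.Finite.mem_toFinset, Set.mem_ofPred_eq]
      exact ⟨fun h => h.2, fun h => ⟨(B i).2.subset_ground h.1, h⟩⟩
    have memπA : ∀ x, x ∈ π '' (A : Set α) ↔
        x ∈ (B j : Set α) ∧ x ∉ (B i : Set α) ∧ χ x = true := by
      intro x
      constructor
      · rintro ⟨a, ha, rfl⟩
        obtain ⟨h1, h2, h3⟩ := (memA a).1 ha
        exact ⟨hπ.mapsTo h1, hπ' a h1 h2, by rw [hχ₁ a h1 h2, h3]; rfl⟩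
      · rintro ⟨h1, h2, h3⟩
        exact ⟨ψ x, (memA _).2 ⟨hψm x h1, hψ' x h1 h2, by rw [hχ₂ x h1 h2, h3]; rfl⟩, hπψ x h1⟩
    obtain ⟨B', hB', hi, hj, hk⟩ := exists_rel₁_image hij hπ hA A
      fun x hx => ⟨((memA x).1 hx).1, ((memA x).1 hx).2.1⟩
    refine ⟨B', hB', fun x => ?_, fun x => ?_, hk⟩
    · rw [hi, Set.mem_union, Set.mem_sdiff, memA, memπA]
      cases χ x <;> by_cases h1 : x ∈ (B i : Set α) <;> by_cases h2 : x ∈ (B j : Set α) <;>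
        simp [h1, h2]
    · rw [hj, Set.mem_union, Set.mem_sdiff, memA, memπA]
      cases χ x <;> by_cases h1 : x ∈ (B i : Set α) <;> by_cases h2 : x ∈ (B j : Set α) <;>
        simp [h1, h2]

lemma sum_le_of_pair {g g' : Fin n → ℕ} {i j : Fin n} (hij : i ≠ j)
    (hk : ∀ k, k ≠ i → k ≠ j → g k = g' k) :
    (g i + g j ≤ g' i + g' j → ∑ k, g k ≤ ∑ k, g' k) ∧
    (g i + g j < g' i + g' j → ∑ k, g k < ∑ k, g' k) := by
  have hsplit : ∀ g : Fin n → ℕ, ∑ k, g k = g i + g j + ∑ k ∈ (univ.erase i).erase j, g k := by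
    intro g
    rw [← add_sum_erase _ _ (mem_univ i), ← add_sum_erase (univ.erase i) _
      (mem_erase.2 ⟨hij.symm, mem_univ j⟩), add_assoc]
  have hrest : ∑ k ∈ (univ.erase i).erase j, g k = ∑ k ∈ (univ.erase i).erase j, g' k :=
    sum_congr rfl fun k hkm => by
      simp only [mem_erase] at hkm
      exact hk k hkm.2.1 hkm.1
  rw [hsplit g, hsplit g', hrest]
  constructor <;> intro h <;> omega

open Classical in
lemma ncard_eq_sum (B : M.BaseSeq n) (x : α) :
    {i | x ∈ (B i : Set α)}.ncard = ∑ k, if x ∈ (B k : Set α) then 1 else 0 := by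
  rw [← card_filter, Set.ncard_eq_toFinset_card', Set.toFinset_ofPred]

/-- Compatible sequences of bases of a strongly base orderable matroid can be made to agree at more
and more elements: if `e` occurs in the first sequence at position `i` but not at `j`, and in the
second one at `j` but not at `i`, then a common 2-colouring of the two matchings on the symmetric
differences prescribes exchanges in both sequences after which they agree more. -/
theorem rel₁_of_stronglyBaseOrderable (hM : M.StronglyBaseOrderable) (hE : M.E.Finite)
    (hBD : Compatible B D) : Rel₁ B D := by
  classical
  let ag : M.BaseSeq n → M.BaseSeq n → ℕ := fun B D =>
    ∑ x ∈ hE.toFinset, ∑ k, if x ∈ (B k : Set α) ∧ x ∈ (D k : Set α) then 1 else 0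
  have hbound : ∀ B D, ag B D ≤ hE.toFinset.card * n := by
    intro B D
    refine sum_le_card_nsmul _ _ _ fun x _ => ?_
    refine (sum_le_card_nsmul _ _ 1 fun k _ => ?_).trans (by simp)
    split_ifs <;> simp
  obtain ⟨N, hN⟩ : ∃ N, N = hE.toFinset.card * n - ag B D := ⟨_, rfl⟩
  induction N using Nat.strong_induction_on generalizing B D with
  | _ N ih =>
    by_cases heq : B = D
    · rw [heq]; exact .refl
    obtain ⟨i, e, hei, hei'⟩ : ∃ i e, e ∈ (B i : Set α) ∧ e ∉ (D i : Set α) := by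
      by_contra! hcon
      exact heq (funext fun i => Subtype.ext ((B i).2.eq_of_subset_isBase (D i).2 (hcon i)))
    obtain ⟨j, hej, hej'⟩ : ∃ j, e ∈ (D j : Set α) ∧ e ∉ (B j : Set α) := by
      by_contra! hcon
      have h1 : {k | e ∈ (D k : Set α)} = {k | e ∈ (B k : Set α)} :=
        Set.eq_of_subset_of_ncard_le hcon (hBD e).le
      have h2 : i ∈ {k | e ∈ (B k : Set α)} := hei
      rw [← h1] at h2
      exact hei' h2
    have hij : i ≠ j := by rintro rfl; exact hej' hei
    obtain ⟨s, hs, hsB⟩ := hM.exists_involutive hE B hij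
    obtain ⟨t, ht, htD⟩ := hM.exists_involutive hE D hij
    obtain ⟨χ, hχ⟩ := exists_bool_of_two_involutive hs ht
    obtain ⟨B', hB', hBi, hBj, hBk⟩ := hsB χ fun x => (hχ x).1
    obtain ⟨D', hD', hDi, hDj, hDk⟩ := htD χ fun x => (hχ x).2
    have hcomp : ∀ {B B' : M.BaseSeq n} {χ : α → Bool},
        (∀ x, x ∈ (B' i : Set α) ↔ (x ∈ (B i : Set α) ∧ x ∈ (B j : Set α)) ∨
          ((x ∈ (B i : Set α) ∨ x ∈ (B j : Set α)) ∧ χ x = true)) →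
        (∀ x, x ∈ (B' j : Set α) ↔ (x ∈ (B i : Set α) ∧ x ∈ (B j : Set α)) ∨
          ((x ∈ (B i : Set α) ∨ x ∈ (B j : Set α)) ∧ χ x = false)) →
        (∀ k, k ≠ i → k ≠ j → B' k = B k) → Compatible B' B := by
      intro B B' χ h1 h2 h3 x
      rw [ncard_eq_sum, ncard_eq_sum]
      refine le_antisymm ((sum_le_of_pair hij fun k hki hkj => ?_).1 ?_)
        ((sum_le_of_pair hij fun k hki hkj => ?_).1 ?_)
      · rw [h3 k hki hkj]
      · simp only [h1 x, h2 x]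
        cases χ x <;> by_cases h4 : x ∈ (B i : Set α) <;> by_cases h5 : x ∈ (B j : Set α) <;>
          simp [h4, h5]
      · rw [h3 k hki hkj]
      · simp only [h1 x, h2 x]
        cases χ x <;> by_cases h4 : x ∈ (B i : Set α) <;> by_cases h5 : x ∈ (B j : Set α) <;>
          simp [h4, h5]
    have hlt : ag B D < ag B' D' := by
      have hk : ∀ x k, k ≠ i → k ≠ j →
          (if x ∈ (B k : Set α) ∧ x ∈ (D k : Set α) then 1 else 0) =
          (if x ∈ (B' k : Set α) ∧ x ∈ (D' k : Set α) then 1 else 0) := by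
        intro x k hki hkj
        rw [hBk k hki hkj, hDk k hki hkj]
      refine sum_lt_sum (fun x _ => (sum_le_of_pair hij (hk x)).1 ?_)
        ⟨e, by simpa using (B i).2.subset_ground hei, (sum_le_of_pair hij (hk e)).2 ?_⟩
      · simp only [hBi x, hBj x, hDi x, hDj x]
        cases χ x <;> by_cases h1 : x ∈ (B i : Set α) <;> by_cases h2 : x ∈ (B j : Set α) <;>
          by_cases h3 : x ∈ (D i : Set α) <;> by_cases h4 : x ∈ (D j : Set α) <;>
          simp [h1, h2, h3, h4]
      · simp only [hBi e, hBj e, hDi e, hDj e]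
        cases χ e <;> simp [hei, hei', hej, hej']
    have hcomp' : Compatible B' D' := fun x =>
      ((hcomp hBi hBj hBk x).trans (hBD x)).trans (hcomp hDi hDj hDk x).symm
    have hb := hbound B' D'
    exact (hB'.trans (ih _ (by omega) hcomp' rfl)).trans hD'.symm

end StronglyBaseOrderable

end Matroid

theorem mainTheorem4 :
    (∀ 𝒞 : Set FinMatroid.{u}, FinMatroid.ClosedUnderDirectSums 𝒞 →
      (𝒞 ⊆ FinMatroid.TE₁ ↔ 𝒞 ⊆ FinMatroid.TE₂)) ∧
    (∀ M : FinMatroid.{u}, M.toMatroid.StronglyBaseOrderable → M ∈ FinMatroid.TE₁) ∧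
    (∀ M : FinMatroid.{u}, M.toMatroid.Graphical → M ∈ FinMatroid.TE₁) ∧
    (∀ M : FinMatroid.{u}, M.toMatroid.Cographical → M ∈ FinMatroid.TE₁) ∧
    (FinMatroid.TE₁.{u} = Set.univ ↔ FinMatroid.TE₂.{u} = Set.univ) := by
  have hsum : ∀ 𝒞 : Set FinMatroid.{u}, FinMatroid.ClosedUnderDirectSums 𝒞 →
      (𝒞 ⊆ FinMatroid.TE₁ ↔ 𝒞 ⊆ FinMatroid.TE₂) := by
    refine fun 𝒞 h𝒞 => ⟨fun h M hM n hn B D hBD => (h hM n hn B D hBD).rel₂,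
      fun h M hM n hn B D hBD => ?_⟩
    exact Matroid.rel₁_of_rel₂ (Matroid.rel₁_comp_of_sum (h (h𝒞 M hM M hM) n hn))
      (h hM n hn B D hBD)
  refine ⟨hsum,
    fun M hM n _ B D hBD => Matroid.rel₁_of_stronglyBaseOrderable hM M.finite_ground hBD,
    fun M hM n _ B D hBD => BaseExchange.rel₁_of_graphical M.finite_ground hM hBD,
    fun M hM n _ B D hBD => Matroid.rel₁_of_dual
      (fun _ _ => BaseExchange.rel₁_of_graphical (M := M.toMatroid.dual) M.finite_ground hM) hBD,
    ?_⟩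
  simpa [Set.univ_subset_iff] using hsum Set.univ fun _ _ _ _ => Set.mem_univ _
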